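/- All graphs are finite and simple, and all weight functions take values in $\mathbb{N}$; $\mathbf{w}(A)=\sum_{v\in A}\mathbf{w}(v)$. **Extended strip decompositions.** An extended strip decomposition $(H,\eta)$ of a graph $G$ consists of a non-empty simple graph $H$, sets $\eta(v),\eta(e),\eta(T)\subseteq V(G)$ for every vertex $v$, edge $e$ and triangle $T$ of $H$, and sets $\eta(e,u),\eta(e,v)\subseteq\eta(e)$ for every edge $e=uv$ of $H$, such that (1) the sets $\eta(v),\eta(e),\eta(T)$ (some possibly empty) partition $V(G)$; (2) for any two distinct edges $vu,vu'$ of $H$, the set $\eta(vu,v)$ is fully adjacent to $\eta(vu',v)$ in $G$; (3) every edge $xy$ of $G$ either has both ends in one of the sets $\eta(v),\eta(e),\eta(T)$, or, up to exchanging $x$ and $y$, satisfies one of: $x\in\eta(e,v)$ and $y\in\eta(e',v)$ for two distinct edges $e,e'$ of $H$ incident with $v$; $x\in\eta(v)$ and $y\in\eta(e,v)$ for an edge $e$ of $H$ incident with $v$; $x\in\eta(T)$ and $y\in\eta(e,u)\cap\eta(e,v)$ for an edge $e=uv$ of a triangle $T$ of $H$. Its atoms are $\eta(v)$ for $v\in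 V(H)$, $\eta(T)$ for triangles $T$ of $H$, and, for every edge $e=uv$ of $H$, the sets $\eta(e)\setminus(\eta(e,u)\cup\eta(e,v))$, $\eta(u)\cup(\eta(e)\setminus\eta(e,v))$, $\eta(v)\cup(\eta(e)\setminus\eta(e,u))$ and $\eta(u)\cup\eta(v)\cup\eta(e)\cup\bigcup_{T\ni u,v}\eta(T)$. An atom is trivial if it is $\eta(v)$ for an isolated vertex $v$ of $H$ and consists of a single isolated vertex of $G$. **Dispersers.** Let $G$ be a graph with weight function $\mathbf{w}$ and let $\gamma,\delta>0$. A pair $(X,(H,\eta))$, where $X\subseteq V(G)$ and $(H,\eta)$ is an extended strip decomposition of $G-X$, is $(\gamma,\delta)$-good for $G$ and $\mathbf{w}$ if $\mathbf{w}(X)\le\gamma\,\mathbf{w}(V(G))$ and every nontrivial atom $A$ satisfies $\mathbf{w}(A)\le(1-\delta)\,\mathbf{w}(V(G))$ and $\mathbf{w}(X)\le\gamma\,\mathbf{w}(V(G)\setminus A)$. A $(\gamma,\delta)$-disperser for $G$ and $\mathbf{w}$ is a finite family $\mathcal{D}$ of such pairs $(X,(H,\eta))$ such that for every independent set $I$ of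 $G$ with $\mathbf{w}(I)>0$ some member of $\mathcal{D}$ is $(\gamma,\delta)$-good for $G$ and $\mathbf{w}_I$, where $\mathbf{w}_I$ equals $\mathbf{w}$ on $I$ and $0$ elsewhere. **Running times** are counted in unit-cost steps (addition, truncated subtraction and zero-testing of natural numbers, and the formation, inspection and taking apart of pairs cost one step each), so that time bounds depend on the number of vertices and not on the bit length of the weights. **Theorem 5.** Let $\mathcal{C}$ be a hereditary graph class (closed under induced subgraphs). Suppose that there are an algorithm $P$ and a polynomial $p$ in two variables such that for every rational $\gamma\in(0,1/2)$ there are a nonincreasing function $\delta\colon\mathbb{N}\to(0,1/2)$ and nondecreasing functions $\mathbf{S},\mathbf{T}\colon\mathbb{N}\to\mathbb{N}$ with $$\delta(n)^{-1}\le p(\log n,\gamma^{-1}),\qquad \mathbf{S}(n)\le 2^{p(\log n,\gamma^{-1})},\qquad \mathbf{T}(n)\le 2^{p(\log n,\gamma^{-1})}\qquad(n\in\mathbb{N}, \text{ with } \log 0:=0),$$ for which $P$, given $\gamma$, any $n$-vertex graph $G\in\mathcal{C}$ and any $\mathbf{w}\colon V(G)\to\mathbb{N}$, computes in time at most $\mathbf{T}(n)$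 a $(\gamma,\delta(n))$-disperser for $G$ and $\mathbf{w}$ of size at most $\mathbf{S}(n)$. Then Maximum Weight Independent Set restricted to $\mathcal{C}$ admits a QPTAS: there are an algorithm and a polynomial $q$ such that, given a rational $\varepsilon>0$, an $n$-vertex graph $G\in\mathcal{C}$ and $\mathbf{w}\colon V(G)\to\mathbb{N}$, the algorithm outputs, in time at most $2^{q(\log n,\varepsilon^{-1})}$, an independent set $I$ of $G$ with $\mathbf{w}(I)\ge(1-\varepsilon)\,\mathbf{w}(J)$ for every independent set $J$ of $G$. -/

import Mathlib

/-! ### The model of computation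

Programs of a small functional language act on binary trees with natural numbers at the leaves.
Every elementary operation costs one step. With trees stored as pointers to shared immutable cells,
each step is a bounded number of operations of a random access machine with unit-cost addition,
subtraction and comparison of naturals (and no multiplication); conversely such a machine is
simulated with polynomial overhead, its memory being kept as a list of address-value pairs.
In particular the running time does not depend on the bit length of the numbers in the input. -/

/-- The data on which programs act. -/
inductive Val : Type
  | num : ℕ → Val
  | pair : Val → Val → Val

namespace Val

/-- First component (`0` for a number). -/
def first : Val → Val
  | num _ => num 0
  | pair a _ => a

/-- Second component (`0` for a number). -/
def second : Val → Val
  | num _ => num 0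
  | pair _ b => b

/-- Test for being a pair (`1` for a pair, `0` for a number). -/
def testPair : Val → Val
  | num _ => num 0
  | pair _ _ => num 1

/-- Sum of the two components of a pair of numbers (`0` for values of any other shape). -/
def plus : Val → Val
  | pair (num a) (num b) => num (a + b)
  | _ => num 0

/-- Truncated difference of the two components of a pair of numbers
(`0` for values of any other shape). -/
def minus : Val → Val
  | pair (num a) (num b) => num (a - b)
  | _ => num 0

/-- A list of values as a value: `0` is the empty list, a pair is a head and a tail. -/
def ofList : List Val → Val
  | [] => num 0
  | a :: l => pair a (ofList l)

/-- The list `f 0, …, f (n - 1)` as a value. -/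
def table {n : ℕ} (f : Fin n → Val) : Val := ofList (List.ofFn f)

end Val

/-- Programs. -/
inductive Code : Type
  | lit : ℕ → Code
  | ident : Code
  | first : Code
  | second : Code
  | testPair : Code
  | plus : Code
  | minus : Code
  | pair : Code → Code → Code
  | comp : Code → Code → Code
  | cond : Code → Code → Code → Code
  | loop : Code → Code → Code

/-- `Runs p x y t`: on input `x` the program `p` halts with output `y` after exactly `t` steps. -/
inductive Runs : Code → Val → Val → ℕ → Prop
  | lit (k : ℕ) (x : Val) : Runs (.lit k) x (.num k) 1
  | ident (x : Val) : Runs .ident x x 1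
  | first (x : Val) : Runs .first x x.first 1
  | second (x : Val) : Runs .second x x.second 1
  | testPair (x : Val) : Runs .testPair x x.testPair 1
  | plus (x : Val) : Runs .plus x x.plus 1
  | minus (x : Val) : Runs .minus x x.minus 1
  /-- `pair p q` maps `x` to the pair of `p x` and `q x`. -/
  | pair {p q : Code} {x y z : Val} {s t : ℕ} :
      Runs p x y s → Runs q x z t → Runs (.pair p q) x (.pair y z) (s + t + 1)
  /-- `comp p q` runs `q` and then `p` on the result. -/
  | comp {p q : Code} {x y z : Val} {s t : ℕ} :
      Runs q x y s → Runs p y z t → Runs (.comp p q) x z (s + t + 1)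
  /-- `cond b p q` runs `p` if `b` returns anything but `0`, and `q` if `b` returns `0`. -/
  | cond_true {b p q : Code} {x v y : Val} {s t : ℕ} :
      Runs b x v s → v ≠ .num 0 → Runs p x y t → Runs (.cond b p q) x y (s + t + 1)
  | cond_false {b p q : Code} {x y : Val} {s t : ℕ} :
      Runs b x (.num 0) s → Runs q x y t → Runs (.cond b p q) x y (s + t + 1)
  /-- `loop b p` replaces the current value by its image under `p` as long as
  `b` returns anything but `0`. -/
  | loop_stop {b p : Code} {x : Val} {s : ℕ} :
      Runs b x (.num 0) s → Runs (.loop b p) x x (s + 1)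
  | loop_step {b p : Code} {x v y z : Val} {s t r : ℕ} :
      Runs b x v s → v ≠ .num 0 → Runs p x y t → Runs (.loop b p) y z r →
      Runs (.loop b p) x z (s + t + r + 1)

/-! ### Graph classes, weights, independent sets -/

/-- A class of finite graphs, given by its members on the vertex sets `{0, …, n - 1}`. -/
def GraphClass : Type := ∀ n : ℕ, Set (SimpleGraph (Fin n))

/-- Closed under induced subgraphs (and hence under isomorphism). -/
def GraphClass.Hereditary (C : GraphClass) : Prop :=
  ∀ (m n : ℕ) (G' : SimpleGraph (Fin m)) (G : SimpleGraph (Fin n)),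
    G ∈ C n → Nonempty (G' ↪g G) → G' ∈ C m

/-- The weight of a set of vertices. -/
def weight {n : ℕ} (w : Fin n → ℕ) (A : Finset (Fin n)) : ℕ := ∑ v ∈ A, w v

/-- The weight function that agrees with `w` on `I` and vanishes outside `I`. -/
def restrictWeight {n : ℕ} (w : Fin n → ℕ) (I : Finset (Fin n)) : Fin n → ℕ :=
  fun v => if v ∈ I then w v else 0

/-- `I` is an independent set whose weight is at least `α` times that of any independent set. -/
def IsApproxMWIS {n : ℕ} (G : SimpleGraph (Fin n)) (w : Fin n → ℕ) (α : ℝ)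
    (I : Finset (Fin n)) : Prop :=
  G.IsIndepSet (I : Set (Fin n)) ∧
    ∀ J : Finset (Fin n), G.IsIndepSet (J : Set (Fin n)) → α * weight w J ≤ weight w I

/-! ### Extended strip decompositions -/

/-- Names for the parts of an extended strip decomposition whose graph has vertex set `Fin m`. -/
inductive StripPart (m : ℕ) : Type
  | vertex : Fin m → StripPart m
  | edge : Sym2 (Fin m) → StripPart m
  | triangle : Finset (Fin m) → StripPart m

/-- The data `(H, η)`: `η p` is the set of the part `p`, and `ηEnd e v` is the set `η(e, v)`.
Only edges, triangles and incident pairs of `H` matter. -/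
structure StripData (n : ℕ) where
  m : ℕ
  H : SimpleGraph (Fin m)
  η : StripPart m → Finset (Fin n)
  ηEnd : Sym2 (Fin m) → Fin m → Finset (Fin n)

namespace StripData

variable {n : ℕ} (S : StripData n)

/-- The vertices, edges and triangles of `H`. -/
def IsPart : StripPart S.m → Prop
  | .vertex _ => True
  | .edge e => e ∈ S.H.edgeSet
  | .triangle T => S.H.IsNClique 3 T

/-- The types of edges `xy` of the decomposed graph that join different parts. -/
def Crossing (x y : Fin n) : Prop :=
  (∃ v u u' : Fin S.m, S.H.Adj v u ∧ S.H.Adj v u' ∧ u ≠ u' ∧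
      x ∈ S.ηEnd s(v, u) v ∧ y ∈ S.ηEnd s(v, u') v) ∨
  (∃ v u : Fin S.m, S.H.Adj v u ∧ x ∈ S.η (.vertex v) ∧ y ∈ S.ηEnd s(v, u) v) ∨
  (∃ (T : Finset (Fin S.m)) (u v : Fin S.m), S.H.IsNClique 3 T ∧ u ∈ T ∧ v ∈ T ∧ u ≠ v ∧
      x ∈ S.η (.triangle T) ∧ y ∈ S.ηEnd s(u, v) u ∧ y ∈ S.ηEnd s(u, v) v)

/-- `S` is an extended strip decomposition of the induced subgraph `G[Y]`. -/
structure Decomposes (G : SimpleGraph (Fin n)) (Y : Finset (Fin n)) : Prop where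
  nonempty : 0 < S.m
  end_subset : ∀ u v : Fin S.m, S.H.Adj u v → S.ηEnd s(u, v) u ⊆ S.η (.edge s(u, v))
  part_subset : ∀ p : StripPart S.m, S.IsPart p → S.η p ⊆ Y
  partition : ∀ x ∈ Y, ∃! p : StripPart S.m, S.IsPart p ∧ x ∈ S.η p
  complete : ∀ v u u' : Fin S.m, S.H.Adj v u → S.H.Adj v u' → u ≠ u' →
    ∀ x ∈ S.ηEnd s(v, u) v, ∀ y ∈ S.ηEnd s(v, u') v, G.Adj x y
  edges : ∀ x ∈ Y, ∀ y ∈ Y, G.Adj x y →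
    (∃ p : StripPart S.m, S.IsPart p ∧ x ∈ S.η p ∧ y ∈ S.η p) ∨ S.Crossing x y ∨ S.Crossing y x

open Classical in
/-- The union of the sets `η(T)` over all triangles `T` of `H` that contain `u` and `v`. -/
noncomputable def trianglesAt (u v : Fin S.m) : Finset (Fin n) :=
  (Finset.univ.filter fun T : Finset (Fin S.m) => S.H.IsNClique 3 T ∧ u ∈ T ∧ v ∈ T).biUnion
    fun T => S.η (.triangle T)

/-- The atoms of `(H, η)`. -/
inductive IsAtom : Finset (Fin n) → Prop
  | bot (u v : Fin S.m) : S.H.Adj u v →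
      IsAtom (S.η (.edge s(u, v)) \ (S.ηEnd s(u, v) u ∪ S.ηEnd s(u, v) v))
  | one (u v : Fin S.m) : S.H.Adj u v →
      IsAtom (S.η (.vertex u) ∪ (S.η (.edge s(u, v)) \ S.ηEnd s(u, v) v))
  | full (u v : Fin S.m) : S.H.Adj u v →
      IsAtom (S.η (.vertex u) ∪ S.η (.vertex v) ∪ S.η (.edge s(u, v)) ∪ S.trianglesAt u v)
  | vertex (v : Fin S.m) : IsAtom (S.η (.vertex v))
  | triangle (T : Finset (Fin S.m)) : S.H.IsNClique 3 T → IsAtom (S.η (.triangle T))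

/-- `A` is `η(v)` for an isolated vertex `v` of `H`, and consists of one isolated vertex
of `G[Y]`. -/
def IsTrivialAtom (G : SimpleGraph (Fin n)) (Y A : Finset (Fin n)) : Prop :=
  ∃ v : Fin S.m, (∀ u : Fin S.m, ¬ S.H.Adj v u) ∧ A = S.η (.vertex v) ∧
    ∃ x : Fin n, A = {x} ∧ ∀ y ∈ Y, ¬ G.Adj x y

/-- Nontrivial atoms of an extended strip decomposition of `G[Y]`. -/
def IsNontrivialAtom (G : SimpleGraph (Fin n)) (Y A : Finset (Fin n)) : Prop :=
  S.IsAtom A ∧ ¬ S.IsTrivialAtom G Y A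

end StripData

/-! ### Dispersers -/

/-- `(X, (H, η))` is `δ`-shrinking for `G` and `w`; here `(H, η)` decomposes `G - X`. -/
def Shrinking {n : ℕ} (G : SimpleGraph (Fin n)) (w : Fin n → ℕ) (δ : ℝ)
    (X : Finset (Fin n)) (S : StripData n) : Prop :=
  ∀ A : Finset (Fin n), S.IsNontrivialAtom G Xᶜ A →
    (weight w A : ℝ) ≤ (1 - δ) * weight w Finset.univ

/-- `(X, (H, η))` is `γ`-safe for `G` and `w`; here `(H, η)` decomposes `G - X`. -/
def Safe {n : ℕ} (G : SimpleGraph (Fin n)) (w : Fin n → ℕ) (γ : ℝ)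
    (X : Finset (Fin n)) (S : StripData n) : Prop :=
  (weight w X : ℝ) ≤ γ * weight w Finset.univ ∧
  ∀ A : Finset (Fin n), S.IsNontrivialAtom G Xᶜ A → (weight w X : ℝ) ≤ γ * weight w Aᶜ

/-- The finite family `D` is a `(γ, δ)`-disperser for `G` and `w`. -/
def IsDisperser {n : ℕ} (G : SimpleGraph (Fin n)) (w : Fin n → ℕ) (γ δ : ℝ)
    (D : List (Finset (Fin n) × StripData n)) : Prop :=
  (∀ d ∈ D, d.2.Decomposes G d.1ᶜ) ∧
  ∀ I : Finset (Fin n), G.IsIndepSet (I : Set (Fin n)) → 0 < weight w I →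
    ∃ d ∈ D, Shrinking G (restrictWeight w I) δ d.1 d.2 ∧
      Safe G (restrictWeight w I) γ d.1 d.2

/-! ### Inputs and outputs of programs -/

/-- A set of vertices, as its list of `n` membership bits. -/
def encodeSet {n : ℕ} (A : Finset (Fin n)) : Val :=
  Val.table fun v => .num (if v ∈ A then 1 else 0)

open Classical in
/-- A rational parameter (numerator and denominator) together with a graph (number of vertices
and adjacency matrix) and a weight function. -/
noncomputable def encodeInput {n : ℕ} (q : ℚ) (G : SimpleGraph (Fin n)) (w : Fin n → ℕ) : Val :=
  .pair (.pair (.num q.num.toNat) (.num q.den))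
    (.pair (.num n)
      (.pair (Val.table fun u => Val.table fun v => .num (if G.Adj u v then 1 else 0))
        (Val.table fun v => .num (w v))))

open Classical in
/-- `(H, η)` as a triple of tables: the entry at `u` is `η(u)`; the entry at `u, v` is the pair
of `η(uv)` and `η(uv, u)` if `uv` is an edge of `H`, and `0` otherwise; the entry at `u, v, z`
is `η(uvz)` if `uvz` is a triangle of `H`, and `0` otherwise. -/
noncomputable def encodeStrip {n : ℕ} (S : StripData n) : Val :=
  .pair (Val.table fun u => encodeSet (S.η (.vertex u)))
    (.pair
      (Val.table fun u => Val.table fun v =>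
        if S.H.Adj u v then
          .pair (encodeSet (S.η (.edge s(u, v)))) (encodeSet (S.ηEnd s(u, v) u))
        else .num 0)
      (Val.table fun u => Val.table fun v => Val.table fun z =>
        if S.H.Adj u v ∧ S.H.Adj v z ∧ S.H.Adj u z then
          encodeSet (S.η (.triangle {u, v, z}))
        else .num 0))

/-- A disperser, as the list of its members. -/
noncomputable def encodeDisperser {n : ℕ} (D : List (Finset (Fin n) × StripData n)) : Val :=
  Val.ofList (D.map fun d => .pair (encodeSet d.1) (encodeStrip d.2))

/-! ### Dispersible classes and approximation schemes -/

/-- The program `P`, given `γ`, a graph of `C` with `n` vertices and a weight function, computes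
in time at most `T n` a `(γ, δ n)`-disperser of size at most `S n`. -/
def DispersesWith (C : GraphClass) (P : Code) (γ : ℚ) (δ : ℕ → ℝ) (S T : ℕ → ℕ) : Prop :=
  ∀ (n : ℕ) (G : SimpleGraph (Fin n)) (w : Fin n → ℕ), G ∈ C n →
    ∃ (D : List (Finset (Fin n) × StripData n)) (t : ℕ),
      Runs P (encodeInput γ G w) (encodeDisperser D) t ∧ t ≤ T n ∧
      IsDisperser G w (γ : ℝ) (δ n) D ∧ D.length ≤ S n

/-- The polynomial `c (1 + log n + x) ^ c`; every polynomial in `log n` and `x` is bounded, for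
nonnegative arguments, by one of this form. -/
noncomputable def polyLog (c n : ℕ) (x : ℝ) : ℝ := c * (1 + Real.log n + x) ^ c

/-- Quasi-polynomial dispersibility: one algorithm, which receives `γ`, and one polynomial in
`log n` and `γ⁻¹` serve all `γ`. -/
def QPDispersible (C : GraphClass) : Prop :=
  ∃ (P : Code) (c : ℕ), ∀ γ : ℚ, 0 < γ → γ < 1 / 2 →
    ∃ (δ : ℕ → ℝ) (S T : ℕ → ℕ),
      Antitone δ ∧ (∀ n, 0 < δ n ∧ δ n < 1 / 2) ∧ Monotone S ∧ Monotone T ∧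
      (∀ n, (δ n)⁻¹ ≤ polyLog c n (γ : ℝ)⁻¹) ∧
      (∀ n, (S n : ℝ) ≤ 2 ^ polyLog c n (γ : ℝ)⁻¹) ∧
      (∀ n, (T n : ℝ) ≤ 2 ^ polyLog c n (γ : ℝ)⁻¹) ∧
      DispersesWith C P γ δ S T

/-- MWIS on graphs of `C` admits a quasi-polynomial time approximation scheme: one algorithm,
given `ε > 0`, a graph of `C` with `n` vertices and a weight function, computes a
`(1 - ε)`-approximation in time exponential in a polynomial of `log n` and `ε⁻¹`. -/
def AdmitsQPTAS (C : GraphClass) : Prop :=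
  ∃ (P : Code) (c : ℕ), ∀ ε : ℚ, 0 < ε →
    ∀ (n : ℕ) (G : SimpleGraph (Fin n)) (w : Fin n → ℕ), G ∈ C n →
      ∃ (I : Finset (Fin n)) (t : ℕ),
        Runs P (encodeInput ε G w) (encodeSet I) t ∧
        (t : ℝ) ≤ 2 ^ polyLog c n (ε : ℝ)⁻¹ ∧
        IsApproxMWIS G w (1 - (ε : ℝ)) I

/-! One disperser for the whole graph drives a divide and conquer. It has a good member for every
independent set of positive weight, so the same family serves an unknown optimum and all the subsets
into which the optimum is later split. An instance is a vertex set `A`. For each member `(X, (H,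
η))` the set `X` is given up, the intersections of `A` with the atoms are solved recursively, the
solutions are merged, and the best outcome over all members is kept.

Splitting and merging. Let `I` be an independent set. The sets `η(uv, u)` at a vertex `u` of `H` are
pairwise fully adjacent, so `I` meets at most one of them (`Hits.unique`). Hence `I` outside `X` is
a disjoint union of pieces (`Chosen.eq_of_mem`, `exists_chosen`), and the pieces that merge several
parts form a matching in an auxiliary graph whose nodes are the vertices and edges of `H`
(`Chosen.eq_of_clash`). Conversely, solutions for any such matching, completed by solutions of the
basic parts outside it, form an independent set (`combine_isIndepSet`). Merging is therefore a
maximum weight matching problem. Local search solves it up to a factor `1 - 2 / k`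
(`localSearch_ge`): the exchange graph of two matchings has maximum degree two, so deleting few
layers cuts it into small exchanges (`exists_small_exchange`). The outcome is `combine_spec`.

Loss. Goodness bounds the weight of `I` in `X` by `γ` times the weight of `I` outside any nontrivial
atom, in particular outside the heaviest nontrivial piece. This charge falls on weight in lighter
pieces, each with at most half of the total, or on weight that is not split further. If all vertices
of `I` weigh at least `θ`, a unit of weight is thus charged about `log (W / θ)` times. The potential
`loss` makes this precise (`add_sum_loss_le`), and `solve_ge` carries it through the recursion.
Nontrivial atoms shrink by `1 - δ`, so a depth of about `log (W / θ) / δ` suffices; trivial atoms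
are single vertices and are solved exactly. Vertices lighter than a fraction `1 / (4mn)` of the
maximum are dropped first (`weight_inter_heavyVertices`), so that `log (W / θ)` is polynomial in
`log n` and `m`. The constants are balanced in `solve_heavyVertices`.

Time. `Computes` asserts that one program evaluates a whole family of values in time
quasi-polynomial in a size parameter, and it is closed under the usual list operations. The
algorithm is assembled from these closure properties, with the recursion unrolled level by level.
The size of the disperser and of the graphs `H` is controlled by the running time that produced
them, through the depth of values (`Runs.depth_le`). -/

/-! ### Quasi-polynomial bounds -/

/-- `f` is bounded by the exponential of a polynomial in `s`. -/
def QuasiPoly {ι : Type*} (s f : ι → ℕ) : Prop :=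
  ∃ c : ℕ, ∀ i, f i ≤ 2 ^ (c * (s i + 2) ^ c)

/-- `f` is bounded by a polynomial in `s`. -/
def PolyBdd {ι : Type*} (s f : ι → ℕ) : Prop :=
  ∃ c : ℕ, ∀ i, f i ≤ c * (s i + 2) ^ c

namespace PolyBdd

variable {ι κ : Type*} {s f g : ι → ℕ}

theorem mono (hg : PolyBdd s g) (h : ∀ i, f i ≤ g i) : PolyBdd s f := by
  obtain ⟨c, hc⟩ := hg
  exact ⟨c, fun i => (h i).trans (hc i)⟩

theorem comp (hf : PolyBdd s f) (π : κ → ι) : PolyBdd (fun j => s (π j)) (fun j => f (π j)) := by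
  obtain ⟨c, hc⟩ := hf
  exact ⟨c, fun j => hc (π j)⟩

theorem const (k : ℕ) : PolyBdd s fun _ => k :=
  ⟨k, fun _ => Nat.le_mul_of_pos_right _ (by positivity)⟩

theorem self : PolyBdd s s := ⟨1, fun i => by simp⟩

theorem add (hf : PolyBdd s f) (hg : PolyBdd s g) : PolyBdd s fun i => f i + g i := by
  obtain ⟨c, hc⟩ := hf
  obtain ⟨d, hd⟩ := hg
  refine ⟨c + d, fun i => (Nat.add_le_add (hc i) (hd i)).trans ?_⟩
  rw [add_mul]
  gcongr <;> omega

theorem mul (hf : PolyBdd s f) (hg : PolyBdd s g) : PolyBdd s fun i => f i * g i := by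
  obtain ⟨c, hc⟩ := hf
  obtain ⟨d, hd⟩ := hg
  refine ⟨c * d + c + d, fun i => (Nat.mul_le_mul (hc i) (hd i)).trans ?_⟩
  calc c * (s i + 2) ^ c * (d * (s i + 2) ^ d) = (c * d) * (s i + 2) ^ (c + d) := by ring
    _ ≤ (c * d + c + d) * (s i + 2) ^ (c * d + c + d) := by
        gcongr
        · omega
        · omega
        · omega

theorem pow (hf : PolyBdd s f) (k : ℕ) : PolyBdd s fun i => f i ^ k := by
  induction k with
  | zero => simpa using const 1
  | succ k ih => simpa only [pow_succ] using ih.mul hf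

theorem quasiPoly_two_pow (hf : PolyBdd s f) : QuasiPoly s fun i => 2 ^ f i := by
  obtain ⟨c, hc⟩ := hf
  exact ⟨c, fun i => Nat.pow_le_pow_right (by norm_num) (hc i)⟩

end PolyBdd

namespace QuasiPoly

variable {ι κ : Type*} {s f g : ι → ℕ}

theorem mono (hg : QuasiPoly s g) (h : ∀ i, f i ≤ g i) : QuasiPoly s f := by
  obtain ⟨c, hc⟩ := hg
  exact ⟨c, fun i => (h i).trans (hc i)⟩

theorem comp (hf : QuasiPoly s f) (π : κ → ι) :
    QuasiPoly (fun j => s (π j)) (fun j => f (π j)) := by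
  obtain ⟨c, hc⟩ := hf
  exact ⟨c, fun j => hc (π j)⟩

theorem of_polyBdd (hf : PolyBdd s f) : QuasiPoly s f :=
  hf.quasiPoly_two_pow.mono fun _ => Nat.lt_two_pow_self.le

theorem const (k : ℕ) : QuasiPoly s fun _ => k := of_polyBdd (.const k)

theorem mul (hf : QuasiPoly s f) (hg : QuasiPoly s g) : QuasiPoly s fun i => f i * g i := by
  obtain ⟨c, hc⟩ := hf
  obtain ⟨d, hd⟩ := hg
  obtain ⟨e, he⟩ := PolyBdd.add (s := s) ⟨c, fun _ => le_rfl⟩ ⟨d, fun _ => le_rfl⟩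
  refine ⟨e, fun i => (Nat.mul_le_mul (hc i) (hd i)).trans ?_⟩
  rw [← pow_add]
  exact Nat.pow_le_pow_right (by norm_num) (he i)

theorem add (hf : QuasiPoly s f) (hg : QuasiPoly s g) : QuasiPoly s fun i => f i + g i := by
  obtain ⟨c, hc⟩ := hf
  obtain ⟨d, hd⟩ := hg
  obtain ⟨e, he⟩ := (PolyBdd.add (s := s) ⟨c, fun _ => le_rfl⟩ ⟨d, fun _ => le_rfl⟩).add (.const 1)
  refine ⟨e, fun i => (Nat.add_le_add (hc i) (hd i)).trans ?_⟩
  refine le_trans ?_ (Nat.pow_le_pow_right (by norm_num) (he i))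
  have h1 := Nat.one_le_two_pow (n := c * (s i + 2) ^ c)
  have h2 := Nat.one_le_two_pow (n := d * (s i + 2) ^ d)
  rw [pow_succ, pow_add]
  nlinarith

theorem pow (hf : QuasiPoly s f) (hg : PolyBdd s g) : QuasiPoly s fun i => f i ^ g i := by
  obtain ⟨c, hc⟩ := hf
  obtain ⟨e, he⟩ := PolyBdd.mul (s := s) (f := fun i => c * (s i + 2) ^ c) ⟨c, fun _ => le_rfl⟩ hg
  refine ⟨e, fun i => (Nat.pow_le_pow_left (hc i) _).trans ?_⟩
  rw [← pow_mul]
  exact Nat.pow_le_pow_right (by norm_num) (he i)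

end QuasiPoly

/-! ### Functions computed in quasi-polynomial time -/

/-- Some program computes `out i` from `env i`, in time quasi-polynomial in `s i`. -/
def Computes {ι : Type*} (s : ι → ℕ) (env out : ι → Val) : Prop :=
  ∃ (p : Code) (T : ι → ℕ), QuasiPoly s T ∧ ∀ i, ∃ t, Runs p (env i) (out i) t ∧ t ≤ T i

open Classical in
/-- A truth value as a value. -/
noncomputable def Val.flag (p : Prop) : Val := .num (if p then 1 else 0)

theorem Val.flag_true {p : Prop} (h : p) : Val.flag p = .num 1 := by simp [Val.flag, h]

theorem Val.flag_false {p : Prop} (h : ¬ p) : Val.flag p = .num 0 := by simp [Val.flag, h]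

namespace Computes

open Val

variable {ι κ : Type*} {s : ι → ℕ} {env out : ι → Val}

theorem of_code (p : Code) (k : ℕ) (h : ∀ i, Runs p (env i) (out i) k) : Computes s env out :=
  ⟨p, fun _ => k, .const k, fun i => ⟨k, h i, le_rfl⟩⟩

theorem congr {out' : ι → Val} (h : Computes s env out) (e : ∀ i, out i = out' i) :
    Computes s env out' := by
  rwa [← funext e]

theorem congr_env {env' : ι → Val} (h : Computes s env out) (e : ∀ i, env i = env' i) :
    Computes s env' out := by
  rwa [← funext e]

theorem id : Computes s env env := of_code .ident 1 fun _ => .ident _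

/-- A program does not see the index type, so a family may be pulled back along any map. Loop
bodies, indexed by an input together with a round or a list element, inherit in this way what is
known for the input alone. -/
theorem reindex (h : Computes s env out) (π : κ → ι) :
    Computes (fun j => s (π j)) (fun j => env (π j)) (fun j => out (π j)) := by
  obtain ⟨p, T, hT, h⟩ := h
  exact ⟨p, _, hT.comp π, fun j => h (π j)⟩

theorem comp {mid : ι → Val} (h : Computes s env mid) (h' : Computes s mid out) :
    Computes s env out := by
  obtain ⟨p, T, hT, h⟩ := h
  obtain ⟨q, U, hU, h'⟩ := h'
  refine ⟨.comp q p, _, (hT.add hU).add (.const 1), fun i => ?_⟩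
  obtain ⟨t, ht, htT⟩ := h i
  obtain ⟨u, hu, huU⟩ := h' i
  exact ⟨_, .comp ht hu, by omega⟩

theorem pair {a b : ι → Val} (h : Computes s env a) (h' : Computes s env b) :
    Computes s env fun i => .pair (a i) (b i) := by
  obtain ⟨p, T, hT, h⟩ := h
  obtain ⟨q, U, hU, h'⟩ := h'
  refine ⟨.pair p q, _, (hT.add hU).add (.const 1), fun i => ?_⟩
  obtain ⟨t, ht, htT⟩ := h i
  obtain ⟨u, hu, huU⟩ := h' i
  exact ⟨_, .pair ht hu, by omega⟩

theorem num (k : ℕ) : Computes s env fun _ => .num k := of_code (.lit k) 1 fun _ => .lit _ _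

theorem first (h : Computes s env out) : Computes s env fun i => (out i).first :=
  h.comp (of_code .first 1 fun _ => .first _)

theorem second (h : Computes s env out) : Computes s env fun i => (out i).second :=
  h.comp (of_code .second 1 fun _ => .second _)

theorem fst {a b : ι → Val} (h : Computes s env fun i => .pair (a i) (b i)) : Computes s env a :=
  h.first

theorem snd {a b : ι → Val} (h : Computes s env fun i => .pair (a i) (b i)) : Computes s env b :=
  h.second

theorem testPair (h : Computes s env out) : Computes s env fun i => (out i).testPair :=
  h.comp (of_code .testPair 1 fun _ => .testPair _)

theorem add {a b : ι → ℕ} (ha : Computes s env fun i => .num (a i))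
    (hb : Computes s env fun i => .num (b i)) : Computes s env fun i => .num (a i + b i) :=
  (ha.pair hb).comp (of_code .plus 1 fun _ => .plus _)

theorem sub {a b : ι → ℕ} (ha : Computes s env fun i => .num (a i))
    (hb : Computes s env fun i => .num (b i)) : Computes s env fun i => .num (a i - b i) :=
  (ha.pair hb).comp (of_code .minus 1 fun _ => .minus _)

/-- Entering the scope of a new variable. -/
theorem weaken (h : Computes s env out) (π : κ → ι) (x : κ → Val) :
    Computes (fun j => s (π j)) (fun j => .pair (env (π j)) (x j)) (fun j => out (π j)) :=
  (fst id).comp (h.reindex π)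

/-- Entering the scopes of two new variables. -/
theorem weaken₂ {α : ι → Type*} {β : (i : ι) × α i → Type*} (h : Computes s env out)
    (x y : (j : (i : ι) × α i) × β j → Val) :
    Computes (fun j => s j.1.1) (fun j => .pair (.pair (env j.1.1) (x j)) (y j))
      (fun j => out j.1.1) :=
  (fst (fst id)).comp (h.reindex fun j : (j : (i : ι) × α i) × β j => j.1.1)

/-- Entering the scopes of three new variables. -/
theorem weaken₃ {α : ι → Type*} {β : (i : ι) × α i → Type*}
    {γ : (j : (i : ι) × α i) × β j → Type*} (h : Computes s env out)
    (x y z : (k : (j : (i : ι) × α i) × β j) × γ k → Val) :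
    Computes (fun j => s j.1.1.1) (fun j => .pair (.pair (.pair (env j.1.1.1) (x j)) (y j)) (z j))
      (fun j => out j.1.1.1) :=
  (fst (fst (fst id))).comp
    (h.reindex fun j : (k : (j : (i : ι) × α i) × β j) × γ k => j.1.1.1)

/-- The value of the innermost variable. -/
theorem top {x : ι → Val} : Computes s (fun i => .pair (env i) (x i)) x := snd id

-- Each branch need only be correct on the indices that reach it. This allows branches which make
-- sense only under the condition, such as reading the data of an edge of `H`.
open Classical in
theorem ite {p : ι → Prop} {a b : ι → Val} (hp : Computes s env fun i => flag (p i))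
    (ha : Computes (fun i : {i // p i} => s i) (fun i => env i) fun i => a i)
    (hb : Computes (fun i : {i // ¬ p i} => s i) (fun i => env i) fun i => b i) :
    Computes s env fun i => if p i then a i else b i := by
  obtain ⟨p₀, T₀, hT₀, h₀⟩ := hp
  obtain ⟨p₁, T₁, ⟨c₁, hT₁⟩, h₁⟩ := ha
  obtain ⟨p₂, T₂, ⟨c₂, hT₂⟩, h₂⟩ := hb
  -- The time bounds of the branches live on subtypes; their explicit majorants are defined for
  -- every index.
  set A : ι → ℕ := fun i => 2 ^ (c₁ * (s i + 2) ^ c₁)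
  set B : ι → ℕ := fun i => 2 ^ (c₂ * (s i + 2) ^ c₂)
  have hA : QuasiPoly s A := ⟨c₁, fun _ => le_rfl⟩
  have hB : QuasiPoly s B := ⟨c₂, fun _ => le_rfl⟩
  refine ⟨.cond p₀ p₁ p₂, _, ((hT₀.add hA).add hB).add (.const 1), fun i => ?_⟩
  obtain ⟨t, ht, htT⟩ := h₀ i
  by_cases hi : p i
  · obtain ⟨u, hu, huU⟩ := h₁ ⟨i, hi⟩
    simp only [flag_true hi] at ht
    simp only [if_pos hi]
    refine ⟨_, .cond_true ht (by simp) hu, ?_⟩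
    have : u ≤ A i := huU.trans (hT₁ ⟨i, hi⟩)
    omega
  · obtain ⟨u, hu, huU⟩ := h₂ ⟨i, hi⟩
    simp only [flag_false hi] at ht
    simp only [if_neg hi]
    refine ⟨_, .cond_false ht hu, ?_⟩
    have : u ≤ B i := huU.trans (hT₂ ⟨i, hi⟩)
    omega

open Classical in
theorem ite' {p : ι → Prop} {a b : ι → Val} (hp : Computes s env fun i => flag (p i))
    (ha : Computes s env a) (hb : Computes s env b) :
    Computes s env fun i => if p i then a i else b i :=
  ite hp (ha.reindex _) (hb.reindex _)

theorem not {p : ι → Prop} (hp : Computes s env fun i => flag (p i)) :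
    Computes s env fun i => flag (¬ p i) :=
  (ite' hp (num 0) (num 1)).congr fun i => by by_cases h : p i <;> simp [flag, h]

theorem and {p q : ι → Prop} (hp : Computes s env fun i => flag (p i))
    (hq : Computes s env fun i => flag (q i)) : Computes s env fun i => flag (p i ∧ q i) :=
  (ite' hp hq (num 0)).congr fun i => by
    by_cases h : p i <;> by_cases h' : q i <;> simp [flag, h, h']

theorem or {p q : ι → Prop} (hp : Computes s env fun i => flag (p i))
    (hq : Computes s env fun i => flag (q i)) : Computes s env fun i => flag (p i ∨ q i) :=
  (ite' hp (num 1) hq).congr fun i => by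
    by_cases h : p i <;> by_cases h' : q i <;> simp [flag, h, h']

theorem eq_zero {a : ι → ℕ} (ha : Computes s env fun i => .num (a i)) :
    Computes s env fun i => flag (a i = 0) :=
  ((num 1).sub ha).congr fun i => by
    by_cases h : a i = 0
    · simp [flag, h]
    · have : 1 - a i = 0 := by omega
      simp [flag, h, this]

theorem le {a b : ι → ℕ} (ha : Computes s env fun i => .num (a i))
    (hb : Computes s env fun i => .num (b i)) : Computes s env fun i => flag (a i ≤ b i) :=
  (ha.sub hb).eq_zero.congr fun i => by rw [Nat.sub_eq_zero_iff_le]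

theorem lt {a b : ι → ℕ} (ha : Computes s env fun i => .num (a i))
    (hb : Computes s env fun i => .num (b i)) : Computes s env fun i => flag (a i < b i) :=
  (hb.le ha).not.congr fun i => by rw [not_le]

theorem eq {a b : ι → ℕ} (ha : Computes s env fun i => .num (a i))
    (hb : Computes s env fun i => .num (b i)) : Computes s env fun i => flag (a i = b i) :=
  ((ha.le hb).and (hb.le ha)).congr fun i => by rw [← le_antisymm_iff]

theorem of_flag {p : ι → Prop} {a b : ι → Val} (ha : Computes s env a) (hb : Computes s env b)
    (hp : Computes s env fun i => flag (p i)) (hpa : ∀ i, p i → out i = a i)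
    (hpb : ∀ i, ¬ p i → out i = b i) : Computes s env out :=
  (ite' hp ha hb).congr fun i => by
    by_cases h : p i
    · simp [h, hpa]
    · simp [h, hpb]

/-- Iteration of a loop whose `k`-th state is `σ i k`, with `N i` rounds. -/
theorem loop {N : ι → ℕ} {σ : ι → ℕ → Val} (hN : QuasiPoly s N)
    (h0 : Computes s env fun i => σ i 0)
    (htest : Computes (fun j : (i : ι) × Fin (N i + 1) => s j.1) (fun j => σ j.1 j.2)
      fun j => flag (j.2.val < N j.1))
    (hstep : Computes (fun j : (i : ι) × Fin (N i) => s j.1) (fun j => σ j.1 j.2)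
      fun j => σ j.1 (j.2 + 1)) :
    Computes s env fun i => σ i (N i) := by
  refine h0.comp ?_
  obtain ⟨p₁, T₁, ⟨c₁, hT₁⟩, h₁⟩ := htest
  obtain ⟨p₂, T₂, ⟨c₂, hT₂⟩, h₂⟩ := hstep
  -- The majorants depend on `s i` only, so they are uniform over the rounds of the loop.
  set A : ι → ℕ := fun i => 2 ^ (c₁ * (s i + 2) ^ c₁)
  set B : ι → ℕ := fun i => 2 ^ (c₂ * (s i + 2) ^ c₂)
  have hA : QuasiPoly s A := ⟨c₁, fun _ => le_rfl⟩
  have hB : QuasiPoly s B := ⟨c₂, fun _ => le_rfl⟩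
  refine ⟨.loop p₁ p₂, _, (hN.add (.const 1)).mul ((hA.add hB).add (.const 1)), fun i => ?_⟩
  -- Induction on the number `k` of rounds that remain; the extra `1` in the factor `k + 1` pays for
  -- the final test.
  suffices H : ∀ k ≤ N i, ∃ t, Runs (.loop p₁ p₂) (σ i (N i - k)) (σ i (N i)) t ∧
      t ≤ (k + 1) * (A i + B i + 1) by
    simpa using H (N i) le_rfl
  intro k
  induction k with
  | zero =>
    intro _
    obtain ⟨t, ht, htT⟩ := h₁ ⟨i, ⟨N i, by omega⟩⟩
    have hA' : t ≤ A i := htT.trans (hT₁ _)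
    dsimp only at ht
    rw [flag_false (by simp)] at ht
    exact ⟨t + 1, by constructor; exact ht, by omega⟩
  | succ k ih =>
    intro hk
    obtain ⟨r, hr, hrT⟩ := ih (by omega)
    obtain ⟨t, ht, htT⟩ := h₁ ⟨i, ⟨N i - (k + 1), by omega⟩⟩
    have hA' : t ≤ A i := htT.trans (hT₁ _)
    dsimp only at ht
    rw [flag_true (by omega)] at ht
    obtain ⟨u, hu, huU⟩ := h₂ ⟨i, ⟨N i - (k + 1), by omega⟩⟩
    have hB' : u ≤ B i := huU.trans (hT₂ _)
    simp only [show N i - (k + 1) + 1 = N i - k by omega] at hu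
    refine ⟨_, .loop_step ht (by simp) hu hr, ?_⟩
    rw [add_mul (k + 1) 1]
    omega

/-- Left fold over a list; `acc i k` is the accumulator after `k` elements. -/
theorem fold {l : ι → List Val} {acc : ι → ℕ → Val}
    (hl : Computes s env fun i => ofList (l i)) (hlen : QuasiPoly s fun i => (l i).length)
    (h0 : Computes s env fun i => acc i 0)
    (hstep : Computes (fun j : (i : ι) × Fin (l i).length => s j.1)
      (fun j => .pair (env j.1) (.pair (acc j.1 j.2) ((l j.1).get j.2)))
      fun j => acc j.1 (j.2 + 1)) :
    Computes s env fun i => acc i (l i).length := by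
  -- The loop carries the environment, the accumulator and the unread part of the list. The unread
  -- part is a pair exactly as long as elements remain, which gives the loop test.
  have key := loop (σ := fun i k => .pair (env i) (.pair (acc i k) (ofList ((l i).drop k)))) hlen
    (id.pair (h0.pair (by simpa using hl))) (env := env) ?_ ?_
  · exact key.snd.fst
  · refine (testPair (snd (snd id))).congr fun j => ?_
    rcases Nat.lt_or_ge j.2.val (l j.1).length with h | h
    · rw [flag_true h, List.drop_eq_getElem_cons h]
      rfl
    · rw [flag_false (by omega), List.drop_eq_nil_of_le h]
      rfl
  · have e : Computes (fun j : (i : ι) × Fin (l i).length => s j.1)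
      (fun j => .pair (env j.1) (.pair (acc j.1 j.2) (ofList ((l j.1).drop j.2))))
      (fun j => .pair (env j.1) (.pair (acc j.1 j.2)
        (.pair ((l j.1).get j.2) (ofList ((l j.1).drop (j.2 + 1)))))) :=
      id.congr fun j => by rw [List.drop_eq_getElem_cons j.2.2]; rfl
    refine e.comp ?_
    refine (fst id).pair (Computes.pair ?_ (snd (snd (snd id))))
    exact ((fst id).pair ((fst (snd id)).pair (fst (snd (snd id))))).comp hstep

end Computes

namespace Computes

open Val

variable {ι κ : Type*} {s : ι → ℕ} {env out : ι → Val}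

/-! ### Lists -/

theorem nil : Computes s env fun _ => ofList [] := num 0

theorem cons {a : ι → Val} {l : ι → List Val} (ha : Computes s env a)
    (hl : Computes s env fun i => ofList (l i)) : Computes s env fun i => ofList (a i :: l i) :=
  ha.pair hl

theorem reverse {l : ι → List Val} (hl : Computes s env fun i => ofList (l i))
    (hlen : QuasiPoly s fun i => (l i).length) :
    Computes s env fun i => ofList (l i).reverse := by
  refine (fold (acc := fun i k => ofList ((l i).take k).reverse) hl hlen
    (nil.congr fun i => by simp) ?_).congr fun i => by simp
  refine (cons (snd (snd id)) (fst (snd id))).congr fun j => ?_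
  rw [List.take_succ_eq_append_getElem j.2.2, List.reverse_append]
  rfl

/-- A list can be extended only at its head, so the first list is reversed and its elements are
pushed one by one onto the second. -/
theorem append {l l' : ι → List Val} (hl : Computes s env fun i => ofList (l i))
    (hlen : QuasiPoly s fun i => (l i).length) (hl' : Computes s env fun i => ofList (l' i)) :
    Computes s env fun i => ofList (l i ++ l' i) := by
  refine (fold (acc := fun i k => ofList (((l i).reverse.take k).reverse ++ l' i))
    (hl.reverse hlen) (by simpa using hlen) (hl'.congr fun i => by simp) ?_).congr
    fun i => by rw [List.take_length]; simp
  refine (cons (snd (snd id)) (fst (snd id))).congr fun j => ?_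
  rw [List.take_succ_eq_append_getElem j.2.2, List.reverse_append]
  rfl

section typed

variable {A X : ι → Type*} {eA : ∀ i, A i → Val} {e : ∀ i, X i → Val} {l : ∀ i, List (X i)}

/-- Left fold over a list, with an invariant of the accumulator. -/
theorem foldl_of_invariant {P : ∀ i, A i → Prop} {a₀ : ∀ i, A i} {f : ∀ i, A i → X i → A i}
    (hl : Computes s env fun i => ofList ((l i).map (e i)))
    (hlen : QuasiPoly s fun i => (l i).length)
    (h0 : Computes s env fun i => eA i (a₀ i)) (hP0 : ∀ i, P i (a₀ i))
    (hP : ∀ i a, P i a → ∀ x ∈ l i, P i (f i a x))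
    (hf : Computes (fun j : (i : ι) × {a // P i a} × {x // x ∈ l i} => s j.1)
      (fun j => .pair (env j.1) (.pair (eA j.1 j.2.1) (e j.1 j.2.2)))
      fun j => eA j.1 (f j.1 j.2.1 j.2.2)) :
    Computes s env fun i => eA i ((l i).foldl (f i) (a₀ i)) := by
  refine (fold (acc := fun i k => eA i (((l i).take k).foldl (f i) (a₀ i))) hl
    (by simpa using hlen) (h0.congr fun i => by simp) ?_).congr fun i => by simp
  have hlt : ∀ j : (i : ι) × Fin ((l i).map (e i)).length, j.2.val < (l j.1).length :=
    fun j => by simpa using j.2.2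
  have hinv : ∀ i k, P i (((l i).take k).foldl (f i) (a₀ i)) := fun i k =>
    List.foldlRecOn (motive := P i) _ _ (hP0 i) fun a ha x hx =>
      hP i a ha x (List.mem_of_mem_take hx)
  refine ((hf.reindex fun j : (i : ι) × Fin ((l i).map (e i)).length =>
    ⟨j.1, ⟨((l j.1).take j.2).foldl (f j.1) (a₀ j.1), hinv _ _⟩, ⟨(l j.1)[j.2.val]'(hlt j),
      List.getElem_mem _⟩⟩).congr_env fun j => by simp).congr fun j => ?_
  rw [List.take_succ_eq_append_getElem (hlt j), List.foldl_append]
  rfl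

theorem foldl {a₀ : ∀ i, A i} {f : ∀ i, A i → X i → A i}
    (hl : Computes s env fun i => ofList ((l i).map (e i)))
    (hlen : QuasiPoly s fun i => (l i).length)
    (h0 : Computes s env fun i => eA i (a₀ i))
    (hf : Computes (fun j : (i : ι) × A i × {x // x ∈ l i} => s j.1)
      (fun j => .pair (env j.1) (.pair (eA j.1 j.2.1) (e j.1 j.2.2)))
      fun j => eA j.1 (f j.1 j.2.1 j.2.2)) :
    Computes s env fun i => eA i ((l i).foldl (f i) (a₀ i)) :=
  foldl_of_invariant (P := fun _ _ => True) hl hlen h0 (fun _ => trivial)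
    (fun _ _ _ _ _ => trivial)
    (hf.reindex fun j : (i : ι) × {_a : A i // True} × {x // x ∈ l i} => ⟨j.1, j.2.1.1, j.2.2⟩)

/-- The blocks are prepended while the list is read backwards, which leaves them in the right order.
Maps and filters are special cases with blocks of length at most one. -/
theorem flatMap {f : ∀ i, X i → List Val}
    (hl : Computes s env fun i => ofList ((l i).map (e i)))
    (hlen : QuasiPoly s fun i => (l i).length)
    (hflen : QuasiPoly (fun j : (i : ι) × {x // x ∈ l i} => s j.1) fun j => (f j.1 j.2).length)
    (hf : Computes (fun j : (i : ι) × {x // x ∈ l i} => s j.1)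
      (fun j => .pair (env j.1) (e j.1 j.2)) fun j => ofList (f j.1 j.2)) :
    Computes s env fun i => ofList ((l i).flatMap (f i)) := by
  have hlt : ∀ j : (i : ι) × Fin ((l i).map (e i)).reverse.length,
    j.2.val < (l j.1).reverse.length := fun j => by simpa using j.2.2
  refine (fold (acc := fun i k => ofList (((l i).reverse.take k).reverse.flatMap (f i)))
    (hl.reverse (by simpa using hlen)) (by simpa using hlen) (nil.congr fun i => by simp)
    ?_).congr fun i => by
      rw [List.length_reverse, List.length_map, List.take_of_length_le (by simp)]
      simp
  set π : ((i : ι) × Fin ((l i).map (e i)).reverse.length) → (i : ι) × {x // x ∈ l i} :=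
    fun j => ⟨j.1, (l j.1).reverse[j.2.val]'(hlt j), by
      rw [← List.mem_reverse]; exact List.getElem_mem _⟩ with hπ
  have h1 := ((fst id).pair (snd (snd id))).comp (hf.reindex π)
    (s := fun j : (i : ι) × Fin ((l i).map (e i)).reverse.length => s j.1)
    (env := fun j => .pair (env j.1) (.pair
      (ofList (((l j.1).reverse.take j.2).reverse.flatMap (f j.1))) (e j.1 (π j).2)))
  refine ((append h1 (hflen.comp π) (fst (snd id))).congr_env fun j => ?_).congr fun j => ?_
  · simp [π]
  · rw [List.take_succ_eq_append_getElem (hlt j), List.reverse_append]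
    rfl

theorem map {f : ∀ i, X i → Val}
    (hl : Computes s env fun i => ofList ((l i).map (e i)))
    (hlen : QuasiPoly s fun i => (l i).length)
    (hf : Computes (fun j : (i : ι) × {x // x ∈ l i} => s j.1)
      (fun j => .pair (env j.1) (e j.1 j.2)) fun j => f j.1 j.2) :
    Computes s env fun i => ofList ((l i).map (f i)) :=
  (flatMap (f := fun i x => [f i x]) hl hlen (.const 1) (cons hf nil)).congr fun i => by
    rw [← List.map_eq_flatMap]

open Classical in
theorem filter {p : ∀ i, X i → Prop}
    (hl : Computes s env fun i => ofList ((l i).map (e i)))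
    (hlen : QuasiPoly s fun i => (l i).length)
    (hp : Computes (fun j : (i : ι) × {x // x ∈ l i} => s j.1)
      (fun j => .pair (env j.1) (e j.1 j.2)) fun j => flag (p j.1 j.2)) :
    Computes s env fun i => ofList (((l i).filter fun x => p i x).map (e i)) :=
  (flatMap (f := fun i x => if p i x then [e i x] else []) hl hlen
    ((QuasiPoly.const 1).mono fun j => by split_ifs <;> simp)
    (of_flag (cons top nil) nil hp (fun j h => by simp [h]) fun j h => by simp [h])).congr
    fun i => by
      congr 1
      induction l i with
      | nil => rfl
      | cons a t ih => by_cases h : p i a <;> simp [h, ih]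

theorem exists_mem {p : ∀ i, X i → Prop}
    (hl : Computes s env fun i => ofList ((l i).map (e i)))
    (hlen : QuasiPoly s fun i => (l i).length)
    (hp : Computes (fun j : (i : ι) × {x // x ∈ l i} => s j.1)
      (fun j => .pair (env j.1) (e j.1 j.2)) fun j => flag (p j.1 j.2)) :
    Computes s env fun i => flag (∃ x ∈ l i, p i x) := by
  have h := foldl (A := fun _ => Prop) (eA := fun _ => flag) (a₀ := fun _ => False)
    (f := fun i q x => q ∨ p i x) hl hlen ((num 0).congr fun i => by simp [flag])
    (or (fst (snd id)) (((fst id).pair (snd (snd id))).comp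
      (hp.reindex fun j : (i : ι) × Prop × {x // x ∈ l i} => ⟨j.1, j.2.2⟩)))
  refine h.congr fun i => ?_
  congr 1
  have : ∀ (t : List (X i)) (q : Prop),
      t.foldl (fun q x => q ∨ p i x) q = (q ∨ ∃ x ∈ t, p i x) := by
    intro t
    induction t with
    | nil => simp
    | cons a t ih => intro q; simp [ih, or_assoc]
  rw [this, false_or]

theorem sum {f : ∀ i, X i → ℕ}
    (hl : Computes s env fun i => ofList ((l i).map (e i)))
    (hlen : QuasiPoly s fun i => (l i).length)
    (hf : Computes (fun j : (i : ι) × {x // x ∈ l i} => s j.1)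
      (fun j => .pair (env j.1) (e j.1 j.2)) fun j => .num (f j.1 j.2)) :
    Computes s env fun i => .num (((l i).map (f i)).sum) := by
  have h := foldl (A := fun _ => ℕ) (eA := fun _ => .num) (a₀ := fun _ => 0)
    (f := fun i q x => q + f i x) hl hlen (num 0)
    (add (fst (snd id)) (((fst id).pair (snd (snd id))).comp
      (hf.reindex fun j : (i : ι) × ℕ × {x // x ∈ l i} => ⟨j.1, j.2.2⟩)))
  refine h.congr fun i => ?_
  rw [List.sum_eq_foldl, List.foldl_map]

theorem length (hl : Computes s env fun i => ofList ((l i).map (e i)))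
    (hlen : QuasiPoly s fun i => (l i).length) : Computes s env fun i => .num (l i).length :=
  (sum (f := fun _ _ => 1) hl hlen (num 1)).congr fun i => by simp

end typed

/-! ### Tables -/

/-- The counter runs down from `n`, because the list grows at its head and should come out
increasing. -/
theorem range {n : ι → ℕ} (hn : Computes s env fun i => .num (n i)) (hb : QuasiPoly s n) :
    Computes s env fun i => ofList ((List.finRange (n i)).map fun v => .num v.val) := by
  have key := loop (env := env) (σ := fun i k => .pair (.num (n i - k))
      (ofList (((List.range (n i)).drop (n i - k)).map .num))) hb
    (hn.pair (nil.congr fun i => by simp [List.drop_eq_nil_of_le])) ?_ ?_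
  · refine key.snd.congr fun i => ?_
    rw [← List.map_coe_finRange_eq_range]
    simp only [Nat.sub_self, List.drop_zero, List.map_map, Function.comp_def]
  · exact (lt (num 0) (fst id)).congr fun j => by rw [Nat.sub_pos_iff_lt]
  · have h1 := (sub (fst id) (num 1)
      (s := fun j : (i : ι) × Fin (n i) => s j.1) (env := fun j => .pair (.num (n j.1 - j.2))
        (ofList (((List.range (n j.1)).drop (n j.1 - j.2)).map .num))))
    refine (h1.pair (cons h1 (snd id))).congr fun j => ?_
    have hj := j.2.2
    rw [show n j.1 - (j.2 + 1) = n j.1 - j.2 - 1 by omega,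
      List.drop_eq_getElem_cons (i := n j.1 - j.2 - 1) (by simp; omega)]
    simp only [List.getElem_range, List.map_cons]
    rw [show n j.1 - j.2 - 1 + 1 = n j.1 - j.2 by omega]

theorem table_eq {n : ℕ} (f : Fin n → Val) : table f = ofList ((List.finRange n).map f) := by
  rw [table, List.ofFn_eq_map]

/-- Loops over the vertices `0, …, n - 1`. -/
theorem table {n : ι → ℕ} {f : ∀ i, Fin (n i) → Val} (hn : Computes s env fun i => .num (n i))
    (hb : QuasiPoly s n)
    (hf : Computes (fun j : (i : ι) × Fin (n i) => s j.1)
      (fun j => .pair (env j.1) (.num j.2)) fun j => f j.1 j.2) :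
    Computes s env fun i => Val.table (f i) :=
  (map (range hn hb) (by simpa using hb)
    (hf.reindex fun j : (i : ι) × {x // x ∈ List.finRange (n i)} => ⟨j.1, j.2.1⟩)).congr
    fun _ => (table_eq _).symm

theorem getElem {l : ι → List Val} {k : ι → ℕ} (hl : Computes s env fun i => ofList (l i))
    (hk : Computes s env fun i => .num (k i)) (hb : QuasiPoly s k) (h : ∀ i, k i < (l i).length) :
    Computes s env fun i => (l i)[k i]'(h i) := by
  have key := loop (env := env) (σ := fun i j => .pair (.num (k i - j)) (ofList ((l i).drop j)))
    hb (by simpa using hk.pair hl) ?_ ?_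
  · refine (first key.snd).congr fun i => ?_
    rw [List.drop_eq_getElem_cons (h i)]
    rfl
  · exact (lt (num 0) (fst id)).congr fun j => by rw [Nat.sub_pos_iff_lt]
  · refine (pair (sub (fst id) (num 1)) (second (snd id))).congr fun j => ?_
    have hj := j.2.2
    rw [List.drop_eq_getElem_cons ((hj.trans (h j.1)))]
    rfl

theorem lookup {n : ι → ℕ} {f : ∀ i, Fin (n i) → Val} {u : ∀ i, Fin (n i)}
    (hf : Computes s env fun i => Val.table (f i)) (hu : Computes s env fun i => .num (u i))
    (hb : QuasiPoly s n) : Computes s env fun i => f i (u i) :=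
  (getElem hf hu (hb.mono fun i => (u i).2.le) (fun i => by simp)).congr fun i => by simp

theorem exists_fin {n : ι → ℕ} {p : ∀ i, Fin (n i) → Prop}
    (hn : Computes s env fun i => .num (n i)) (hb : QuasiPoly s n)
    (hp : Computes (fun j : (i : ι) × Fin (n i) => s j.1)
      (fun j => .pair (env j.1) (.num j.2)) fun j => flag (p j.1 j.2)) :
    Computes s env fun i => flag (∃ v, p i v) :=
  (exists_mem (range hn hb) (by simpa using hb)
    (hp.reindex fun j : (i : ι) × {x // x ∈ List.finRange (n i)} => ⟨j.1, j.2.1⟩)).congr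
    fun i => by simp

theorem forall_fin {n : ι → ℕ} {p : ∀ i, Fin (n i) → Prop}
    (hn : Computes s env fun i => .num (n i)) (hb : QuasiPoly s n)
    (hp : Computes (fun j : (i : ι) × Fin (n i) => s j.1)
      (fun j => .pair (env j.1) (.num j.2)) fun j => flag (p j.1 j.2)) :
    Computes s env fun i => flag (∀ v, p i v) :=
  (exists_fin (p := fun i x => ¬ p i x) hn hb hp.not).not.congr fun i => by simp

theorem sum_fin {n : ι → ℕ} {f : ∀ i, Fin (n i) → ℕ}
    (hn : Computes s env fun i => .num (n i)) (hb : QuasiPoly s n)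
    (hf : Computes (fun j : (i : ι) × Fin (n i) => s j.1)
      (fun j => .pair (env j.1) (.num j.2)) fun j => .num (f j.1 j.2)) :
    Computes s env fun i => .num (∑ v, f i v) :=
  (sum (range hn hb) (by simpa using hb)
    (hf.reindex fun j : (i : ι) × {x // x ∈ List.finRange (n i)} => ⟨j.1, j.2.1⟩)).congr
    fun i => by rw [← List.ofFn_eq_map, List.sum_ofFn]

/-! ### Vertex sets -/

section sets

variable {n : ι → ℕ} {A B : ∀ i, Finset (Fin (n i))}

theorem encodeSet_eq {n : ℕ} (A : Finset (Fin n)) :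
    encodeSet A = Val.table fun v => flag (v ∈ A) := by
  unfold encodeSet flag
  congr
  ext v
  congr

theorem set {A : ∀ i, Finset (Fin (n i))} (hn : Computes s env fun i => .num (n i))
    (hb : QuasiPoly s n)
    (hA : Computes (fun j : (i : ι) × Fin (n i) => s j.1)
      (fun j => .pair (env j.1) (.num j.2)) fun j => flag (j.2 ∈ A j.1)) :
    Computes s env fun i => encodeSet (A i) :=
  (table hn hb hA).congr fun _ => (encodeSet_eq _).symm

theorem mem {u : ∀ i, Fin (n i)} (hA : Computes s env fun i => encodeSet (A i))
    (hb : QuasiPoly s n) (hu : Computes s env fun i => .num (u i)) :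
    Computes s env fun i => flag (u i ∈ A i) :=
  lookup (f := fun i v => flag (v ∈ A i)) (hA.congr fun _ => encodeSet_eq _) hu hb

theorem mem_var (hA : Computes s env fun i => encodeSet (A i)) (hb : QuasiPoly s n) :
    Computes (fun j : (i : ι) × Fin (n i) => s j.1)
      (fun j => .pair (env j.1) (.num j.2)) fun j => flag (j.2 ∈ A j.1) :=
  mem (hA.weaken _ _) (hb.comp _) top

theorem empty (hn : Computes s env fun i => .num (n i)) (hb : QuasiPoly s n) :
    Computes s env fun i => encodeSet (∅ : Finset (Fin (n i))) :=
  set hn hb ((num 0).congr fun j => by simp [flag])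

theorem union (hn : Computes s env fun i => .num (n i)) (hb : QuasiPoly s n)
    (hA : Computes s env fun i => encodeSet (A i)) (hB : Computes s env fun i => encodeSet (B i)) :
    Computes s env fun i => encodeSet (A i ∪ B i) :=
  set hn hb (((mem_var hA hb).or (mem_var hB hb)).congr fun j => by simp)

theorem inter (hn : Computes s env fun i => .num (n i)) (hb : QuasiPoly s n)
    (hA : Computes s env fun i => encodeSet (A i)) (hB : Computes s env fun i => encodeSet (B i)) :
    Computes s env fun i => encodeSet (A i ∩ B i) :=
  set hn hb (((mem_var hA hb).and (mem_var hB hb)).congr fun j => by simp)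

theorem sdiff (hn : Computes s env fun i => .num (n i)) (hb : QuasiPoly s n)
    (hA : Computes s env fun i => encodeSet (A i)) (hB : Computes s env fun i => encodeSet (B i)) :
    Computes s env fun i => encodeSet (A i \ B i) :=
  set hn hb (((mem_var hA hb).and (mem_var hB hb).not).congr fun j => by simp)

theorem set_eq (hn : Computes s env fun i => .num (n i)) (hb : QuasiPoly s n)
    (hA : Computes s env fun i => encodeSet (A i)) (hB : Computes s env fun i => encodeSet (B i)) :
    Computes s env fun i => flag (A i = B i) :=
  (forall_fin hn hb (p := fun i v => (v ∈ A i ∧ v ∈ B i) ∨ (v ∉ A i ∧ v ∉ B i))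
    (((mem_var hA hb).and (mem_var hB hb)).or
      ((mem_var hA hb).not.and (mem_var hB hb).not))).congr fun i => by
    congr 1
    rw [Finset.ext_iff]
    exact propext (forall_congr' fun v => by tauto)

theorem weight {w : ∀ i, Fin (n i) → ℕ} (hn : Computes s env fun i => .num (n i))
    (hb : QuasiPoly s n) (hw : Computes s env fun i => Val.table fun v => .num (w i v))
    (hA : Computes s env fun i => encodeSet (A i)) :
    Computes s env fun i => .num (weight (w i) (A i)) :=
  (sum_fin hn hb (f := fun i v => if v ∈ A i then w i v else 0)
    (of_flag (lookup (f := fun (j : (i : ι) × Fin (n i)) v => .num (w j.1 v)) (hw.weaken _ _) top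
      (hb.comp _)) (num 0) (mem_var hA hb) (fun j h => by simp [h]) fun j h => by simp [h])).congr
    fun i => by simp [_root_.weight, Finset.sum_ite_mem]

theorem card (hn : Computes s env fun i => .num (n i)) (hb : QuasiPoly s n)
    (hA : Computes s env fun i => encodeSet (A i)) :
    Computes s env fun i => .num (A i).card :=
  (weight (w := fun _ _ => 1) hn hb (table hn hb (num 1)) hA).congr fun i => by
    simp [_root_.weight]

end sets

end Computes

/-! ### Local search for matchings

An item occupies two labels, and two items clash if they share a label. -/

/-! ### Breadth-first layers in graphs of maximum degree two -/

section layers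

variable {V : Type*} (G : SimpleGraph V)

theorem SimpleGraph.exists_adj_dist_eq {r a : V} {d : ℕ} (h : G.dist a r = d + 1) :
    ∃ x, G.Adj a x ∧ G.dist x r = d ∧ G.Reachable x r := by
  -- The distance between unreachable vertices is `0` by convention, so a positive distance entails
  -- reachability.
  have hr : G.Reachable a r := by
    by_contra hn
    rw [SimpleGraph.dist_eq_zero_of_not_reachable hn] at h
    omega
  obtain ⟨p, hp⟩ := hr.exists_walk_length_eq_dist
  cases p with
  | nil => simp at h
  | @cons _ x _ hax q =>
    refine ⟨x, hax, ?_, ⟨q⟩⟩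
    have h1 := SimpleGraph.dist_le q
    obtain ⟨q', hq'⟩ := (show G.Reachable x r from ⟨q⟩).exists_walk_length_eq_dist
    have h2 := SimpleGraph.dist_le (SimpleGraph.Walk.cons hax q')
    simp only [SimpleGraph.Walk.length_cons] at hp h2
    omega

/-- A graph of maximum degree two has a breadth-first layering with layers of size at most two. -/
theorem SimpleGraph.exists_layering
    (h : ∀ x a b c, G.Adj x a → G.Adj x b → G.Adj x c → a = b ∨ a = c ∨ b = c) :
    ∃ (root : V → V) (lev : V → ℕ),
      (∀ a b, G.Adj a b → root a = root b ∧ lev a ≤ lev b + 1) ∧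
      ∀ a b c, root a = root b → root a = root c → lev a = lev b → lev a = lev c →
        a = b ∨ a = c ∨ b = c := by
  classical
  set root : V → V := fun a => (G.connectedComponentMk a).out with hroot
  have hreach : ∀ a, G.Reachable a (root a) := fun a => by
    rw [← SimpleGraph.ConnectedComponent.eq]
    exact (Quot.out_eq (G.connectedComponentMk a)).symm
  have hadj : ∀ a b, G.Reachable a b → root a = root b := fun a b hab => by
    simp only [hroot, SimpleGraph.ConnectedComponent.eq.mpr hab]
  refine ⟨root, fun a => G.dist a (root a), fun a b hab => ⟨hadj a b hab.reachable, ?_⟩, ?_⟩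
  · dsimp only
    rw [hadj a b hab.reachable]
    obtain ⟨q, hq⟩ := (hreach b).exists_walk_length_eq_dist
    have h2 := SimpleGraph.dist_le (SimpleGraph.Walk.cons hab q)
    simp only [SimpleGraph.Walk.length_cons] at h2
    omega
  -- With a common root `r` fixed, induction on the distance `d`; the layer at distance `0` is the
  -- root alone.
  · suffices H : ∀ d r a b c, root a = r → root b = r → root c = r → G.dist a r = d →
        G.dist b r = d → G.dist c r = d → a = b ∨ a = c ∨ b = c by
      intro a b c hab hac hlab hlac
      dsimp only at hlab hlac
      exact H _ (root a) a b c rfl hab.symm hac.symm rfl (by rw [hlab, hab]) (by rw [hlac, hac])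
    intro d
    induction d with
    | zero =>
      intro r a b c ha hb _ hda hdb _
      left
      have h1 : a = r := by
        subst ha; exact (hreach a).dist_eq_zero_iff.mp hda
      have h2 : b = r := by
        subst hb; exact (hreach b).dist_eq_zero_iff.mp hdb
      rw [h1, h2]
    | succ d ih =>
      intro r a b c ha hb hc hda hdb hdc
      obtain ⟨x, hax, hdx, hx⟩ := G.exists_adj_dist_eq hda
      obtain ⟨y, hby, hdy, hy⟩ := G.exists_adj_dist_eq hdb
      obtain ⟨z, hcz, hdz, hz⟩ := G.exists_adj_dist_eq hdc
      have hrx : root x = r := by rw [← ha]; exact (hadj _ _ hax.reachable).symm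
      have hry : root y = r := by rw [← hb]; exact (hadj _ _ hby.reachable).symm
      have hrz : root z = r := by rw [← hc]; exact (hadj _ _ hcz.reachable).symm
      -- A vertex at distance `d > 0` has one of its at most two neighbours in the previous layer,
      -- hence at most one in the next.
      have two : ∀ x a b, G.Adj a x → G.Adj b x → G.dist x r = d → root x = r →
          G.dist a r = d + 1 → G.dist b r = d + 1 → d ≠ 0 → a = b := by
        intro x a b hax hbx hdx hrx hda hdb hd
        obtain ⟨e, rfl⟩ := Nat.exists_eq_succ_of_ne_zero hd
        obtain ⟨u, hxu, hdu, _⟩ := G.exists_adj_dist_eq hdx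
        rcases h x a b u hax.symm hbx.symm hxu with h | rfl | rfl
        · exact h
        · omega
        · omega
      -- If `d = 0`, all three vertices are neighbours of the root. Otherwise two of the three
      -- predecessors coincide by induction, and a common predecessor has only one successor.
      rcases Nat.eq_zero_or_pos d with rfl | hd
      · have hxr := hx.dist_eq_zero_iff.mp hdx
        have hyr := hy.dist_eq_zero_iff.mp hdy
        have hzr := hz.dist_eq_zero_iff.mp hdz
        subst hxr hyr hzr
        exact h _ _ _ _ hax.symm hby.symm hcz.symm
      · rcases ih r x y z hrx hry hrz hdx hdy hdz with rfl | rfl | rfl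
        · exact .inl (two x a b hax hby hdx hrx hda hdb hd.ne')
        · exact .inr (.inl (two x a c hax hcz hdx hrx hda hdc hd.ne'))
        · exact .inr (.inr (two y b c hby hcz hdy hry hdb hdc hd.ne'))

end layers

/-! ### Exchanges between two sets of items without clashes -/

section localSearch

variable {Q L : Type*} (lab : Q → L × L) (g : Q → ℕ)

/-- Two items share a label. -/
def Clash (p q : Q) : Prop :=
  ((lab p).1 = (lab q).1 ∨ (lab p).1 = (lab q).2) ∨
    ((lab p).2 = (lab q).1 ∨ (lab p).2 = (lab q).2)

variable {lab}

theorem Clash.refl (p : Q) : Clash lab p p := .inl (.inl rfl)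

theorem Clash.symm {p q : Q} (h : Clash lab p q) : Clash lab q p := by
  unfold Clash at *
  rcases h with (h | h) | (h | h) <;> simp [h]

open Classical in
/-- If two sets of items are both free of clashes, then some small set `S` of items of the second
can be inserted into the first with a gain that is at least an average share of the difference. -/
theorem exists_small_exchange {M O : Finset Q}
    (hM : ∀ p ∈ M, ∀ q ∈ M, Clash lab p q → p = q)
    (hO : ∀ p ∈ O, ∀ q ∈ O, Clash lab p q → p = q) {k : ℕ} (hk : 0 < k) {μ : ℕ}
    (hμ : O.card ≤ μ) :
    ∃ S ⊆ O, S.card ≤ 2 * k ∧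
      (1 - 1 / (k : ℝ)) * ∑ a ∈ O, (g a : ℝ) - ∑ b ∈ M, (g b : ℝ) ≤
        μ * (∑ a ∈ S, (g a : ℝ) - ∑ b ∈ M with ∃ a ∈ S, Clash lab a b, (g b : ℝ)) := by
  rcases le_or_gt ((1 - 1 / (k : ℝ)) * ∑ a ∈ O, (g a : ℝ) - ∑ b ∈ M, (g b : ℝ)) 0 with hneg | hpos
  · exact ⟨∅, by simp, by simp, by simpa using hneg⟩
  -- Two items of `O` are adjacent if inserting either of them evicts a common item of `M`.
  let G : SimpleGraph Q :=
    { Adj := fun a a' => a ≠ a' ∧ a ∈ O ∧ a' ∈ O ∧ ∃ b ∈ M, Clash lab a b ∧ Clash lab a' b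
      symm := ⟨fun a a' ⟨h1, h2, h3, b, hb, h4, h5⟩ => ⟨h1.symm, h3, h2, b, hb, h5, h4⟩⟩
      loopless := ⟨fun a h => h.1 rfl⟩ }
  have hdeg : ∀ x a b c, G.Adj x a → G.Adj x b → G.Adj x c → a = b ∨ a = c ∨ b = c := by
    intro x a a' a'' h h' h''
    -- At most one `b ∈ M` carries a given label `l` of `x`. A neighbour of `x` through `b` does not
    -- share `l`, since `O` has no clashes, so it carries the other label of `b`; only one item of
    -- `O` does. As `x` has two labels, it has at most two neighbours.
    have key : ∀ l, ((lab x).1 = l ∨ (lab x).2 = l) → ∀ a a', G.Adj x a → G.Adj x a' →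
        (∃ b ∈ M, ((lab b).1 = l ∨ (lab b).2 = l) ∧ Clash lab a b) →
        (∃ b ∈ M, ((lab b).1 = l ∨ (lab b).2 = l) ∧ Clash lab a' b) → a = a' := by
      rintro l hl a a' ⟨hxa, hx, ha, -⟩ ⟨hxa', -, ha', -⟩ ⟨b, hb, hbl, hab⟩ ⟨b', hb', hbl', hab'⟩
      have hbb : b = b' := hM b hb b' hb' (by unfold Clash; grind)
      subst hbb
      have h1 : ¬ Clash lab x a := fun h => hxa (hO _ hx _ ha h)
      have h2 : ¬ Clash lab x a' := fun h => hxa' (hO _ hx _ ha' h)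
      refine hO _ ha _ ha' ?_
      unfold Clash at *
      grind
    have split : ∀ a, G.Adj x a →
        (∃ b ∈ M, ((lab b).1 = (lab x).1 ∨ (lab b).2 = (lab x).1) ∧ Clash lab a b) ∨
        (∃ b ∈ M, ((lab b).1 = (lab x).2 ∨ (lab b).2 = (lab x).2) ∧ Clash lab a b) := by
      rintro a ⟨-, -, -, b, hb, hxb, hab⟩
      rcases hxb with (h | h) | (h | h)
      · exact .inl ⟨b, hb, .inl h.symm, hab⟩
      · exact .inl ⟨b, hb, .inr h.symm, hab⟩
      · exact .inr ⟨b, hb, .inl h.symm, hab⟩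
      · exact .inr ⟨b, hb, .inr h.symm, hab⟩
    have k1 := key _ (.inl rfl)
    have k2 := key _ (.inr rfl)
    rcases split a h with s | s <;> rcases split a' h' with s' | s' <;>
      rcases split a'' h'' with s'' | s''
    · exact .inl (k1 _ _ h h' s s')
    · exact .inl (k1 _ _ h h' s s')
    · exact .inr (.inl (k1 _ _ h h'' s s''))
    · exact .inr (.inr (k2 _ _ h' h'' s' s''))
    · exact .inr (.inr (k1 _ _ h' h'' s' s''))
    · exact .inr (.inl (k2 _ _ h h'' s s''))
    · exact .inl (k2 _ _ h h' s s')
    · exact .inl (k2 _ _ h h' s s')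
  obtain ⟨root, lev, hlev, hlayer⟩ := G.exists_layering hdeg
  -- By averaging, some residue class of levels modulo `k` holds at most a fraction `1 / k` of the
  -- value of `O`. These levels are deleted.
  obtain ⟨j, hj, hjle⟩ : ∃ j ∈ Finset.range k,
      (k : ℝ) * ∑ a ∈ O with lev a % k = j, (g a : ℝ) ≤ ∑ a ∈ O, (g a : ℝ) := by
    refine Finset.exists_le_of_sum_le ⟨0, by simpa using hk⟩ ?_
    rw [← Finset.mul_sum, Finset.sum_fiberwise_of_maps_to
      (fun a _ => Finset.mem_range.mpr (Nat.mod_lt _ hk))]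
    simp
  rw [Finset.mem_range] at hj
  -- The shift by `k - 1 - j` puts each deleted level at the end of a window of `k` levels, so that
  -- windows are separated by deleted levels.
  set block : Q → Q × ℕ := fun a => (root a, (lev a + (k - 1 - j)) / k) with hblock
  set R := O.filter fun a => lev a % k ≠ j with hR
  set S : Q × ℕ → Finset Q := fun β => R.filter fun a => block a = β with hS
  have hSO : ∀ β, S β ⊆ O := fun β => (Finset.filter_subset _ _).trans (Finset.filter_subset _ _)
  -- A block meets at most `k` levels of one component, with at most two items in each.
  have hcard : ∀ β, (S β).card ≤ 2 * k := by
    intro β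
    have hmaps : ∀ a ∈ S β, lev a + (k - 1 - j) ∈ Finset.Ico (k * β.2) (k * β.2 + k) := by
      intro a ha
      have h1 := (Finset.mem_filter.mp ha).2
      have h2 : (lev a + (k - 1 - j)) / k = β.2 := by rw [← h1]
      rw [Finset.mem_Ico, ← h2]
      exact ⟨Nat.mul_div_le _ _, by
        have := Nat.lt_mul_div_succ (lev a + (k - 1 - j)) hk
        rw [mul_add, mul_one] at this; exact this⟩
    refine (Finset.card_le_mul_card_image_of_maps_to hmaps 2 ?_).trans (by simp)
    intro d _
    by_contra hgt
    obtain ⟨a, b, c, ha, hb, hc, hab, hac, hbc⟩ := Finset.two_lt_card_iff.mp (not_le.mp hgt)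
    simp only [hS, hblock, Finset.mem_filter] at ha hb hc
    have h1 := congrArg Prod.fst ha.1.2
    have h2 := congrArg Prod.fst hb.1.2
    have h3 := congrArg Prod.fst hc.1.2
    rcases hlayer a b c (h1.trans h2.symm) (h1.trans h3.symm) (by omega) (by omega) with h | h | h
    · exact hab h
    · exact hac h
    · exact hbc h
  -- Adjacent items differ by at most one level, and between surviving levels such a step cannot
  -- leave the window. Different blocks therefore evict disjoint subsets of `M`.
  have hsame : ∀ a ∈ R, ∀ a' ∈ R, ∀ b ∈ M, Clash lab a b → Clash lab a' b →
      block a = block a' := by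
    intro a ha a' ha' b hb hab ha'b
    by_cases hne : a = a'
    · rw [hne]
    rw [hR, Finset.mem_filter] at ha ha'
    have hadj : G.Adj a a' := ⟨hne, ha.1, ha'.1, b, hb, hab, ha'b⟩
    obtain ⟨hr, hl⟩ := hlev _ _ hadj
    obtain ⟨-, hl'⟩ := hlev _ _ hadj.symm
    simp only [hblock, Prod.mk.injEq]
    refine ⟨hr, ?_⟩
    have step : ∀ x, x % k ≠ j → (x + 1 + (k - 1 - j)) / k = (x + (k - 1 - j)) / k := by
      intro x hx
      have hxm := Nat.mod_lt x hk
      have e : x = k * (x / k) + x % k := (Nat.div_add_mod x k).symm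
      set m := x % k
      set q := x / k
      rw [e]
      rcases Nat.lt_or_ge m j with h | h
      · rw [show k * q + m + 1 + (k - 1 - j) = (m + 1 + (k - 1 - j)) + k * q by ring,
          show k * q + m + (k - 1 - j) = (m + (k - 1 - j)) + k * q by ring,
          Nat.add_mul_div_left _ _ hk, Nat.add_mul_div_left _ _ hk,
          Nat.div_eq_of_lt (by omega), Nat.div_eq_of_lt (by omega)]
      · have h' : j < m := by omega
        rw [show k * q + m + 1 + (k - 1 - j) = (m - j) + k * (q + 1) by
            rw [mul_add]; omega,
          show k * q + m + (k - 1 - j) = (m - j - 1) + k * (q + 1) by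
            rw [mul_add]; omega,
          Nat.add_mul_div_left _ _ hk, Nat.add_mul_div_left _ _ hk,
          Nat.div_eq_of_lt (by omega), Nat.div_eq_of_lt (by omega)]
    rcases Nat.lt_trichotomy (lev a) (lev a') with h | h | h
    · rw [show lev a' = lev a + 1 by omega, step _ ha.2]
    · rw [h]
    · rw [show lev a = lev a' + 1 by omega, step _ ha'.2]
  set 𝓑 := R.image block with h𝓑
  have hsumS : ∑ β ∈ 𝓑, ∑ a ∈ S β, (g a : ℝ) = ∑ a ∈ R, (g a : ℝ) :=
    Finset.sum_fiberwise_of_maps_to (fun a ha => Finset.mem_image_of_mem _ ha) _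
  have hsumN : ∑ β ∈ 𝓑, ∑ b ∈ M with ∃ a ∈ S β, Clash lab a b, (g b : ℝ) ≤
      ∑ b ∈ M, (g b : ℝ) := by
    rw [← Finset.sum_biUnion]
    · refine Finset.sum_le_sum_of_subset_of_nonneg ?_ fun _ _ _ => by positivity
      exact Finset.biUnion_subset.mpr fun _ _ => Finset.filter_subset _ _
    · intro β _ β' _ hne
      rw [Function.onFun, Finset.disjoint_left]
      intro b hb hb'
      rw [Finset.mem_filter] at hb hb'
      obtain ⟨hbM, a, ha, hab⟩ := hb
      obtain ⟨-, a', ha', hab'⟩ := hb'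
      rw [hS, Finset.mem_filter] at ha ha'
      exact hne (ha.2.symm.trans ((hsame a ha.1 a' ha'.1 b hbM hab hab').trans ha'.2))
  have hRsum : (1 - 1 / (k : ℝ)) * ∑ a ∈ O, (g a : ℝ) ≤ ∑ a ∈ R, (g a : ℝ) := by
    have h1 := Finset.sum_filter_add_sum_filter_not O (fun a => lev a % k = j) fun a => (g a : ℝ)
    have hk' : (0 : ℝ) < k := by exact_mod_cast hk
    have h2 : ∑ a ∈ O with lev a % k = j, (g a : ℝ) ≤ (1 / (k : ℝ)) * ∑ a ∈ O, (g a : ℝ) := by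
      rw [one_div, inv_mul_eq_div, le_div_iff₀ hk']
      linarith
    have h3 : ∑ a ∈ R, (g a : ℝ) = ∑ a ∈ O with ¬ lev a % k = j, (g a : ℝ) := rfl
    linarith
  set v : Q × ℕ → ℝ := fun β =>
    ∑ a ∈ S β, (g a : ℝ) - ∑ b ∈ M with ∃ a ∈ S β, Clash lab a b, (g b : ℝ)
  have hsum : (1 - 1 / (k : ℝ)) * ∑ a ∈ O, (g a : ℝ) - ∑ b ∈ M, (g b : ℝ) ≤ ∑ β ∈ 𝓑, v β := by
    rw [Finset.sum_sub_distrib, hsumS]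
    linarith
  set D := (1 - 1 / (k : ℝ)) * ∑ a ∈ O, (g a : ℝ) - ∑ b ∈ M, (g b : ℝ)
  have hne : 𝓑.Nonempty := by
    rw [Finset.nonempty_iff_ne_empty]
    intro h
    rw [h, Finset.sum_empty] at hsum
    linarith
  have hc0 : (0 : ℝ) < 𝓑.card := by exact_mod_cast hne.card_pos
  -- Some block gains at least the average, and there are no more blocks than items of `O`.
  obtain ⟨β, -, hβ⟩ := Finset.exists_le_of_sum_le (f := fun _ => D / 𝓑.card) (g := v) hne (by
    rw [Finset.sum_const, nsmul_eq_mul, mul_div_cancel₀ _ hc0.ne']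
    exact hsum)
  refine ⟨S β, hSO β, hcard β, ?_⟩
  have hv : 0 ≤ v β := le_trans (by positivity) hβ
  rw [div_le_iff₀ hc0] at hβ
  have hcμ : (𝓑.card : ℝ) ≤ μ := by
    exact_mod_cast Finset.card_image_le.trans ((Finset.card_filter_le _ _).trans hμ)
  calc D ≤ v β * 𝓑.card := hβ
    _ ≤ v β * μ := by gcongr
    _ = μ * v β := mul_comm _ _

/-! The search: insertions that evict clashing items, and the best outcome of a bounded number
of them. -/

/-- The first element of `a :: l` with the largest value. -/
def bestOf {α : Type*} (f : α → ℕ) (a : α) (l : List α) : α :=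
  l.foldl (fun x y => if f x < f y then y else x) a

theorem bestOf_mem {α : Type*} (f : α → ℕ) (a : α) (l : List α) : bestOf f a l ∈ a :: l := by
  induction l generalizing a with
  | nil => simp [bestOf]
  | cons b l ih =>
    have := ih (if f a < f b then b else a)
    unfold bestOf at this ⊢
    rw [List.foldl_cons]
    split_ifs at this ⊢ <;> grind

theorem le_bestOf {α : Type*} (f : α → ℕ) (a : α) (l : List α) {x : α} (hx : x ∈ a :: l) :
    f x ≤ f (bestOf f a l) := by
  induction l generalizing a x with
  | nil => simp_all [bestOf]
  | cons b l ih =>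
    have e : bestOf f a (b :: l) = bestOf f (if f a < f b then b else a) l := rfl
    rw [e]
    have h1 := ih (if f a < f b then b else a) List.mem_cons_self
    rcases List.mem_cons.mp hx with rfl | hx
    · refine le_trans ?_ h1
      split_ifs <;> omega
    · rcases List.mem_cons.mp hx with rfl | hx
      · refine le_trans ?_ h1
        split_ifs <;> omega
      · exact ih _ (List.mem_cons_of_mem _ hx)

variable (lab)

open Classical in
/-- Insert `q` and remove everything that clashes with it. -/
noncomputable def insertEvict (q : Q) (M : List Q) : List Q :=
  q :: M.filter fun r => ¬ Clash lab q r

/-- The outcomes of at most `k` insertions of items from `E`. -/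
noncomputable def exchanges (E M : List Q) : ℕ → List (List Q)
  | 0 => [M]
  | k + 1 => (exchanges E M k).flatMap fun c => c :: E.map fun q => insertEvict lab q c

/-- The best outcome of at most `k` insertions. -/
noncomputable def improve (E : List Q) (k : ℕ) (M : List Q) : List Q :=
  bestOf (fun N => (N.map g).sum) M (exchanges lab E M k)

/-- Local search from the empty set, for `t` rounds. -/
noncomputable def localSearch (E : List Q) (k t : ℕ) : List Q :=
  (improve lab g E k)^[t] []

/-- A set of items from `E` without clashes. -/
def IsPacking (E M : List Q) : Prop :=
  (∀ q ∈ M, q ∈ E) ∧ M.Pairwise fun p q => ¬ Clash lab p q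

variable {lab}

namespace IsPacking

variable {E M : List Q}

theorem nodup (h : IsPacking lab E M) : M.Nodup :=
  h.2.imp fun {a b} hab => by rintro rfl; exact hab (.refl a)

theorem length_le (h : IsPacking lab E M) : M.length ≤ E.length :=
  (h.nodup.subperm h.1).length_le

theorem eq_of_clash (h : IsPacking lab E M) {p q : Q} (hp : p ∈ M) (hq : q ∈ M)
    (hpq : Clash lab p q) : p = q := by
  by_contra hne
  have : Std.Symm (fun p q => ¬ Clash lab p q) := ⟨fun _ _ hxy hyx => hxy hyx.symm⟩
  exact h.2.forall hp hq hne hpq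

theorem nil : IsPacking lab E [] := ⟨by simp, .nil⟩

theorem insertEvict (h : IsPacking lab E M) {q : Q} (hq : q ∈ E) :
    IsPacking lab E (insertEvict lab q M) := by
  refine ⟨?_, List.pairwise_cons.mpr ⟨by simp, h.2.filter _⟩⟩
  intro p hp
  rcases List.mem_cons.mp hp with rfl | hp
  · exact hq
  · exact h.1 _ (List.mem_of_mem_filter hp)

theorem exchanges (h : IsPacking lab E M) {k : ℕ} {c : List Q} (hc : c ∈ exchanges lab E M k) :
    IsPacking lab E c := by
  induction k generalizing c with
  | zero =>
    rw [_root_.exchanges, List.mem_singleton] at hc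
    rwa [hc]
  | succ k ih =>
    rw [_root_.exchanges, List.mem_flatMap] at hc
    obtain ⟨d, hd, hc⟩ := hc
    rcases List.mem_cons.mp hc with rfl | hc
    · exact ih hd
    · obtain ⟨q, hq, rfl⟩ := List.mem_map.mp hc
      exact (ih hd).insertEvict hq

theorem improve (h : IsPacking lab E M) (k : ℕ) : IsPacking lab E (improve lab g E k M) := by
  rcases List.mem_cons.mp (bestOf_mem (fun N => (N.map g).sum) M (_root_.exchanges lab E M k))
    with h' | h'
  · rw [_root_.improve, h']
    exact h
  · exact h.exchanges h'

end IsPacking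

theorem isPacking_iterate (E : List Q) (k t : ℕ) :
    IsPacking lab E ((improve lab g E k)^[t] []) := by
  induction t with
  | zero => exact .nil
  | succ t ih => rw [Function.iterate_succ_apply']; exact ih.improve g k

theorem isPacking_localSearch (E : List Q) (k t : ℕ) :
    IsPacking lab E (localSearch lab g E k t) := isPacking_iterate g E k t

theorem length_exchanges (E M : List Q) (k : ℕ) :
    (exchanges lab E M k).length = (E.length + 1) ^ k := by
  induction k with
  | zero => rfl
  | succ k ih => simp [exchanges, List.length_flatMap, ih, pow_succ]

theorem mem_exchanges_succ {E M c : List Q} {k : ℕ} (hc : c ∈ exchanges lab E M k) :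
    c ∈ exchanges lab E M (k + 1) :=
  List.mem_flatMap.mpr ⟨c, hc, List.mem_cons_self⟩

-- The items of `t` do not clash with each other, so inserting them one after another never evicts
-- an earlier one: the net effect is the simultaneous exchange of `t` for everything that clashes
-- with it.
open Classical in
theorem insert_list_mem_exchanges (E M t : List Q) (ht : ∀ q ∈ t, q ∈ E)
    (hp : t.Pairwise fun p q => ¬ Clash lab p q) {k : ℕ} (hk : t.length ≤ k) :
    t ++ M.filter (fun r => ¬ ∃ q ∈ t, Clash lab q r) ∈ exchanges lab E M k := by
  induction k generalizing t with
  | zero =>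
    obtain rfl : t = [] := List.length_eq_zero_iff.mp (by omega)
    simp [exchanges]
  | succ k ih =>
    cases t with
    | nil => exact mem_exchanges_succ (ih [] (by simp) .nil (by simp))
    | cons q t =>
      have h := ih t (fun p hp => ht p (List.mem_cons_of_mem _ hp)) (List.pairwise_cons.mp hp).2
        (by simpa using hk)
      refine List.mem_flatMap.mpr ⟨_, h, List.mem_cons_of_mem _ (List.mem_map.mpr
        ⟨q, ht q List.mem_cons_self, ?_⟩)⟩
      rw [insertEvict, List.filter_append, List.filter_filter, List.cons_append]
      congr 1
      congr 1
      · rw [List.filter_eq_self]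
        exact fun p hpt => by simpa using (List.pairwise_cons.mp hp).1 p hpt
      · congr 1
        ext r
        simp

theorem sum_improve (E : List Q) (k : ℕ) (M : List Q) {c : List Q}
    (hc : c ∈ M :: exchanges lab E M k) : (c.map g).sum ≤ ((improve lab g E k M).map g).sum :=
  le_bestOf (fun N => (N.map g).sum) M _ hc

/-- The small exchange recovers at least a share `1 / μ` of the gap to the target `(1 - 1 / k)
g(O)`, and it is among the candidates of one round. The gap may be negative, in which case the
inequality still holds. -/
theorem improve_gap {E M : List Q} (hM : IsPacking lab E M) {O : Finset Q} (hOE : ∀ q ∈ O, q ∈ E)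
    (hO : ∀ p ∈ O, ∀ q ∈ O, Clash lab p q → p = q) {k : ℕ} (hk : 0 < k) {μ : ℕ} (hμ0 : 0 < μ)
    (hμ : O.card ≤ μ) :
    (1 - 1 / (k : ℝ)) * ∑ a ∈ O, (g a : ℝ) - ((improve lab g E (2 * k) M).map g).sum ≤
      (1 - 1 / (μ : ℝ)) * ((1 - 1 / (k : ℝ)) * ∑ a ∈ O, (g a : ℝ) - (M.map g).sum) := by
  classical
  have hsumM : ∀ N : List Q, N.Nodup → ((N.map g).sum : ℝ) = ∑ b ∈ N.toFinset, (g b : ℝ) := by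
    intro N hN
    rw [← Nat.cast_sum, List.sum_toFinset _ hN]
  obtain ⟨S, hSO, hSk, hS⟩ := exists_small_exchange (lab := lab) g (M := M.toFinset) (O := O)
    (fun p hp q hq => hM.eq_of_clash (List.mem_toFinset.mp hp) (List.mem_toFinset.mp hq))
    hO hk hμ
  have hSp : S.toList.Pairwise fun p q => ¬ Clash lab p q := by
    refine List.Pairwise.imp_of_mem ?_ S.nodup_toList
    intro a b ha hb hab hc
    exact hab (hO a (hSO (Finset.mem_toList.mp ha)) b (hSO (Finset.mem_toList.mp hb)) hc)
  have hmem := insert_list_mem_exchanges E M S.toList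
    (fun q hq => hOE q (hSO (Finset.mem_toList.mp hq))) hSp (k := 2 * k) (by simpa using hSk)
  have hle := sum_improve g E (2 * k) M (List.mem_cons_of_mem _ hmem)
  have hval : (((S.toList ++ M.filter (fun r => ¬ ∃ q ∈ S.toList, Clash lab q r)).map g).sum : ℝ)
      = ∑ a ∈ S, (g a : ℝ) + ∑ b ∈ M.toFinset, (g b : ℝ) -
        ∑ b ∈ M.toFinset with ∃ a ∈ S, Clash lab a b, (g b : ℝ) := by
    rw [List.map_append, List.sum_append, Nat.cast_add, hsumM _ (hM.nodup.filter _),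
      hsumM _ S.nodup_toList, Finset.toList_toFinset, List.toFinset_filter]
    have := Finset.sum_filter_add_sum_filter_not M.toFinset (fun b => ∃ a ∈ S, Clash lab a b)
      fun b => (g b : ℝ)
    simp only [decide_not, Bool.not_eq_eq_eq_not, Bool.not_true, decide_eq_false_iff_not,
      Finset.mem_toList]
    linarith
  rw [hsumM M hM.nodup]
  have hle' : (((S.toList ++ M.filter (fun r => ¬ ∃ q ∈ S.toList, Clash lab q r)).map g).sum : ℝ)
    ≤ ((improve lab g E (2 * k) M).map g).sum := by exact_mod_cast hle
  rw [hval] at hle'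
  have hμ' : (0 : ℝ) < μ := by exact_mod_cast hμ0
  set D := (1 - 1 / (k : ℝ)) * ∑ a ∈ O, (g a : ℝ) - ∑ b ∈ M.toFinset, (g b : ℝ) with hD
  have h1 : D / μ ≤ ∑ a ∈ S, (g a : ℝ) -
      ∑ b ∈ M.toFinset with ∃ a ∈ S, Clash lab a b, (g b : ℝ) := by
    rw [div_le_iff₀ hμ', mul_comm]
    exact hS
  have h2 : (1 - 1 / (μ : ℝ)) * D = D - D / μ := by ring
  rw [h2]
  linarith

/-- Local search finds a packing of weight at least `1 - 2 / k` times the maximum. -/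
theorem localSearch_ge {E : List Q} {O : Finset Q} (hOE : ∀ q ∈ O, q ∈ E)
    (hO : ∀ p ∈ O, ∀ q ∈ O, Clash lab p q → p = q) {k : ℕ} (hk : 0 < k) :
    (1 - 2 / (k : ℝ)) * ∑ a ∈ O, (g a : ℝ) ≤
      ((localSearch lab g E (2 * k) (E.length * k)).map g).sum := by
  classical
  rcases Nat.eq_zero_or_pos E.length with h0 | hμ0
  · have hE : E = [] := List.length_eq_zero_iff.mp h0
    have : O = ∅ := Finset.eq_empty_of_forall_notMem fun q hq => by simpa [hE] using hOE q hq
    rw [this, Finset.sum_empty, mul_zero]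
    exact Nat.cast_nonneg _
  have hμ : O.card ≤ E.length := by
    rw [← Finset.length_toList]
    exact (O.nodup_toList.subperm fun q hq => hOE q (Finset.mem_toList.mp hq)).length_le
  set μ := E.length
  set W : ℝ := ∑ a ∈ O, (g a : ℝ)
  have hW : 0 ≤ W := by positivity
  have hk' : (1 : ℝ) ≤ k := by exact_mod_cast hk
  have hμ' : (1 : ℝ) ≤ μ := by exact_mod_cast hμ0
  have hT : 0 ≤ (1 - 1 / (k : ℝ)) := by
    rw [sub_nonneg, div_le_one (by linarith)]
    exact hk'
  have hr : 0 ≤ (1 - 1 / (μ : ℝ)) := by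
    rw [sub_nonneg, div_le_one (by linarith)]
    exact hμ'
  -- The gap decays geometrically from its value for the empty packing.
  have iter : ∀ t : ℕ, (1 - 1 / (k : ℝ)) * W - (((improve lab g E (2 * k))^[t] []).map g).sum ≤
      (1 - 1 / (μ : ℝ)) ^ t * ((1 - 1 / (k : ℝ)) * W) := by
    intro t
    induction t with
    | zero => simp
    | succ t ih =>
      rw [Function.iterate_succ_apply']
      refine (improve_gap g (isPacking_iterate g E (2 * k) t) hOE hO hk hμ0 hμ).trans ?_
      rw [pow_succ', mul_assoc]
      exact mul_le_mul_of_nonneg_left ih hr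
  have h1 := iter (μ * k)
  -- After `μ k` rounds the factor is at most `exp (-k)`, and `exp k ≥ k + 1`. The rest of the gap
  -- costs a second `1 / k`.
  have h2 : (1 - 1 / (μ : ℝ)) ^ (μ * k) ≤ 1 / (k : ℝ) := by
    have h3 := Real.one_sub_div_pow_le_exp_neg (n := μ * k) (t := k) (by
      push_cast
      nlinarith)
    have h4 : (k : ℝ) / ((μ * k : ℕ) : ℝ) = 1 / μ := by
      push_cast
      field_simp
    rw [h4] at h3
    refine h3.trans ?_
    rw [Real.exp_neg, one_div]
    exact inv_anti₀ (by linarith) (by linarith [Real.add_one_le_exp (k : ℝ)])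
  have h5 : (1 - 1 / (μ : ℝ)) ^ (μ * k) * ((1 - 1 / (k : ℝ)) * W) ≤ 1 / k * W := by
    refine (mul_le_mul_of_nonneg_right h2 (by positivity)).trans ?_
    refine mul_le_mul_of_nonneg_left ?_ (by positivity)
    have : 0 ≤ 1 / (k : ℝ) * W := by positivity
    linarith
  have h6 : (1 - 2 / (k : ℝ)) * W = (1 - 1 / (k : ℝ)) * W - 1 / k * W := by ring
  rw [h6, localSearch]
  linarith

end localSearch

/-! ### Pieces of an extended strip decomposition -/

/-- A set of vertices that is either a basic part of an extended strip decomposition or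
an item (an atom that merges several parts), together with the two labels of an item. -/
structure Piece (n : ℕ) where
  item : Bool
  lab : (ℕ × ℕ) × (ℕ × ℕ)
  set : Finset (Fin n)

namespace StripData

variable {n : ℕ} (S : StripData n)

/-- Basic pieces take no part in the local search, so their labels are placeholders. -/
def vertexPiece (u : Fin S.m) : Piece n := ⟨false, ((0, 0), (0, 0)), S.η (.vertex u)⟩

def trianglePiece (T : Finset (Fin S.m)) : Piece n := ⟨false, ((0, 0), (0, 0)), S.η (.triangle T)⟩

def botPiece (u v : Fin S.m) : Piece n :=
  ⟨false, ((0, 0), (0, 0)), S.η (.edge s(u, v)) \ (S.ηEnd s(u, v) u ∪ S.ηEnd s(u, v) v)⟩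

/-- The label `(u, u)` stands for the vertex `u` and `(min u v, max u v)` for the edge `uv`; the two
kinds never coincide for an edge of `H`. The edge label makes `onePiece u v` and `onePiece v u`
clash. -/
def onePiece (u v : Fin S.m) : Piece n :=
  ⟨true, ((u, u), (min u v, max u v)),
    S.η (.vertex u) ∪ (S.η (.edge s(u, v)) \ S.ηEnd s(u, v) v)⟩

/-- No label for the edge is needed: every other item that involves `uv` carries `u` or `v`. -/
noncomputable def fullPiece (u v : Fin S.m) : Piece n :=
  ⟨true, ((u, u), (v, v)),
    S.η (.vertex u) ∪ S.η (.vertex v) ∪ S.η (.edge s(u, v)) ∪ S.trianglesAt u v⟩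

open Classical in
/-- The pieces that belong to the ordered pair `(u, v)`. -/
noncomputable def edgePieces (u v : Fin S.m) : List (Piece n) :=
  if S.H.Adj u v then [S.botPiece u v, S.onePiece u v, S.fullPiece u v] else []

open Classical in
noncomputable def trianglePieces (u v z : Fin S.m) : List (Piece n) :=
  if S.H.Adj u v ∧ S.H.Adj v z ∧ S.H.Adj u z then [S.trianglePiece {u, v, z}] else []

/-- All pieces. -/
noncomputable def pieces : List (Piece n) :=
  (List.finRange S.m).map S.vertexPiece ++
    (((List.finRange S.m).flatMap fun u => (List.finRange S.m).flatMap fun v => S.edgePieces u v) ++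
      (List.finRange S.m).flatMap fun u => (List.finRange S.m).flatMap fun v =>
        (List.finRange S.m).flatMap fun z => S.trianglePieces u v z)

variable {S}

theorem mem_pieces {q : Piece n} : q ∈ S.pieces ↔ (∃ u, q = S.vertexPiece u) ∨
    (∃ u v, S.H.Adj u v ∧ (q = S.botPiece u v ∨ q = S.onePiece u v ∨ q = S.fullPiece u v)) ∨
    ∃ T, S.H.IsNClique 3 T ∧ q = S.trianglePiece T := by
  simp only [pieces, List.mem_append, List.mem_map, List.mem_finRange, true_and, List.mem_flatMap,
    edgePieces, trianglePieces, List.mem_ite_nil_right, List.mem_cons, List.not_mem_nil, or_false]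
  refine or_congr ⟨fun ⟨u, h⟩ => ⟨u, h.symm⟩, fun ⟨u, h⟩ => ⟨u, h.symm⟩⟩ (or_congr Iff.rfl ?_)
  constructor
  · rintro ⟨u, v, z, ⟨h1, h2, h3⟩, rfl⟩
    exact ⟨_, SimpleGraph.is3Clique_iff.mpr ⟨u, v, z, h1, h3, h2, rfl⟩, rfl⟩
  · rintro ⟨T, hT, rfl⟩
    obtain ⟨u, v, z, h1, h3, h2, rfl⟩ := SimpleGraph.is3Clique_iff.mp hT
    exact ⟨u, v, z, ⟨h1, h2, h3⟩, rfl⟩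

theorem isAtom_of_mem_pieces {q : Piece n} (hq : q ∈ S.pieces) : S.IsAtom q.set := by
  rcases mem_pieces.mp hq with ⟨u, rfl⟩ | ⟨u, v, h, rfl | rfl | rfl⟩ | ⟨T, hT, rfl⟩
  · exact .vertex u
  · exact .bot u v h
  · exact .one u v h
  · exact .full u v h
  · exact .triangle T hT

theorem mem_botPiece {u v : Fin S.m} {x : Fin n} : x ∈ (S.botPiece u v).set ↔
    x ∈ S.η (.edge s(u, v)) ∧ x ∉ S.ηEnd s(u, v) u ∧ x ∉ S.ηEnd s(u, v) v := by
  simp [botPiece]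

theorem mem_onePiece {u v : Fin S.m} {x : Fin n} : x ∈ (S.onePiece u v).set ↔
    x ∈ S.η (.vertex u) ∨ x ∈ S.η (.edge s(u, v)) ∧ x ∉ S.ηEnd s(u, v) v := by
  simp [onePiece]

theorem mem_trianglesAt {u v : Fin S.m} {x : Fin n} : x ∈ S.trianglesAt u v ↔
    ∃ T, S.H.IsNClique 3 T ∧ u ∈ T ∧ v ∈ T ∧ x ∈ S.η (.triangle T) := by
  simp [trianglesAt, and_assoc]

theorem mem_fullPiece {u v : Fin S.m} {x : Fin n} : x ∈ (S.fullPiece u v).set ↔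
    x ∈ S.η (.vertex u) ∨ x ∈ S.η (.vertex v) ∨ x ∈ S.η (.edge s(u, v)) ∨
      ∃ T, S.H.IsNClique 3 T ∧ u ∈ T ∧ v ∈ T ∧ x ∈ S.η (.triangle T) := by
  simp [fullPiece, mem_trianglesAt]

namespace Decomposes

variable {G : SimpleGraph (Fin n)} {Y : Finset (Fin n)}

theorem part_unique (hS : S.Decomposes G Y) {x : Fin n} {p p' : StripPart S.m} (hp : S.IsPart p)
    (hp' : S.IsPart p') (hx : x ∈ S.η p) (hx' : x ∈ S.η p') : p = p' :=
  (hS.partition x (hS.part_subset p hp hx)).unique ⟨hp, hx⟩ ⟨hp', hx'⟩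

theorem end_mem (hS : S.Decomposes G Y) {u v : Fin S.m} (h : S.H.Adj u v) {x : Fin n}
    (hx : x ∈ S.ηEnd s(u, v) u) : x ∈ S.η (.edge s(u, v)) := hS.end_subset u v h hx

end Decomposes

theorem Decomposes.set_subset {G : SimpleGraph (Fin n)} {Y : Finset (Fin n)}
    (hS : S.Decomposes G Y) {q : Piece n} (hq : q ∈ S.pieces) : q.set ⊆ Y := by
  have hV : ∀ u, S.η (.vertex u) ⊆ Y := fun u => hS.part_subset (.vertex u) trivial
  have hE : ∀ u v, S.H.Adj u v → S.η (.edge s(u, v)) ⊆ Y :=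
    fun u v h => hS.part_subset (.edge s(u, v)) h
  have hT : ∀ T, S.H.IsNClique 3 T → S.η (.triangle T) ⊆ Y :=
    fun T h => hS.part_subset (.triangle T) h
  intro x hx
  rcases mem_pieces.mp hq with ⟨u, rfl⟩ | ⟨u, v, h, rfl | rfl | rfl⟩ | ⟨T, h, rfl⟩
  · exact hV u hx
  · exact hE u v h (mem_botPiece.mp hx).1
  · rcases mem_onePiece.mp hx with h' | h'
    · exact hV u h'
    · exact hE u v h h'.1
  · rcases mem_fullPiece.mp hx with h' | h' | h' | ⟨T, hT', -, -, h'⟩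
    · exact hV u h'
    · exact hV v h'
    · exact hE u v h h'
    · exact hT T hT' h'
  · exact hT T h hx

/-! #### The pieces that partition a given independent set -/

variable (S) in
/-- The set `I` meets `η(uv, u)`. -/
def Hits (I : Finset (Fin n)) (u v : Fin S.m) : Prop :=
  S.H.Adj u v ∧ ∃ x ∈ I, x ∈ S.ηEnd s(u, v) u

variable (S) in
/-- The pieces into which `I` splits. -/
inductive Chosen (I : Finset (Fin n)) : Piece n → Prop
  | full (u v : Fin S.m) : u < v → S.Hits I u v → S.Hits I v u → Chosen I (S.fullPiece u v)
  | one (u v : Fin S.m) : S.Hits I u v → ¬ S.Hits I v u → Chosen I (S.onePiece u v)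
  | vertex (u : Fin S.m) : (∀ v, ¬ S.Hits I u v) → Chosen I (S.vertexPiece u)
  | bot (u v : Fin S.m) : u < v → S.H.Adj u v → ¬ S.Hits I u v → ¬ S.Hits I v u →
      Chosen I (S.botPiece u v)
  | triangle (T : Finset (Fin S.m)) : S.H.IsNClique 3 T →
      (∀ u ∈ T, ∀ v ∈ T, u < v → S.Hits I u v → ¬ S.Hits I v u) → Chosen I (S.trianglePiece T)

theorem Chosen.mem_pieces {I : Finset (Fin n)} {q : Piece n} (h : S.Chosen I q) :
    q ∈ S.pieces := by
  rw [StripData.mem_pieces]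
  rcases h with ⟨u, v, _, h, _⟩ | ⟨u, v, h, _⟩ | ⟨u, _⟩ | ⟨u, v, _, h, _⟩ | ⟨T, h, _⟩
  · exact .inr (.inl ⟨u, v, h.1, .inr (.inr rfl)⟩)
  · exact .inr (.inl ⟨u, v, h.1, .inr (.inl rfl)⟩)
  · exact .inl ⟨u, rfl⟩
  · exact .inr (.inl ⟨u, v, h, .inl rfl⟩)
  · exact .inr (.inr ⟨T, h, rfl⟩)

section chosen

variable {G : SimpleGraph (Fin n)} {Y I : Finset (Fin n)}

/-- Hits on two edges at `u` would give two adjacent vertices of `I`, as the end sets at `u` are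
fully adjacent. This uniqueness is what makes the chosen items a matching. -/
theorem Hits.unique (hS : S.Decomposes G Y) (hI : G.IsIndepSet (I : Set (Fin n)))
    {u v v' : Fin S.m} (h : S.Hits I u v) (h' : S.Hits I u v') : v = v' := by
  by_contra hne
  obtain ⟨ha, x, hx, hxe⟩ := h
  obtain ⟨ha', y, hy, hye⟩ := h'
  have := hS.complete u v v' ha ha' hne x hxe y hye
  exact hI hx hy this.ne this

namespace Decomposes

theorem vertex_eq (hS : S.Decomposes G Y) {u v : Fin S.m} {x : Fin n}
    (h : x ∈ S.η (.vertex u)) (h' : x ∈ S.η (.vertex v)) : v = u := by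
  simpa using hS.part_unique (p := .vertex v) (p' := .vertex u) trivial trivial h' h

theorem vertex_edge (hS : S.Decomposes G Y) {u a b : Fin S.m} {x : Fin n}
    (h : x ∈ S.η (.vertex u)) (hab : S.H.Adj a b) : x ∉ S.η (.edge s(a, b)) := fun h' => by
  simpa using hS.part_unique (p := .vertex u) (p' := .edge s(a, b)) trivial hab h h'

theorem vertex_triangle (hS : S.Decomposes G Y) {u : Fin S.m} {T : Finset (Fin S.m)} {x : Fin n}
    (h : x ∈ S.η (.vertex u)) (hT : S.H.IsNClique 3 T) : x ∉ S.η (.triangle T) := fun h' => by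
  simpa using hS.part_unique (p := .vertex u) (p' := .triangle T) trivial hT h h'

theorem edge_eq (hS : S.Decomposes G Y) {a b a' b' : Fin S.m} {x : Fin n} (hab : S.H.Adj a b)
    (h : x ∈ S.η (.edge s(a, b))) (hab' : S.H.Adj a' b') (h' : x ∈ S.η (.edge s(a', b'))) :
    a' = a ∧ b' = b ∨ a' = b ∧ b' = a := by
  have := hS.part_unique (p := .edge s(a', b')) (p' := .edge s(a, b)) hab' hab h' h
  simpa using this

theorem edge_triangle (hS : S.Decomposes G Y) {a b : Fin S.m} {T : Finset (Fin S.m)} {x : Fin n}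
    (hab : S.H.Adj a b) (h : x ∈ S.η (.edge s(a, b))) (hT : S.H.IsNClique 3 T) :
    x ∉ S.η (.triangle T) := fun h' => by
  simpa using hS.part_unique (p := .edge s(a, b)) (p' := .triangle T) hab hT h h'

theorem triangle_eq (hS : S.Decomposes G Y) {T T' : Finset (Fin S.m)} {x : Fin n}
    (hT : S.H.IsNClique 3 T) (h : x ∈ S.η (.triangle T)) (hT' : S.H.IsNClique 3 T')
    (h' : x ∈ S.η (.triangle T')) : T' = T := by
  simpa using hS.part_unique (p := .triangle T') (p' := .triangle T) hT' hT h' h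

end Decomposes

variable (S I) in
/-- The chosen piece that contains `η(u)`. -/
def ChosenAt (u : Fin S.m) (q : Piece n) : Prop :=
  (∃ v, S.Hits I u v ∧ S.Hits I v u ∧ q = S.fullPiece (min u v) (max u v)) ∨
    (∃ v, S.Hits I u v ∧ ¬ S.Hits I v u ∧ q = S.onePiece u v) ∨
    (∀ v, ¬ S.Hits I u v) ∧ q = S.vertexPiece u

theorem ChosenAt.unique (hS : S.Decomposes G Y) (hI : G.IsIndepSet (I : Set (Fin n)))
    {u : Fin S.m} {q q' : Piece n} (h : S.ChosenAt I u q) (h' : S.ChosenAt I u q') : q = q' := by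
  rcases h with ⟨v, h1, h2, rfl⟩ | ⟨v, h1, h2, rfl⟩ | ⟨h1, rfl⟩ <;>
  rcases h' with ⟨v', h1', h2', rfl⟩ | ⟨v', h1', h2', rfl⟩ | ⟨h1', rfl⟩
  · rw [h1.unique hS hI h1']
  · rw [h1.unique hS hI h1'] at h2
    exact absurd h2 h2'
  · exact absurd h1 (h1' v)
  · rw [h1.unique hS hI h1'] at h2
    exact absurd h2' h2
  · rw [h1.unique hS hI h1']
  · exact absurd h1 (h1' v)
  · exact absurd h1' (h1 v')
  · exact absurd h1' (h1 v')
  · rfl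

theorem chosenAt_full {u v : Fin S.m} (huv : u < v) (h : S.Hits I u v) (h' : S.Hits I v u) :
    S.ChosenAt I u (S.fullPiece u v) ∧ S.ChosenAt I v (S.fullPiece u v) :=
  ⟨.inl ⟨v, h, h', by rw [min_eq_left huv.le, max_eq_right huv.le]⟩,
    .inl ⟨u, h', h, by rw [min_eq_right huv.le, max_eq_left huv.le]⟩⟩

theorem Chosen.chosenAt (hS : S.Decomposes G Y) {u : Fin S.m} {q : Piece n} {x : Fin n}
    (hq : S.Chosen I q) (hx : x ∈ q.set) (hu : x ∈ S.η (.vertex u)) : S.ChosenAt I u q := by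
  rcases hq with ⟨a, b, hab, h1, h2⟩ | ⟨a, b, h1, h2⟩ | ⟨a, h⟩ | ⟨a, b, _, h, _⟩ | ⟨T, hT, _⟩
  · rcases mem_fullPiece.mp hx with h | h | h | ⟨T, hT, -, -, h⟩
    · rw [← hS.vertex_eq hu h]
      exact (chosenAt_full hab h1 h2).1
    · rw [← hS.vertex_eq hu h]
      exact (chosenAt_full hab h1 h2).2
    · exact absurd h (hS.vertex_edge hu h1.1)
    · exact absurd h (hS.vertex_triangle hu hT)
  · rcases mem_onePiece.mp hx with h | h
    · rw [← hS.vertex_eq hu h]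
      exact .inr (.inl ⟨b, h1, h2, rfl⟩)
    · exact absurd h.1 (hS.vertex_edge hu h1.1)
  · rw [← hS.vertex_eq hu hx]
    exact .inr (.inr ⟨h, rfl⟩)
  · exact absurd (mem_botPiece.mp hx).1 (hS.vertex_edge hu h)
  · exact absurd hx (hS.vertex_triangle hu hT)

variable (S I) in
/-- The chosen piece that contains the interior of `η(uv)`, for `u < v`. -/
def ChosenOn (u v : Fin S.m) (q : Piece n) : Prop :=
  (S.Hits I u v ∧ S.Hits I v u ∧ q = S.fullPiece u v) ∨
    (S.Hits I u v ∧ ¬ S.Hits I v u ∧ q = S.onePiece u v) ∨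
    (¬ S.Hits I u v ∧ S.Hits I v u ∧ q = S.onePiece v u) ∨
    (¬ S.Hits I u v ∧ ¬ S.Hits I v u ∧ q = S.botPiece u v)

theorem ChosenOn.unique {u v : Fin S.m} {q q' : Piece n} (h : S.ChosenOn I u v q)
    (h' : S.ChosenOn I u v q') : q = q' := by
  unfold ChosenOn at h h'
  grind

theorem Chosen.chosenOn (hS : S.Decomposes G Y) {u v : Fin S.m} (huv : u < v)
    (hadj : S.H.Adj u v) {q : Piece n} {x : Fin n} (hq : S.Chosen I q) (hx : x ∈ q.set)
    (hu : x ∈ S.η (.edge s(u, v))) : S.ChosenOn I u v q := by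
  rcases hq with ⟨a, b, hab, h1, h2⟩ | ⟨a, b, h1, h2⟩ | ⟨a, h⟩ | ⟨a, b, hab, h, h1, h2⟩ | ⟨T, hT, _⟩
  · rcases mem_fullPiece.mp hx with h | h | h | ⟨T, hT, -, -, h⟩
    · exact absurd hu (hS.vertex_edge h hadj)
    · exact absurd hu (hS.vertex_edge h hadj)
    · rcases hS.edge_eq hadj hu h1.1 h with ⟨rfl, rfl⟩ | ⟨rfl, rfl⟩
      · exact .inl ⟨h1, h2, rfl⟩
      · exact absurd hab huv.asymm
    · exact absurd h (hS.edge_triangle hadj hu hT)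
  · rcases mem_onePiece.mp hx with h | h
    · exact absurd hu (hS.vertex_edge h hadj)
    · rcases hS.edge_eq hadj hu h1.1 h.1 with ⟨rfl, rfl⟩ | ⟨rfl, rfl⟩
      · exact .inr (.inl ⟨h1, h2, rfl⟩)
      · exact .inr (.inr (.inl ⟨h2, h1, rfl⟩))
  · exact absurd hu (hS.vertex_edge hx hadj)
  · rcases hS.edge_eq hadj hu h (mem_botPiece.mp hx).1 with ⟨rfl, rfl⟩ | ⟨rfl, rfl⟩
    · exact .inr (.inr (.inr ⟨h1, h2, rfl⟩))
    · exact absurd hab huv.asymm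
  · exact absurd hx (hS.edge_triangle hadj hu hT)

theorem pairs_meet {T : Finset (Fin S.m)} (hT : S.H.IsNClique 3 T) {a b c d : Fin S.m}
    (ha : a ∈ T) (hb : b ∈ T) (hc : c ∈ T) (hd : d ∈ T) (hab : a ≠ b) (hcd : c ≠ d) :
    a = c ∨ a = d ∨ b = c ∨ b = d := by
  obtain ⟨u, v, z, -, -, -, rfl⟩ := SimpleGraph.is3Clique_iff.mp hT
  simp only [Finset.mem_insert, Finset.mem_singleton] at ha hb hc hd
  grind

/-- Any two edges of a triangle share a vertex, and only one piece is chosen at that vertex. So at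
most one full piece reaches `η(T)`, and the triangle piece is chosen only if there is none. -/
theorem Chosen.eq_of_mem_triangle (hS : S.Decomposes G Y) (hI : G.IsIndepSet (I : Set (Fin n)))
    {T : Finset (Fin S.m)} (hT : S.H.IsNClique 3 T) {q q' : Piece n} {x y : Fin n}
    (hq : S.Chosen I q) (hq' : S.Chosen I q') (hx : x ∈ q.set) (hx' : y ∈ q'.set)
    (hu : x ∈ S.η (.triangle T)) (hu' : y ∈ S.η (.triangle T)) : q = q' := by
  have key : ∀ {q : Piece n} {x : Fin n}, S.Chosen I q → x ∈ q.set → x ∈ S.η (.triangle T) →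
      (∃ a ∈ T, ∃ b ∈ T, a < b ∧ S.Hits I a b ∧ S.Hits I b a ∧ q = S.fullPiece a b) ∨
      ((∀ u ∈ T, ∀ v ∈ T, u < v → S.Hits I u v → ¬ S.Hits I v u) ∧ q = S.trianglePiece T) := by
    intro q x hq hx hu
    rcases hq with ⟨a, b, hab, h1, h2⟩ | ⟨a, b, h1, h2⟩ | ⟨a, h⟩ | ⟨a, b, hab, h, h1, h2⟩ |
      ⟨T', hT', h⟩
    · rcases mem_fullPiece.mp hx with h | h | h | ⟨T', hT', ha, hb, h⟩
      · exact absurd hu (hS.vertex_triangle h hT)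
      · exact absurd hu (hS.vertex_triangle h hT)
      · exact absurd hu (hS.edge_triangle h1.1 h hT)
      · obtain rfl := hS.triangle_eq hT hu hT' h
        exact .inl ⟨a, ha, b, hb, hab, h1, h2, rfl⟩
    · rcases mem_onePiece.mp hx with h | h
      · exact absurd hu (hS.vertex_triangle h hT)
      · exact absurd hu (hS.edge_triangle h1.1 h.1 hT)
    · exact absurd hu (hS.vertex_triangle hx hT)
    · exact absurd hu (hS.edge_triangle h (mem_botPiece.mp hx).1 hT)
    · obtain rfl := hS.triangle_eq hT hu hT' hx
      exact .inr ⟨h, rfl⟩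
  rcases key hq hx hu with ⟨a, ha, b, hb, hab, h1, h2, rfl⟩ | ⟨h, rfl⟩ <;>
  rcases key hq' hx' hu' with ⟨a', ha', b', hb', hab', h1', h2', rfl⟩ | ⟨h', rfl⟩
  · have hc := chosenAt_full hab h1 h2
    have hc' := chosenAt_full hab' h1' h2'
    rcases pairs_meet hT ha hb ha' hb' hab.ne hab'.ne with rfl | rfl | rfl | rfl
    · exact hc.1.unique hS hI hc'.1
    · exact hc.1.unique hS hI hc'.2
    · exact hc.2.unique hS hI hc'.1
    · exact hc.2.unique hS hI hc'.2
  · exact absurd h2 (h' a ha b hb hab h1)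
  · exact absurd h2' (h a' ha' b' hb' hab' h1')
  · rfl

theorem exists_lt_of_edge {e : Sym2 (Fin S.m)} (he : e ∈ S.H.edgeSet) :
    ∃ u v, u < v ∧ S.H.Adj u v ∧ e = s(u, v) := by
  induction e using Sym2.ind with
  | _ u v =>
    have h : S.H.Adj u v := he
    rcases lt_or_gt_of_ne h.ne with hlt | hlt
    · exact ⟨u, v, hlt, h, rfl⟩
    · exact ⟨v, u, hlt, h.symm, Sym2.eq_swap⟩

/-- The chosen pieces are disjoint. -/
theorem Chosen.eq_of_mem (hS : S.Decomposes G Y) (hI : G.IsIndepSet (I : Set (Fin n)))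
    {q q' : Piece n} {x : Fin n} (hq : S.Chosen I q) (hq' : S.Chosen I q') (hx : x ∈ q.set)
    (hx' : x ∈ q'.set) (hY : x ∈ Y) : q = q' := by
  obtain ⟨p, ⟨hp, hxp⟩, -⟩ := hS.partition x hY
  cases p with
  | vertex u => exact (hq.chosenAt hS hx hxp).unique hS hI (hq'.chosenAt hS hx' hxp)
  | edge e =>
    obtain ⟨u, v, huv, hadj, rfl⟩ := exists_lt_of_edge hp
    exact (hq.chosenOn hS huv hadj hx hxp).unique (hq'.chosenOn hS huv hadj hx' hxp)
  | triangle T => exact Chosen.eq_of_mem_triangle hS hI hp hq hq' hx hx' hxp hxp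

/-- Each label of a chosen item is a vertex at which, or an edge on which, the item is chosen;
uniqueness there then settles every clash. -/
theorem Chosen.item_cases {q : Piece n} (hq : S.Chosen I q) (hi : q.item = true) {l : ℕ × ℕ}
    (hl : q.lab.1 = l ∨ q.lab.2 = l) :
    (∃ u : Fin S.m, l = (u.val, u.val) ∧ S.ChosenAt I u q) ∨
      ∃ u v : Fin S.m, u < v ∧ l = (u.val, v.val) ∧ S.ChosenOn I u v q := by
  rcases hq with ⟨a, b, hab, h1, h2⟩ | ⟨a, b, h1, h2⟩ | ⟨a, h⟩ | ⟨a, b, hab, h, h1, h2⟩ | ⟨T, hT, _⟩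
  · left
    rcases hl with rfl | rfl
    · exact ⟨a, rfl, (chosenAt_full hab h1 h2).1⟩
    · exact ⟨b, rfl, (chosenAt_full hab h1 h2).2⟩
  · rcases hl with rfl | rfl
    · exact .inl ⟨a, rfl, .inr (.inl ⟨b, h1, h2, rfl⟩)⟩
    · right
      rcases lt_or_gt_of_ne h1.1.ne with hlt | hlt
      · exact ⟨a, b, hlt, by simp [onePiece, hlt.le], .inr (.inl ⟨h1, h2, rfl⟩)⟩
      · exact ⟨b, a, hlt, by simp [onePiece, hlt.le], .inr (.inr (.inl ⟨h2, h1, rfl⟩))⟩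
  all_goals exact absurd hi (by simp [vertexPiece, botPiece, trianglePiece])

/-- Chosen items have no label in common. -/
theorem Chosen.eq_of_clash (hS : S.Decomposes G Y) (hI : G.IsIndepSet (I : Set (Fin n)))
    {q q' : Piece n} (hq : S.Chosen I q) (hq' : S.Chosen I q') (hi : q.item = true)
    (hi' : q'.item = true) (hc : Clash Piece.lab q q') : q = q' := by
  obtain ⟨l, hl, hl'⟩ : ∃ l, (q.lab.1 = l ∨ q.lab.2 = l) ∧ (q'.lab.1 = l ∨ q'.lab.2 = l) := by
    rcases hc with (h | h) | (h | h)
    exacts [⟨_, .inl rfl, .inl h.symm⟩, ⟨_, .inl rfl, .inr h.symm⟩, ⟨_, .inr rfl, .inl h.symm⟩,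
      ⟨_, .inr rfl, .inr h.symm⟩]
  rcases hq.item_cases hi hl with ⟨u, rfl, h⟩ | ⟨u, v, huv, rfl, h⟩ <;>
  rcases hq'.item_cases hi' hl' with ⟨u', he, h'⟩ | ⟨u', v', huv', he, h'⟩ <;>
  simp only [Prod.mk.injEq, and_self, ← Fin.ext_iff] at he
  · subst he
    exact h.unique hS hI h'
  · omega
  · omega
  · obtain ⟨rfl, rfl⟩ := he
    exact h.unique h'

/-- The chosen pieces cover `I`. -/
theorem exists_chosen (hS : S.Decomposes G Y) {x : Fin n} (hx : x ∈ I) (hY : x ∈ Y) :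
    ∃ q, S.Chosen I q ∧ x ∈ q.set := by
  obtain ⟨p, ⟨hp, hxp⟩, -⟩ := hS.partition x hY
  -- Full pieces are chosen for `u < v` only, so the unordered case is reduced to this one.
  have full : ∀ u v, S.Hits I u v → S.Hits I v u → (x ∈ S.η (.vertex u) ∨ x ∈ S.η (.edge s(u, v)) ∨
      ∃ T, S.H.IsNClique 3 T ∧ u ∈ T ∧ v ∈ T ∧ x ∈ S.η (.triangle T)) →
      ∃ q, S.Chosen I q ∧ x ∈ q.set := by
    intro u v h1 h2 h
    rcases lt_or_gt_of_ne h1.1.ne with hlt | hlt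
    · refine ⟨_, .full u v hlt h1 h2, mem_fullPiece.mpr ?_⟩
      tauto
    · refine ⟨_, .full v u hlt h2 h1, mem_fullPiece.mpr ?_⟩
      rw [Sym2.eq_swap (a := v)]
      rcases h with h | h | ⟨T, h1, h2, h3, h4⟩
      · exact .inr (.inl h)
      · exact .inr (.inr (.inl h))
      · exact .inr (.inr (.inr ⟨T, h1, h3, h2, h4⟩))
  cases p with
  | vertex u =>
    by_cases h : ∃ v, S.Hits I u v
    · obtain ⟨v, h⟩ := h
      by_cases h' : S.Hits I v u
      · exact full u v h h' (.inl hxp)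
      · exact ⟨_, .one u v h h', mem_onePiece.mpr (.inl hxp)⟩
    · exact ⟨_, .vertex u (not_exists.mp h), hxp⟩
  | edge e =>
    obtain ⟨u, v, huv, hadj, rfl⟩ := exists_lt_of_edge hp
    have hu : ¬ S.Hits I u v → x ∉ S.ηEnd s(u, v) u := fun h hx' => h ⟨hadj, x, hx, hx'⟩
    have hv : ¬ S.Hits I v u → x ∉ S.ηEnd s(u, v) v := fun h hx' => h ⟨hadj.symm, x, hx, by
      rwa [Sym2.eq_swap]⟩
    by_cases h1 : S.Hits I u v <;> by_cases h2 : S.Hits I v u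
    · exact full u v h1 h2 (.inr (.inl hxp))
    · exact ⟨_, .one u v h1 h2, mem_onePiece.mpr (.inr ⟨hxp, hv h2⟩)⟩
    · exact ⟨_, .one v u h2 h1, mem_onePiece.mpr (.inr (by
        rw [Sym2.eq_swap]; exact ⟨hxp, hu h1⟩))⟩
    · exact ⟨_, .bot u v huv hadj h1 h2, mem_botPiece.mpr ⟨hxp, hu h1, hv h2⟩⟩
  | triangle T =>
    by_cases h : ∀ u ∈ T, ∀ v ∈ T, u < v → S.Hits I u v → ¬ S.Hits I v u
    · exact ⟨_, .triangle T hp h, hxp⟩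
    · push Not at h
      obtain ⟨u, hu, v, hv, -, h1, h2⟩ := h
      exact full u v h1 h2 (.inr (.inr ⟨T, hp, hu, hv, hxp⟩))

end chosen

/-! #### Combining independent sets of pieces -/

section combine

variable {G : SimpleGraph (Fin n)} {Y : Finset (Fin n)}

theorem eq_of_clash_of_label {M : Set (Piece n)}
    (hM : ∀ p ∈ M, ∀ q ∈ M, Clash Piece.lab p q → p = q) {p q : Piece n} (hp : p ∈ M) (hq : q ∈ M)
    (l : ℕ × ℕ) (hl : p.lab.1 = l ∨ p.lab.2 = l) (hl' : q.lab.1 = l ∨ q.lab.2 = l) : p = q :=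
  hM p hp q hq (by unfold Clash; grind)

theorem item_cases {q : Piece n} (hq : q ∈ S.pieces) (hi : q.item = true) :
    ∃ u v, S.H.Adj u v ∧ (q = S.onePiece u v ∨ q = S.fullPiece u v) := by
  rcases mem_pieces.mp hq with ⟨u, rfl⟩ | ⟨u, v, h, rfl | h'⟩ | ⟨T, -, rfl⟩
  · simp [vertexPiece] at hi
  · simp [botPiece] at hi
  · exact ⟨u, v, h, h'⟩
  · simp [trianglePiece] at hi

variable (S) in
/-- The items that involve the edge `uv`, at `u`. -/
def AtEnd (u v : Fin S.m) (q : Piece n) : Prop :=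
  q = S.onePiece u v ∨ q = S.fullPiece u v ∨ q = S.fullPiece v u

theorem AtEnd.label {u v : Fin S.m} {q : Piece n} (h : S.AtEnd u v q) :
    q.lab.1 = (u.val, u.val) ∨ q.lab.2 = (u.val, u.val) := by
  rcases h with rfl | rfl | rfl
  · exact .inl rfl
  · exact .inl rfl
  · exact .inr rfl

theorem AtEnd.vertex_mem {u v : Fin S.m} {q : Piece n} (h : S.AtEnd u v q) {x : Fin n}
    (hx : x ∈ S.η (.vertex u)) : x ∈ q.set := by
  rcases h with rfl | rfl | rfl
  · exact mem_onePiece.mpr (.inl hx)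
  · exact mem_fullPiece.mpr (.inl hx)
  · exact mem_fullPiece.mpr (.inr (.inl hx))

theorem atEnd_of_mem_vertex (hS : S.Decomposes G Y) {q : Piece n} (hq : q ∈ S.pieces)
    (hi : q.item = true) {x : Fin n} (hx : x ∈ q.set) {u : Fin S.m} (hu : x ∈ S.η (.vertex u)) :
    ∃ v, S.H.Adj u v ∧ S.AtEnd u v q := by
  obtain ⟨a, b, hab, rfl | rfl⟩ := item_cases hq hi
  · rcases mem_onePiece.mp hx with h | h
    · rw [← hS.vertex_eq hu h]
      exact ⟨b, hab, .inl rfl⟩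
    · exact absurd h.1 (hS.vertex_edge hu hab)
  · rcases mem_fullPiece.mp hx with h | h | h | ⟨T, hT, -, -, h⟩
    · rw [← hS.vertex_eq hu h]
      exact ⟨b, hab, .inr (.inl rfl)⟩
    · rw [← hS.vertex_eq hu h]
      exact ⟨a, hab.symm, .inr (.inr rfl)⟩
    · exact absurd h (hS.vertex_edge hu hab)
    · exact absurd h (hS.vertex_triangle hu hT)

theorem edge_item_cases (hS : S.Decomposes G Y) {q : Piece n} (hq : q ∈ S.pieces)
    (hi : q.item = true) {x : Fin n} (hx : x ∈ q.set) {u v : Fin S.m} (hadj : S.H.Adj u v)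
    (hu : x ∈ S.η (.edge s(u, v))) : S.AtEnd u v q ∨ S.AtEnd v u q := by
  obtain ⟨a, b, hab, rfl | rfl⟩ := item_cases hq hi
  · rcases mem_onePiece.mp hx with h | h
    · exact absurd hu (hS.vertex_edge h hadj)
    · rcases hS.edge_eq hadj hu hab h.1 with ⟨rfl, rfl⟩ | ⟨rfl, rfl⟩
      · exact .inl (.inl rfl)
      · exact .inr (.inl rfl)
  · rcases mem_fullPiece.mp hx with h | h | h | ⟨T, hT, -, -, h⟩
    · exact absurd hu (hS.vertex_edge h hadj)
    · exact absurd hu (hS.vertex_edge h hadj)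
    · rcases hS.edge_eq hadj hu hab h with ⟨rfl, rfl⟩ | ⟨rfl, rfl⟩
      · exact .inl (.inr (.inl rfl))
      · exact .inl (.inr (.inr rfl))
    · exact absurd h (hS.edge_triangle hadj hu hT)

theorem triangle_item_cases (hS : S.Decomposes G Y) {q : Piece n} (hq : q ∈ S.pieces)
    (hi : q.item = true) {x : Fin n} (hx : x ∈ q.set) {T : Finset (Fin S.m)}
    (hT : S.H.IsNClique 3 T) (hu : x ∈ S.η (.triangle T)) :
    ∃ a ∈ T, ∃ b ∈ T, a ≠ b ∧ q = S.fullPiece a b := by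
  obtain ⟨a, b, hab, rfl | rfl⟩ := item_cases hq hi
  · rcases mem_onePiece.mp hx with h | h
    · exact absurd hu (hS.vertex_triangle h hT)
    · exact absurd hu (hS.edge_triangle hab h.1 hT)
  · rcases mem_fullPiece.mp hx with h | h | h | ⟨T', hT', ha, hb, h⟩
    · exact absurd hu (hS.vertex_triangle h hT)
    · exact absurd hu (hS.vertex_triangle h hT)
    · exact absurd hu (hS.edge_triangle hab h hT)
    · obtain rfl := hS.triangle_eq hT hu hT' h
      exact ⟨a, ha, b, hb, hab.ne, rfl⟩

theorem onePiece_clash (u v : Fin S.m) :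
    Clash Piece.lab (S.onePiece u v) (S.onePiece v u) :=
  .inr (.inr (by simp [onePiece, min_comm, max_comm]))

/-- Two items that involve the same edge clash. -/
theorem AtEnd.clash {u v : Fin S.m} {q q' : Piece n} (h : S.AtEnd u v q ∨ S.AtEnd v u q)
    (h' : S.AtEnd u v q' ∨ S.AtEnd v u q') : Clash Piece.lab q q' := by
  unfold AtEnd at h h'
  have := onePiece_clash u v
  have := onePiece_clash v u
  rcases h with (rfl | rfl | rfl) | (rfl | rfl | rfl) <;>
  rcases h' with (rfl | rfl | rfl) | (rfl | rfl | rfl) <;>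
  first
  | assumption
  | exact .inl (.inl rfl)
  | exact .inl (.inr rfl)
  | exact .inr (.inl rfl)

/-- Items without clashes are disjoint. -/
theorem item_eq_of_mem (hS : S.Decomposes G Y) {p q : Piece n} (hp : p ∈ S.pieces)
    (hq : q ∈ S.pieces) (hpi : p.item = true) (hqi : q.item = true)
    {x : Fin n} (hx : x ∈ p.set) (hx' : x ∈ q.set) (hY : x ∈ Y) : Clash Piece.lab p q := by
  obtain ⟨r, ⟨hr, hxr⟩, -⟩ := hS.partition x hY
  have label : ∀ l, (p.lab.1 = l ∨ p.lab.2 = l) → (q.lab.1 = l ∨ q.lab.2 = l) →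
      Clash Piece.lab p q := fun l h h' => by unfold Clash; grind
  cases r with
  | vertex u =>
    obtain ⟨v, -, h⟩ := atEnd_of_mem_vertex hS hp hpi hx hxr
    obtain ⟨v', -, h'⟩ := atEnd_of_mem_vertex hS hq hqi hx' hxr
    exact label _ h.label h'.label
  | edge e =>
    obtain ⟨u, v, huv, hadj, rfl⟩ := exists_lt_of_edge hr
    exact AtEnd.clash (edge_item_cases hS hp hpi hx hadj hxr)
      (edge_item_cases hS hq hqi hx' hadj hxr)
  | triangle T =>
    obtain ⟨a, ha, b, hb, hab, rfl⟩ := triangle_item_cases hS hp hpi hx hr hxr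
    obtain ⟨c, hc, d, hd, hcd, rfl⟩ := triangle_item_cases hS hq hqi hx' hr hxr
    rcases pairs_meet hr ha hb hc hd hab hcd with rfl | rfl | rfl | rfl
    · exact .inl (.inl rfl)
    · exact .inl (.inr rfl)
    · exact .inr (.inl rfl)
    · exact .inr (.inr rfl)

/-- Solutions of disjoint items and of the basic parts outside of them fit together. -/
theorem combine_isIndepSet (hS : S.Decomposes G Y) {M : Set (Piece n)}
    (hMp : ∀ q ∈ M, q ∈ S.pieces ∧ q.item = true)
    (hM : ∀ p ∈ M, ∀ q ∈ M, Clash Piece.lab p q → p = q) {F : Finset (Fin n) → Finset (Fin n)}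
    (hF : ∀ B, F B ⊆ B) (hFG : ∀ B, G.IsIndepSet (F B : Set (Fin n))) {Z : Set (Fin n)}
    (hZ : ∀ x ∈ Z, (∃ q ∈ M, x ∈ F q.set) ∨
      (∀ q ∈ M, x ∉ q.set) ∧ ∃ q ∈ S.pieces, q.item = false ∧ x ∈ F q.set)
    (hZY : ∀ x ∈ Z, x ∈ Y) :
    G.IsIndepSet Z := by
  -- Distinct items of `M` are disjoint, and basic solutions are kept only outside all items of `M`.
  have hin : ∀ q ∈ M, ∀ x ∈ Z, x ∈ q.set → x ∈ F q.set := by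
    intro q hq x hx hxq
    rcases hZ x hx with ⟨q', hq', h⟩ | ⟨h, -⟩
    · rwa [hM q hq q' hq' (item_eq_of_mem hS (hMp q hq).1 (hMp q' hq').1 (hMp q hq).2
        (hMp q' hq').2 hxq (hF _ h) (hZY x hx))]
    · exact absurd hxq (h q hq)
  have hsame : ∀ q ∈ M, ∀ x ∈ Z, ∀ y ∈ Z, x ∈ q.set → y ∈ q.set → ¬ G.Adj x y := by
    intro q hq x hx y hy hxq hyq hadj
    exact hFG q.set (hin q hq x hx hxq) (hin q hq y hy hyq) hadj.ne hadj
  -- No basic piece contains a vertex of `η(uv, u)`, so such a vertex of `Z` comes from an item of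
  -- `M`. The item is not `onePiece v u`, which omits this end.
  have hend : ∀ y ∈ Z, ∀ u v, S.H.Adj u v → y ∈ S.ηEnd s(u, v) u →
      ∃ q ∈ M, y ∈ q.set ∧ S.AtEnd u v q := by
    intro y hy u v huv hyu
    have hye := hS.end_mem huv hyu
    rcases hZ y hy with ⟨q, hq, h⟩ | ⟨-, q, hq, hqi, h⟩
    · have hyq := hF _ h
      refine ⟨q, hq, hyq, ?_⟩
      rcases edge_item_cases hS (hMp q hq).1 (hMp q hq).2 hyq huv hye with h | rfl | rfl | rfl
      · exact h
      · rcases mem_onePiece.mp hyq with h' | h'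
        · exact absurd hye (hS.vertex_edge h' huv)
        · rw [Sym2.eq_swap] at h'
          exact absurd hyu h'.2
      · exact .inr (.inr rfl)
      · exact .inr (.inl rfl)
    · have hyq := hF _ h
      rcases mem_pieces.mp hq with ⟨a, rfl⟩ | ⟨a, b, hab, rfl | rfl | rfl⟩ | ⟨T, hT, rfl⟩
      · exact absurd hye (hS.vertex_edge hyq huv)
      · obtain ⟨h1, h2, h3⟩ := mem_botPiece.mp hyq
        rcases hS.edge_eq huv hye hab h1 with ⟨rfl, rfl⟩ | ⟨rfl, rfl⟩
        · exact absurd hyu h2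
        · rw [Sym2.eq_swap] at h3
          exact absurd hyu h3
      · simp [onePiece] at hqi
      · simp [fullPiece] at hqi
      · exact absurd hyq (hS.edge_triangle huv hye hT)
  -- An edge between different parts has an end in some `η(e, v)`, hence in an item of `M`. In each
  -- case that item also contains the other end, and its solution is independent.
  have hcross : ∀ x ∈ Z, ∀ y ∈ Z, G.Adj x y → ¬ S.Crossing x y := by
    intro x hx y hy hadj hc
    rcases hc with ⟨v, u, u', h1, h2, -, hxe, hye⟩ | ⟨v, u, h1, hxv, hye⟩ |
      ⟨T, u, v, hT, hu, hv, huv, hxT, hyu, hyv⟩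
    · obtain ⟨q, hq, hxq, hqu⟩ := hend x hx v u h1 hxe
      obtain ⟨q', hq', hyq, hqu'⟩ := hend y hy v u' h2 hye
      obtain rfl := eq_of_clash_of_label hM hq hq' _ hqu.label hqu'.label
      exact hsame q hq x hx y hy hxq hyq hadj
    · obtain ⟨q, hq, hyq, hqu⟩ := hend y hy v u h1 hye
      exact hsame q hq x hx y hy (hqu.vertex_mem hxv) hyq hadj
    · have hadj' : S.H.Adj u v := hT.1 hu hv huv
      obtain ⟨q, hq, hyq, hqu⟩ := hend y hy u v hadj' hyu
      -- As `y` lies in both ends of `uv`, its item is not of the kind `onePiece`; it is full and so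
      -- contains `η(T)`.
      refine hsame q hq x hx y hy ?_ hyq hadj
      rcases hqu with rfl | rfl | rfl
      · rcases mem_onePiece.mp hyq with h | h
        · exact absurd (hS.end_mem hadj' hyu) (hS.vertex_edge h hadj')
        · exact absurd hyv h.2
      · exact mem_fullPiece.mpr (.inr (.inr (.inr ⟨T, hT, hu, hv, hxT⟩)))
      · exact mem_fullPiece.mpr (.inr (.inr (.inr ⟨T, hT, hv, hu, hxT⟩)))
  -- If `x` lies in an item, then so does every `y ∈ Z` of the same part.
  have hpart : ∀ p, S.IsPart p → ∀ x ∈ Z, ∀ y ∈ Z, x ∈ S.η p → y ∈ S.η p → G.Adj x y →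
      ∀ q ∈ M, x ∈ q.set → False := by
    intro p hp x hx y hy hxp hyp hadj q hq hxq
    refine hsame q hq x hx y hy hxq ?_ hadj
    obtain ⟨hqp, hqi⟩ := hMp q hq
    cases p with
    | vertex u =>
      obtain ⟨v, -, h⟩ := atEnd_of_mem_vertex hS hqp hqi hxq hxp
      exact h.vertex_mem hyp
    | edge e =>
      obtain ⟨u, v, -, huv, rfl⟩ := exists_lt_of_edge hp
      -- `onePiece u v` omits `η(uv, v)`. A vertex of `Z` there would come from an item of `M` on
      -- the same edge, at `v`; that item clashes with `q` and so equals `q`.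
      have one : ∀ u v, S.H.Adj u v → y ∈ S.η (.edge s(u, v)) → q = S.onePiece u v →
          y ∈ q.set := by
        rintro u v huv hyp rfl
        by_cases hyv : y ∈ S.ηEnd s(u, v) v
        · obtain ⟨q', hq', hyq', h'⟩ := hend y hy v u huv.symm (by rwa [Sym2.eq_swap])
          rwa [hM _ hq _ hq' (AtEnd.clash (.inl (.inl rfl)) (.inr h'))]
        · exact mem_onePiece.mpr (.inr ⟨hyp, hyv⟩)
      have hyp' : y ∈ S.η (.edge s(v, u)) := by rwa [Sym2.eq_swap]
      rcases edge_item_cases hS hqp hqi hxq huv hxp with (h | rfl | rfl) | (h | rfl | rfl)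
      · exact one u v huv hyp h
      · exact mem_fullPiece.mpr (.inr (.inr (.inl hyp)))
      · exact mem_fullPiece.mpr (.inr (.inr (.inl hyp')))
      · exact one v u huv.symm hyp' h
      · exact mem_fullPiece.mpr (.inr (.inr (.inl hyp')))
      · exact mem_fullPiece.mpr (.inr (.inr (.inl hyp)))
    | triangle T =>
      obtain ⟨a, ha, b, hb, -, rfl⟩ := triangle_item_cases hS hqp hqi hxq hp hxp
      exact mem_fullPiece.mpr (.inr (.inr (.inr ⟨T, hp, ha, hb, hyp⟩)))
  -- Each part has only one basic set, although the piece of an edge is listed for both orders of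
  -- its ends.
  have hbase : ∀ q ∈ S.pieces, q.item = false → ∀ q' ∈ S.pieces, q'.item = false →
      ∀ p, S.IsPart p → ∀ x y, x ∈ q.set → y ∈ q'.set → x ∈ S.η p → y ∈ S.η p →
      q.set = q'.set := by
    have key : ∀ q ∈ S.pieces, q.item = false → ∀ x ∈ q.set, ∀ p, S.IsPart p → x ∈ S.η p →
        (∃ u, p = .vertex u ∧ q.set = S.η p) ∨ (∃ u v, S.H.Adj u v ∧ p = .edge s(u, v) ∧
        q = S.botPiece u v) ∨ ∃ T, p = .triangle T ∧ q.set = S.η p := by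
      intro q hq hqi x hxq p hp hxp
      rcases mem_pieces.mp hq with ⟨a, rfl⟩ | ⟨a, b, hab, rfl | rfl | rfl⟩ | ⟨T, hT, rfl⟩
      · obtain rfl := hS.part_unique (p := .vertex a) (p' := p) trivial hp hxq hxp
        exact .inl ⟨a, rfl, rfl⟩
      · obtain rfl := hS.part_unique (p := .edge s(a, b)) (p' := p) hab hp
          (mem_botPiece.mp hxq).1 hxp
        exact .inr (.inl ⟨a, b, hab, rfl, rfl⟩)
      · simp [onePiece] at hqi
      · simp [fullPiece] at hqi
      · obtain rfl := hS.part_unique (p := .triangle T) (p' := p) hT hp hxq hxp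
        exact .inr (.inr ⟨T, rfl, rfl⟩)
    intro q hq hqi q' hq' hqi' p hp x y hxq hyq hxp hyp
    rcases key q hq hqi x hxq p hp hxp with ⟨u, rfl, h⟩ | ⟨u, v, huv, rfl, rfl⟩ | ⟨T, rfl, h⟩ <;>
    rcases key q' hq' hqi' y hyq _ hp hyp with ⟨u', e, h'⟩ | ⟨u', v', huv', e, rfl⟩ | ⟨T', e, h'⟩
    all_goals try (simp at e; done)
    · rw [h, h']
    · simp only [StripPart.edge.injEq, Sym2.eq_iff] at e
      rcases e with ⟨rfl, rfl⟩ | ⟨rfl, rfl⟩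
      · rfl
      · simp only [botPiece]
        rw [Sym2.eq_swap, Finset.union_comm]
    · rw [h, h']
  intro x hx y hy _ hadj
  rcases hS.edges x (hZY x hx) y (hZY y hy) hadj with ⟨p, hp, hxp, hyp⟩ | h | h
  · rcases hZ x hx with ⟨q, hq, h⟩ | ⟨-, q, hq, hqi, hxq⟩
    · exact hpart p hp x hx y hy hxp hyp hadj q hq (hF _ h)
    rcases hZ y hy with ⟨q, hq, h⟩ | ⟨-, q', hq', hqi', hyq⟩
    · exact hpart p hp y hy x hx hyp hxp hadj.symm q hq (hF _ h)
    rw [← hbase q hq hqi q' hq' hqi' p hp x y (hF _ hxq) (hF _ hyq) hxp hyp] at hyq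
    exact hFG _ hxq hyq hadj.ne hadj
  · exact hcross x hx y hy hadj h
  · exact hcross y hy x hx hadj.symm h

end combine

end StripData

/-! ### Combining solutions of pieces -/

section combine

variable {n : ℕ} (w : Fin n → ℕ)

/-- The union of the solutions of the basic pieces. -/
noncomputable def baseUnion (ps : List (Piece n × Finset (Fin n))) : Finset (Fin n) :=
  ps.foldl (fun Z q => if q.1.item = true then Z else Z ∪ q.2) ∅

/-- The gain of replacing the basic solutions inside an item by the solution of the item. -/
def gain (Z : Finset (Fin n)) (q : Piece n × Finset (Fin n)) : ℕ :=
  weight w q.2 - weight w (Z ∩ q.1.set)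

open Classical in
/-- The items with a positive gain. -/
noncomputable def gainItems (ps : List (Piece n × Finset (Fin n))) :
    List (Piece n × Finset (Fin n)) :=
  ps.filter fun q => q.1.item = true ∧ 0 < gain w (baseUnion ps) q

/-- Combine solutions of pieces, up to a factor `1 - 2 / k`. -/
noncomputable def combine (k : ℕ) (ps : List (Piece n × Finset (Fin n))) : Finset (Fin n) :=
  (localSearch (fun q => q.1.lab) (gain w (baseUnion ps)) (gainItems w ps) (2 * k)
    ((gainItems w ps).length * k)).foldl (fun Z q => (Z \ q.1.set) ∪ q.2) (baseUnion ps)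

variable {w}

theorem mem_baseUnion {ps : List (Piece n × Finset (Fin n))} {x : Fin n} :
    x ∈ baseUnion ps ↔ ∃ q ∈ ps, q.1.item = false ∧ x ∈ q.2 := by
  suffices H : ∀ Z : Finset (Fin n), x ∈ ps.foldl (fun Z q => if q.1.item = true then Z
      else Z ∪ q.2) Z ↔ x ∈ Z ∨ ∃ q ∈ ps, q.1.item = false ∧ x ∈ q.2 by
    simpa [baseUnion] using H ∅
  induction ps with
  | nil => simp
  | cons q ps ih =>
    intro Z
    rw [List.foldl_cons, ih]
    cases h : q.1.item <;> simp [h, or_assoc]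

theorem mem_gainItems {ps : List (Piece n × Finset (Fin n))} {q : Piece n × Finset (Fin n)} :
    q ∈ gainItems w ps ↔ q ∈ ps ∧ q.1.item = true ∧ 0 < gain w (baseUnion ps) q := by
  simp [gainItems]

theorem weight_mono {A B : Finset (Fin n)} (h : A ⊆ B) : weight w A ≤ weight w B :=
  Finset.sum_le_sum_of_subset h

theorem weight_union {A B : Finset (Fin n)} (h : Disjoint A B) :
    weight w (A ∪ B) = weight w A + weight w B :=
  Finset.sum_union h

theorem weight_sdiff_add_inter (A B : Finset (Fin n)) :
    weight w (A \ B) + weight w (A ∩ B) = weight w A := by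
  rw [← weight_union (Finset.disjoint_sdiff_inter A B), Finset.sdiff_union_inter]

/-- The effect of replacing disjoint parts of `Z`. -/
theorem foldl_replace (M : List (Piece n × Finset (Fin n)))
    (hM : M.Pairwise fun p q => Disjoint p.1.set q.1.set) (hsub : ∀ q ∈ M, q.2 ⊆ q.1.set)
    (Z : Finset (Fin n)) (hg : ∀ q ∈ M, 0 < gain w Z q) :
    (∀ x, x ∈ M.foldl (fun Z q => (Z \ q.1.set) ∪ q.2) Z ↔
      (∃ q ∈ M, x ∈ q.2) ∨ x ∈ Z ∧ ∀ q ∈ M, x ∉ q.1.set) ∧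
    weight w (M.foldl (fun Z q => (Z \ q.1.set) ∪ q.2) Z) =
      weight w Z + (M.map (gain w Z)).sum := by
  induction M generalizing Z with
  | nil => simp
  | cons q M ih =>
    rw [List.pairwise_cons] at hM
    have hq2 : q.2 ⊆ q.1.set := hsub q List.mem_cons_self
    have hdisj : ∀ p ∈ M, ∀ x, x ∈ p.1.set → x ∉ q.1.set := fun p hp x hx hx' =>
      Finset.disjoint_left.mp (hM.1 p hp) hx' hx
    -- A replacement does not touch the other items, so their gains stay the same.
    have hinter : ∀ p ∈ M, ((Z \ q.1.set) ∪ q.2) ∩ p.1.set = Z ∩ p.1.set := by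
      intro p hp
      ext x
      simp only [Finset.mem_inter, Finset.mem_union, Finset.mem_sdiff]
      constructor
      · rintro ⟨h | h, hx⟩
        · exact ⟨h.1, hx⟩
        · exact absurd (hq2 h) (hdisj p hp x hx)
      · rintro ⟨h, hx⟩
        exact ⟨.inl ⟨h, hdisj p hp x hx⟩, hx⟩
    have hgain : ∀ p ∈ M, gain w ((Z \ q.1.set) ∪ q.2) p = gain w Z p := fun p hp => by
      rw [gain, gain, hinter p hp]
    obtain ⟨h1, h2⟩ := ih hM.2 (fun p hp => hsub p (List.mem_cons_of_mem _ hp))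
      ((Z \ q.1.set) ∪ q.2) (fun p hp => by
        rw [hgain p hp]; exact hg p (List.mem_cons_of_mem _ hp))
    rw [List.foldl_cons]
    refine ⟨fun x => ?_, ?_⟩
    · rw [h1]
      simp only [Finset.mem_union, Finset.mem_sdiff, List.mem_cons, exists_eq_or_imp,
        forall_eq_or_imp]
      constructor
      · rintro (h | ⟨⟨h, h'⟩ | h, h''⟩)
        · exact .inl (.inr h)
        · exact .inr ⟨h, h', h''⟩
        · exact .inl (.inl h)
      · rintro ((h | h) | ⟨h, h', h''⟩)
        · exact .inr ⟨.inr h, fun p hp hx => hdisj p hp x hx (hq2 h)⟩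
        · exact .inl h
        · exact .inr ⟨.inl ⟨h, h'⟩, h''⟩
    · rw [h2, weight_union (Finset.disjoint_left.mpr fun x hx hx' =>
        (Finset.mem_sdiff.mp hx).2 (hq2 hx')), List.map_cons, List.sum_cons,
        List.map_congr_left hgain, ← weight_sdiff_add_inter (w := w) Z q.1.set]
      -- The gain is a truncated difference; since it is positive, nothing has been truncated.
      have := hg q List.mem_cons_self
      unfold gain at this ⊢
      omega

open StripData in
/-- Combining solutions of the pieces of an extended strip decomposition: the result is an
independent set, and up to the factor `1 - 2 / k` it is at least as good as the union of the
solutions of the pieces into which a given independent set `I` splits. -/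
theorem combine_spec {G : SimpleGraph (Fin n)} {Y : Finset (Fin n)} {S : StripData n}
    (hS : S.Decomposes G Y) {F : Finset (Fin n) → Finset (Fin n)} (hF : ∀ B, F B ⊆ B)
    (hFG : ∀ B, G.IsIndepSet (F B : Set (Fin n))) {k : ℕ} (hk : 0 < k) :
    G.IsIndepSet (combine w k (S.pieces.map fun q => (q, F q.set)) : Set (Fin n)) ∧
    (∀ x ∈ combine w k (S.pieces.map fun q => (q, F q.set)), ∃ q ∈ S.pieces, x ∈ F q.set) ∧
    ∀ I : Finset (Fin n), G.IsIndepSet (I : Set (Fin n)) → ∃ 𝒬 : Finset (Piece n),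
      (∀ q ∈ 𝒬, q ∈ S.pieces) ∧
      (∀ q ∈ 𝒬, ∀ q' ∈ 𝒬, q ≠ q' → Disjoint q.set q'.set) ∧
      (∀ x ∈ I, x ∈ Y → ∃ q ∈ 𝒬, x ∈ q.set) ∧
      (1 - 2 / (k : ℝ)) * ∑ q ∈ 𝒬, (weight w (F q.set) : ℝ) ≤
        weight w (combine w k (S.pieces.map fun q => (q, F q.set))) := by
  classical
  set ps := S.pieces.map fun q => (q, F q.set) with hps
  set Z := baseUnion ps with hZ
  set E := gainItems w ps with hE
  set M := localSearch (fun q : Piece n × Finset (Fin n) => q.1.lab) (gain w Z) E (2 * k)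
    (E.length * k) with hMdef
  have hmemps : ∀ q ∈ ps, q.1 ∈ S.pieces ∧ q.2 = F q.1.set := by
    intro q hq
    obtain ⟨p, hp, rfl⟩ := List.mem_map.mp hq
    exact ⟨hp, rfl⟩
  have hP : IsPacking (fun q : Piece n × Finset (Fin n) => q.1.lab) E M :=
    isPacking_localSearch _ _ _ _
  have hME : ∀ q ∈ M, q.1 ∈ S.pieces ∧ q.2 = F q.1.set ∧ q.1.item = true ∧ 0 < gain w Z q := by
    intro q hq
    obtain ⟨h1, h2, h3⟩ := mem_gainItems.mp (hP.1 q hq)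
    exact ⟨(hmemps q h1).1, (hmemps q h1).2, h2, h3⟩
  have hdisj : M.Pairwise fun p q => Disjoint p.1.set q.1.set := by
    refine hP.2.imp_of_mem fun {p q} hp hq hpq => Finset.disjoint_left.mpr fun x hx hx' => hpq ?_
    obtain ⟨hp1, -, hp2, -⟩ := hME p hp
    obtain ⟨hq1, -, hq2, -⟩ := hME q hq
    exact item_eq_of_mem hS hp1 hq1 hp2 hq2 hx hx' (hS.set_subset hp1 hx)
  obtain ⟨hmem, hweight⟩ := foldl_replace (w := w) M hdisj
    (fun q hq => by rw [(hME q hq).2.1]; exact hF _) Z fun q hq => (hME q hq).2.2.2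
  change ∀ x, x ∈ combine w k ps ↔ _ at hmem
  change weight w (combine w k ps) = _ at hweight
  have hbase : ∀ x, x ∈ Z ↔ ∃ q ∈ S.pieces, q.item = false ∧ x ∈ F q.set := by
    intro x
    rw [hZ, mem_baseUnion]
    constructor
    · rintro ⟨q, hq, hi, hx⟩
      rw [(hmemps q hq).2] at hx
      exact ⟨q.1, (hmemps q hq).1, hi, hx⟩
    · rintro ⟨q, hq, hi, hx⟩
      exact ⟨(q, F q.set), List.mem_map.mpr ⟨q, hq, rfl⟩, hi, hx⟩
  have hpieces : ∀ x ∈ combine w k ps, ∃ q ∈ S.pieces, x ∈ F q.set := by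
    intro x hx
    rcases (hmem x).mp hx with ⟨q, hq, h⟩ | ⟨h, -⟩
    · rw [(hME q hq).2.1] at h
      exact ⟨q.1, (hME q hq).1, h⟩
    · obtain ⟨q, hq, -, h⟩ := (hbase x).mp h
      exact ⟨q, hq, h⟩
  refine ⟨?_, hpieces, ?_⟩
  · refine combine_isIndepSet hS (M := {p | ∃ q ∈ M, q.1 = p}) ?_ ?_ hF hFG ?_ ?_
    · rintro _ ⟨q, hq, rfl⟩
      exact ⟨(hME q hq).1, (hME q hq).2.2.1⟩
    · rintro _ ⟨q, hq, rfl⟩ _ ⟨q', hq', rfl⟩ h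
      rw [hP.eq_of_clash hq hq' h]
    · intro x hx
      rcases (hmem x).mp hx with ⟨q, hq, h⟩ | ⟨h, h'⟩
      · rw [(hME q hq).2.1] at h
        exact .inl ⟨q.1, ⟨q, hq, rfl⟩, h⟩
      · refine .inr ⟨?_, (hbase x).mp h⟩
        rintro _ ⟨q, hq, rfl⟩
        exact h' q hq
    · intro x hx
      obtain ⟨q, hq, h⟩ := hpieces x hx
      exact hS.set_subset hq (hF _ h)
  · intro I hI
    set 𝒬 := S.pieces.toFinset.filter (S.Chosen I) with h𝒬
    have hQ : ∀ q ∈ 𝒬, q ∈ S.pieces ∧ S.Chosen I q := fun q hq => by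
      rw [h𝒬, Finset.mem_filter, List.mem_toFinset] at hq
      exact hq
    have hQdisj : ∀ q ∈ 𝒬, ∀ q' ∈ 𝒬, q ≠ q' → Disjoint q.set q'.set := by
      intro q hq q' hq' hne
      rw [Finset.disjoint_left]
      intro x hx hx'
      exact hne ((hQ q hq).2.eq_of_mem hS hI (hQ q' hq').2 hx hx' (hS.set_subset (hQ q hq).1 hx))
    refine ⟨𝒬, fun q hq => (hQ q hq).1, hQdisj, ?_, ?_⟩
    · intro x hx hY
      obtain ⟨q, hq, hxq⟩ := exists_chosen hS hx hY
      exact ⟨q, Finset.mem_filter.mpr ⟨List.mem_toFinset.mpr hq.mem_pieces, hq⟩, hxq⟩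
    · clear_value 𝒬
      set g : Piece n → ℕ := fun q => gain w Z (q, F q.set) with hg
      -- The competitor in the local search: the items into which `I` splits, as far as they have
      -- positive gain.
      set O := (𝒬.filter fun q => q.item = true ∧ 0 < g q).image fun q => (q, F q.set) with hO
      have hls := localSearch_ge (lab := fun q : Piece n × Finset (Fin n) => q.1.lab) (gain w Z)
        (E := E) (O := O) (k := k) ?_ ?_ hk
      · have hOsum : ∑ a ∈ O, (gain w Z a : ℝ) = ∑ q ∈ 𝒬 with q.item = true, (g q : ℝ) := by
          rw [hO, Finset.sum_image (fun a _ b _ h => congrArg Prod.fst h), ← Finset.filter_filter]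
          refine Finset.sum_filter_of_ne fun q _ h => ?_
          exact Nat.pos_of_ne_zero fun h0 => h (by simpa [hg] using h0)
        -- `D q` is what `Z` already provides inside the piece `q`. These sets are disjoint subsets
        -- of `Z`, and for an item the gain makes up the difference to the solution of the item.
        set D : Piece n → Finset (Fin n) := fun q =>
          if q.item = true then Z ∩ q.set else F q.set with hD
        have hDsub : ∀ q, D q ⊆ q.set := fun q => by
          simp only [hD]
          split_ifs
          · exact Finset.inter_subset_right
          · exact hF _
        have hDZ : ∀ q ∈ 𝒬, D q ⊆ Z := fun q hq => by
          simp only [hD]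
          split_ifs with h
          · exact Finset.inter_subset_left
          · exact fun x hx => (hbase x).mpr ⟨q, (hQ q hq).1, by simpa using h, hx⟩
        have hDsum : ∑ q ∈ 𝒬, weight w (D q) ≤ weight w Z := by
          have : ∑ q ∈ 𝒬, weight w (D q) = weight w (𝒬.biUnion D) :=
            (Finset.sum_biUnion fun q hq q' hq' hne => (hQdisj q hq q' hq' hne).mono
              (hDsub q) (hDsub q')).symm
          rw [this]
          exact weight_mono (Finset.biUnion_subset.mpr hDZ)
        have hterm : ∑ q ∈ 𝒬, weight w (F q.set) ≤
            ∑ q ∈ 𝒬, weight w (D q) + ∑ q ∈ 𝒬 with q.item = true, g q := by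
          rw [Finset.sum_filter, ← Finset.sum_add_distrib]
          refine Finset.sum_le_sum fun q _ => ?_
          simp only [hD, hg, gain]
          split_ifs <;> omega
        have hterm' : ∑ q ∈ 𝒬, (weight w (F q.set) : ℝ) ≤
            weight w Z + ∑ q ∈ 𝒬 with q.item = true, (g q : ℝ) := by
          exact_mod_cast hterm.trans (Nat.add_le_add_right hDsum _)
        rw [hOsum] at hls
        rw [hweight, Nat.cast_add]
        have hk' : (0 : ℝ) < k := by exact_mod_cast hk
        have hpos : 0 ≤ 2 / (k : ℝ) * weight w Z := by positivity
        have h0 : (0 : ℝ) ≤ ((M.map (gain w Z)).sum : ℕ) := Nat.cast_nonneg _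
        have h1 : (0 : ℝ) ≤ weight w Z := Nat.cast_nonneg _
        have h2 : (0 : ℝ) ≤ ∑ q ∈ 𝒬, (weight w (F q.set) : ℝ) := by positivity
        rcases le_or_gt (1 - 2 / (k : ℝ)) 0 with h | h
        · nlinarith
        · nlinarith
      · intro q hq
        obtain ⟨p, hp, rfl⟩ := Finset.mem_image.mp hq
        obtain ⟨hp, hi, h0⟩ := Finset.mem_filter.mp hp
        exact mem_gainItems.mpr ⟨List.mem_map.mpr ⟨p, (hQ p hp).1, rfl⟩, hi, h0⟩
      · intro q hq q' hq' h
        obtain ⟨p, hp, rfl⟩ := Finset.mem_image.mp hq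
        obtain ⟨p', hp', rfl⟩ := Finset.mem_image.mp hq'
        obtain ⟨hp, hi, -⟩ := Finset.mem_filter.mp hp
        obtain ⟨hp', hi', -⟩ := Finset.mem_filter.mp hp'
        rw [Chosen.eq_of_clash hS hI (hQ p hp).2 (hQ p' hp').2 hi hi' h]

end combine

/-! ### The recursion -/

/-! ### The potential that pays for discarded vertices -/

section loss

/-- The weight that may be lost below a set of weight `a`. -/
noncomputable def loss (γ θ a : ℝ) : ℝ := 4 * γ * (a * (Real.log (a / θ) + 1))

theorem loss_le_of_le {γ θ a W : ℝ} (hγ : 0 < γ) (hθ : 0 < θ) (ha : 0 ≤ a) (h : a ≤ W) :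
    loss γ θ a ≤ 4 * γ * (a * (Real.log (W / θ) + 1)) := by
  rcases ha.eq_or_lt with rfl | ha
  · simp [loss]
  · unfold loss
    gcongr

/-- Halving saves `log 2 > 1 / 2` in the logarithm. -/
theorem loss_le_of_le_half {γ θ a W : ℝ} (hγ : 0 < γ) (hθ : 0 < θ) (ha : 0 ≤ a)
    (h : 2 * a ≤ W) :
    loss γ θ a ≤ 4 * γ * (a * (Real.log (W / θ) + 1 / 2)) := by
  rcases ha.eq_or_lt with rfl | ha
  · simp [loss]
  · have h1 : Real.log (2 * a / θ) ≤ Real.log (W / θ) := by gcongr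
    rw [mul_div_assoc, Real.log_mul (by norm_num) (by positivity)] at h1
    have := Real.log_two_gt_d9
    exact mul_le_mul_of_nonneg_left (mul_le_mul_of_nonneg_left (by linarith) ha.le) (by positivity)

/-- Splitting a set of weight `W` into parts of weight `a q` and a rest of weight `x` that is
charged to the complement of the heaviest part. -/
theorem add_sum_loss_le {Q : Type*} {𝒬 : Finset Q} {N : Q → Prop} [DecidablePred N] {a : Q → ℝ}
    {γ θ x W : ℝ} (hγ : 0 < γ) (hθ : 0 < θ) (ha : ∀ q ∈ 𝒬, 0 ≤ a q) (hx : 0 ≤ x)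
    (hW : W = x + ∑ q ∈ 𝒬, a q) (hθW : θ ≤ W) (hxW : x ≤ γ * W)
    (hxN : ∀ q ∈ 𝒬, N q → x ≤ γ * (W - a q)) :
    x + ∑ q ∈ 𝒬 with N q, loss γ θ (a q) ≤ loss γ θ W := by
  classical
  have hL : 0 ≤ Real.log (W / θ) := Real.log_nonneg (by rwa [le_div_iff₀ hθ, one_mul])
  set L := Real.log (W / θ) with hLdef
  have hWloss : loss γ θ W = 4 * γ * (W * (L + 1)) := rfl
  have hsplit := Finset.sum_filter_add_sum_filter_not 𝒬 N a
  set R := 𝒬.filter N with hR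
  have ht : 0 ≤ ∑ q ∈ 𝒬 with ¬ N q, a q :=
    Finset.sum_nonneg fun q hq => ha q (Finset.mem_filter.mp hq).1
  set t := ∑ q ∈ 𝒬 with ¬ N q, a q
  have hRa : ∀ q ∈ R, 0 ≤ a q := fun q hq => ha q (Finset.mem_filter.mp hq).1
  rw [hWloss]
  rcases R.eq_empty_or_nonempty with h | h
  · rw [h, Finset.sum_empty, add_zero]
    have hW0 : 0 ≤ γ * W := mul_nonneg hγ.le (hθ.le.trans hθW)
    nlinarith [mul_nonneg hW0 hL]
  -- Apart from the heaviest part `m`, every part in `R` has at most half of the weight.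
  · obtain ⟨m, hm, hmax⟩ := Finset.exists_max_image R a h
    have hsum1 : ∑ q ∈ R, a q = a m + ∑ q ∈ R.erase m, a q := (Finset.add_sum_erase R a hm).symm
    have hs : 0 ≤ ∑ q ∈ R.erase m, a q :=
      Finset.sum_nonneg fun q hq => hRa q (Finset.mem_of_mem_erase hq)
    have hother : ∀ q ∈ R.erase m, 2 * a q ≤ W := by
      intro q hq
      have h1 : a q ≤ ∑ q ∈ R.erase m, a q :=
        Finset.single_le_sum (fun p hp => hRa p (Finset.mem_of_mem_erase hp)) hq
      have h2 := hmax q (Finset.mem_of_mem_erase hq)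
      linarith
    have hsum2 : ∑ q ∈ R, loss γ θ (a q) ≤ 4 * γ * (a m * (L + 1)) +
        4 * γ * ((∑ q ∈ R.erase m, a q) * (L + 1 / 2)) := by
      rw [← Finset.add_sum_erase R _ hm]
      gcongr
      · exact loss_le_of_le hγ hθ (hRa m hm) (by linarith)
      · rw [Finset.sum_mul, Finset.mul_sum]
        exact Finset.sum_le_sum fun q hq => loss_le_of_le_half hγ hθ
          (hRa q (Finset.mem_of_mem_erase hq)) (hother q hq)
    have hxm := hxN m (Finset.mem_filter.mp hm).1 (Finset.mem_filter.mp hm).2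
    set s := ∑ q ∈ R.erase m, a q
    -- Here `x ≤ γ (x + s + t)`. The halved logarithms save `2 γ s`, and `x` and `t` save `4 γ (x +
    -- t) (L + 1)`, since no loss is passed on for them.
    have e : W = x + a m + s + t := by linarith
    rw [e] at hxm ⊢
    nlinarith [mul_nonneg (mul_nonneg hγ.le hx) hL, mul_nonneg (mul_nonneg hγ.le ht) hL,
      mul_nonneg hγ.le hx, mul_nonneg hγ.le hs, mul_nonneg hγ.le ht]

end loss

/-! ### The recursive algorithm and its guarantee -/

section solve

variable {n : ℕ} (w : Fin n → ℕ) (k : ℕ) (members : List (List (Piece n)))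

/-- The solution of an instance with at most one vertex. -/
def leafSolution (A : Finset (Fin n)) : Finset (Fin n) := if A.card ≤ 1 then A else ∅

/-- The best solution obtained by combining, for some member of the disperser, the solutions `F`
of the intersections of `A` with the pieces. -/
noncomputable def solveStep (F : Finset (Fin n) → Finset (Fin n)) (A : Finset (Fin n)) :
    Finset (Fin n) :=
  bestOf (weight w) (leafSolution A)
    (members.map fun ps => combine w k (ps.map fun p => (p, F (A ∩ p.set))))

/-- The recursive algorithm, with recursion depth `d`. -/
noncomputable def solve : ℕ → Finset (Fin n) → Finset (Fin n)
  | 0 => fun _ => ∅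
  | d + 1 => solveStep w k members (solve d)

variable {w k members} {G : SimpleGraph (Fin n)}

theorem solve_spec (hk : 0 < k)
    (hmem : ∀ ps ∈ members, ∃ (S : StripData n) (Y : Finset (Fin n)), S.Decomposes G Y ∧
      ps = S.pieces) (d : ℕ) (A : Finset (Fin n)) :
    solve w k members d A ⊆ A ∧ G.IsIndepSet (solve w k members d A : Set (Fin n)) := by
  induction d generalizing A with
  | zero => simp [solve]
  | succ d ih =>
    rcases List.mem_cons.mp (bestOf_mem (weight w) (leafSolution A)
      (members.map fun ps => combine w k (ps.map fun p => (p, solve w k members d (A ∩ p.set)))))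
      with h | h
    · rw [solve, solveStep, h, leafSolution]
      split_ifs with hA
      · refine ⟨subset_rfl, fun x hx y hy hne => ?_⟩
        exact absurd (Finset.card_le_one.mp hA x hx y hy) hne
      · simp
    · rw [solve, solveStep]
      obtain ⟨ps, hps, e⟩ := List.mem_map.mp h
      obtain ⟨S, Y, hS, rfl⟩ := hmem ps hps
      rw [← e]
      obtain ⟨h1, h2, -⟩ := combine_spec (w := w) hS (F := fun B => solve w k members d (A ∩ B))
        (fun B => (ih (A ∩ B)).1.trans Finset.inter_subset_right) (fun B => (ih (A ∩ B)).2) hk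
      refine ⟨fun x hx => ?_, h1⟩
      obtain ⟨q, -, hxq⟩ := h2 x hx
      exact Finset.mem_of_mem_inter_left ((ih (A ∩ q.set)).1 hxq)

theorem weight_restrictWeight (I A : Finset (Fin n)) :
    weight (restrictWeight w I) A = weight w (I ∩ A) := by
  unfold weight restrictWeight
  rw [Finset.sum_ite_mem, Finset.inter_comm]

theorem weight_le_of_mem {A : Finset (Fin n)} {v : Fin n} (hv : v ∈ A) : w v ≤ weight w A :=
  Finset.single_le_sum (f := w) (fun _ _ => Nat.zero_le _) hv

/-- The recursion of depth `d + 1` is good for independent sets whose weight drops below the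
smallest weight `θ` of a vertex when it is multiplied `d` times by `1 - δ`. -/
theorem solve_ge {γ δ : ℝ} {D : List (Finset (Fin n) × StripData n)}
    (hD : IsDisperser G w γ δ D) (hγ : 0 < γ) (hδ : δ ≤ 1) (hk : 2 ≤ k) {θ : ℝ} (hθ : 0 < θ)
    (d : ℕ) {A I : Finset (Fin n)} (hIA : I ⊆ A) (hI : G.IsIndepSet (I : Set (Fin n)))
    (hIθ : ∀ v ∈ I, θ ≤ w v) (hd : weight w I * (1 - δ) ^ d < θ) :
    (1 - 2 / (k : ℝ)) ^ d * (weight w I - loss γ θ (weight w I)) ≤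
      weight w (solve w k (D.map fun m => m.2.pieces) (d + 1) A) := by
  classical
  have hk0 : (2 : ℝ) ≤ k := by exact_mod_cast hk
  have hρ0 : 0 ≤ 1 - 2 / (k : ℝ) := by
    rw [sub_nonneg, div_le_one (by linarith)]
    exact hk0
  have hρ1 : 1 - 2 / (k : ℝ) ≤ 1 := by
    have : 0 ≤ 2 / (k : ℝ) := by positivity
    linarith
  have zero : weight w I = 0 → (1 - 2 / (k : ℝ)) ^ d * (weight w I - loss γ θ (weight w I)) ≤
      weight w (solve w k (D.map fun m => m.2.pieces) (d + 1) A) := by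
    intro h
    rw [h]
    simp [loss]
  have hmem : ∀ ps ∈ D.map fun m => m.2.pieces, ∃ (S : StripData n) (Y : Finset (Fin n)),
      S.Decomposes G Y ∧ ps = S.pieces := by
    intro ps hps
    obtain ⟨m, hm, rfl⟩ := List.mem_map.mp hps
    exact ⟨m.2, _, hD.1 m hm, rfl⟩
  induction d generalizing A I with
  | zero =>
    refine zero ?_
    rw [pow_zero, mul_one] at hd
    -- The weight of `I` is less than `θ`, the least possible weight of a vertex of `I`.
    have : I = ∅ := by
      refine Finset.eq_empty_of_forall_notMem fun v hv => ?_
      have h1 : (w v : ℝ) ≤ weight w I := by exact_mod_cast weight_le_of_mem hv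
      linarith [hIθ v hv]
    rw [this]
    simp [weight]
  | succ d ih =>
    rcases Nat.eq_zero_or_pos (weight w I) with h0 | hpos
    · exact zero h0
    -- The member is chosen for the current `I`, which is an independent set of the whole graph; so
    -- one disperser serves all levels.
    obtain ⟨⟨X, S⟩, hXS, hshrink, hsafe⟩ := hD.2 I hI hpos
    dsimp only at hshrink hsafe
    have hS := hD.1 _ hXS
    dsimp only at hS
    have hk1 : 0 < k := by omega
    have hspec := solve_spec (w := w) hk1 hmem (d + 1)
    obtain ⟨-, -, hcomb⟩ := combine_spec (w := w) hS
      (F := fun B => solve w k (D.map fun m => m.2.pieces) (d + 1) (A ∩ B))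
      (fun B => (hspec (A ∩ B)).1.trans Finset.inter_subset_right)
      (fun B => (hspec (A ∩ B)).2) hk1
    obtain ⟨𝒬, hpc, hdisj, hcover, hval⟩ := hcomb I hI
    set W : ℝ := ((weight w I : ℕ) : ℝ) with hWdef
    set N : Piece n → Prop := fun q => S.IsNontrivialAtom G Xᶜ q.set with hN
    set a : Piece n → ℝ := fun q => weight w (I ∩ q.set) with ha
    have hbest : (weight w (combine w k (S.pieces.map fun q =>
        (q, solve w k (D.map fun m => m.2.pieces) (d + 1) (A ∩ q.set)))) : ℝ) ≤
        weight w (solve w k (D.map fun m => m.2.pieces) (d + 1 + 1) A) := by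
      have h1 : S.pieces ∈ D.map fun m => m.2.pieces := List.mem_map.mpr ⟨_, hXS, rfl⟩
      exact Nat.cast_le.mpr (le_bestOf (weight w) (leafSolution A) _ (List.mem_cons_of_mem _
        (List.mem_map.mpr ⟨S.pieces, h1, rfl⟩)))
    have hρd0 : 0 ≤ (1 - 2 / (k : ℝ)) ^ d := pow_nonneg hρ0 d
    have hρd1 : (1 - 2 / (k : ℝ)) ^ d ≤ 1 := pow_le_one₀ hρ0 hρ1
    -- Nontrivial pieces shrink by `1 - δ` and fall under the induction hypothesis. A trivial piece
    -- is a single vertex, which `leafSolution` solves without loss.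
    have hpart : ∀ q ∈ 𝒬, (1 - 2 / (k : ℝ)) ^ d * (a q - if N q then loss γ θ (a q) else 0) ≤
        weight w (solve w k (D.map fun m => m.2.pieces) (d + 1) (A ∩ q.set)) := by
      intro q hq
      split_ifs with hNq
      · refine ih (Finset.inter_subset_inter_right hIA) ?_ ?_ ?_ ?_
        · exact hI.mono (by simp)
        · exact fun v hv => hIθ v (Finset.mem_of_mem_inter_left hv)
        · have h1 := hshrink q.set hNq
          rw [weight_restrictWeight, weight_restrictWeight, Finset.inter_univ] at h1
          calc (weight w (I ∩ q.set) : ℝ) * (1 - δ) ^ d ≤ ((1 - δ) * weight w I) * (1 - δ) ^ d := by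
                gcongr
            _ = weight w I * (1 - δ) ^ (d + 1) := by ring
            _ < θ := hd
        · intro h
          rw [h]
          simp [loss]
      · have htriv : S.IsTrivialAtom G Xᶜ q.set := by
          by_contra h
          exact hNq ⟨StripData.isAtom_of_mem_pieces (hpc q hq), h⟩
        obtain ⟨v, -, -, x, hx, -⟩ := htriv
        have h1 : weight w (I ∩ q.set) ≤
            weight w (solve w k (D.map fun m => m.2.pieces) (d + 1) (A ∩ q.set)) := by
          refine le_trans (weight_mono ?_) (le_bestOf (weight w) (leafSolution (A ∩ q.set)) _
            List.mem_cons_self)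
          rw [leafSolution, if_pos]
          · exact Finset.inter_subset_inter_right hIA
          · rw [hx]
            exact (Finset.card_le_card Finset.inter_subset_right).trans (by simp)
        have h2 : a q ≤ weight w (solve w k (D.map fun m => m.2.pieces) (d + 1) (A ∩ q.set)) := by
          simp only [ha]
          exact_mod_cast h1
        have h3 : 0 ≤ a q := Nat.cast_nonneg _
        rw [sub_zero]
        nlinarith
    have hWsum : W = weight w (I ∩ X) + ∑ q ∈ 𝒬, a q := by
      have h1 : ∑ q ∈ 𝒬, weight w (I ∩ q.set) = weight w (𝒬.biUnion fun q => I ∩ q.set) :=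
        (Finset.sum_biUnion fun q hq q' hq' hne => (hdisj q hq q' hq' hne).mono
          Finset.inter_subset_right Finset.inter_subset_right).symm
      have h2 : 𝒬.biUnion (fun q => I ∩ q.set) = I \ X := by
        ext x
        simp only [Finset.mem_biUnion, Finset.mem_inter, Finset.mem_sdiff]
        constructor
        · rintro ⟨q, hq, hxI, hxq⟩
          refine ⟨hxI, ?_⟩
          exact Finset.mem_compl.mp (hS.set_subset (hpc q hq) hxq)
        · rintro ⟨hxI, hxX⟩
          obtain ⟨q, hq, hxq⟩ := hcover x hxI (Finset.mem_compl.mpr hxX)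
          exact ⟨q, hq, hxI, hxq⟩
      have h3 := weight_sdiff_add_inter (w := w) I X
      rw [← h2, ← h1] at h3
      rw [hWdef, ← h3]
      push_cast
      ring
    have hθW : θ ≤ W := by
      obtain ⟨v, hv⟩ : I.Nonempty := by
        rw [Finset.nonempty_iff_ne_empty]
        rintro rfl
        simp [weight] at hpos
      exact (hIθ v hv).trans (Nat.cast_le.mpr (weight_le_of_mem hv))
    have hloss := add_sum_loss_le (N := N) (a := a) (x := weight w (I ∩ X)) hγ hθ
      (fun q _ => Nat.cast_nonneg _) (Nat.cast_nonneg _) hWsum hθW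
      (by
        have := hsafe.1
        rwa [weight_restrictWeight, weight_restrictWeight, Finset.inter_univ] at this)
      (fun q _ hNq => by
        have := hsafe.2 q.set hNq
        rw [weight_restrictWeight, weight_restrictWeight] at this
        refine this.trans_eq ?_
        have h3 := weight_sdiff_add_inter (w := w) I q.set
        have h4 : I ∩ q.setᶜ = I \ q.set := by
          ext x
          simp
        rw [h4, hWdef, ← h3]
        push_cast
        ring)
    have hsumF : (1 - 2 / (k : ℝ)) ^ d * (W - loss γ θ W) ≤ ∑ q ∈ 𝒬,
        (weight w (solve w k (D.map fun m => m.2.pieces) (d + 1) (A ∩ q.set)) : ℝ) := by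
      refine le_trans ?_ (Finset.sum_le_sum hpart)
      rw [← Finset.mul_sum, Finset.sum_sub_distrib, ← Finset.sum_filter]
      exact mul_le_mul_of_nonneg_left (by linarith) hρd0
    calc (1 - 2 / (k : ℝ)) ^ (d + 1) * (W - loss γ θ W)
        = (1 - 2 / (k : ℝ)) * ((1 - 2 / (k : ℝ)) ^ d * (W - loss γ θ W)) := by ring
      _ ≤ _ := (mul_le_mul_of_nonneg_left hsumF hρ0).trans (hval.trans hbest)

end solve

/-! ### The approximation guarantee -/

section scheme

variable {n : ℕ} {w : Fin n → ℕ} {G : SimpleGraph (Fin n)}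

open Classical in
/-- The vertices of positive weight whose weight is at least a fraction `1 / N` of the maximum. -/
noncomputable def heavyVertices (w : Fin n → ℕ) (N : ℕ) : Finset (Fin n) :=
  Finset.univ.filter fun v => 0 < w v ∧ ∀ u, w u ≤ N * w v

theorem exists_max_weight_indepSet (w : Fin n → ℕ) (G : SimpleGraph (Fin n)) :
    ∃ O : Finset (Fin n), G.IsIndepSet (O : Set (Fin n)) ∧
      ∀ J : Finset (Fin n), G.IsIndepSet (J : Set (Fin n)) → weight w J ≤ weight w O := by
  classical
  obtain ⟨O, hO, hmax⟩ := Finset.exists_max_image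
    (Finset.univ.filter fun J : Finset (Fin n) => G.IsIndepSet (J : Set (Fin n))) (weight w)
    ⟨∅, by simp⟩
  exact ⟨O, (Finset.mem_filter.mp hO).2, fun J hJ =>
    hmax J (Finset.mem_filter.mpr ⟨Finset.mem_univ _, hJ⟩)⟩

/-- Restricting to heavy vertices loses little. -/
theorem weight_inter_heavyVertices {O : Finset (Fin n)}
    (hO : ∀ J : Finset (Fin n), G.IsIndepSet (J : Set (Fin n)) → weight w J ≤ weight w O)
    {M : ℕ} (hM : 0 < M) :
    (1 - 1 / (M : ℝ)) * weight w O ≤ weight w (O ∩ heavyVertices w (n * M)) := by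
  have hM' : (0 : ℝ) < M := by exact_mod_cast hM
  have h1 := weight_sdiff_add_inter (w := w) O (heavyVertices w (n * M))
  have h2 : M * weight w (O \ heavyVertices w (n * M)) ≤ weight w O := by
    rcases Nat.eq_zero_or_pos n with rfl | hn
    · have : O \ heavyVertices w (0 * M) = ∅ := Finset.eq_empty_of_isEmpty _
      rw [this]
      simp [weight]
    -- A light vertex of positive weight is beaten by a factor `n M` by some vertex `u`, and `{u}`
    -- is itself an independent set.
    · have h3 : ∀ v ∈ O \ heavyVertices w (n * M), n * M * w v ≤ weight w O := by
        intro v hv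
        have hv' := (Finset.mem_sdiff.mp hv).2
        simp only [heavyVertices, Finset.mem_filter, Finset.mem_univ, true_and, not_and,
          not_forall, not_le] at hv'
        rcases Nat.eq_zero_or_pos (w v) with h0 | hpos
        · simp [h0]
        · obtain ⟨u, hu⟩ := hv' hpos
          refine hu.le.trans ?_
          simpa [weight] using hO {u} (by simp)
      have h4 : n * (M * weight w (O \ heavyVertices w (n * M))) ≤ n * weight w O := by
        calc n * (M * weight w (O \ heavyVertices w (n * M)))
            = ∑ v ∈ O \ heavyVertices w (n * M), n * M * w v := by
              rw [weight, Finset.mul_sum, Finset.mul_sum]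
              simp only [mul_assoc]
          _ ≤ (O \ heavyVertices w (n * M)).card • weight w O := Finset.sum_le_card_nsmul _ _ _ h3
          _ ≤ n * weight w O := by
              rw [smul_eq_mul]
              gcongr
              exact (Finset.card_le_univ _).trans (by simp)
      exact Nat.le_of_mul_le_mul_left h4 hn
  have h5 : (weight w (O \ heavyVertices w (n * M)) : ℝ) ≤ 1 / M * weight w O := by
    rw [one_div, inv_mul_eq_div, le_div_iff₀ hM', mul_comm]
    exact_mod_cast h2
  rw [← h1] at h5 ⊢
  push_cast at h5 ⊢
  linarith

/-- Three losses occur, each at most a fraction `ε = 1 / (4m)`: light vertices, vertices discarded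
with the sets `X`, and the imprecision of local search over `d` levels. The parameters `K`, `d` and
`k` are chosen to this end, and `(1 - ε) ^ 3 ≥ 1 - 4 ε = 1 - 1 / m`. -/
theorem solve_heavyVertices {δ : ℝ} {m L K d k : ℕ} {D : List (Finset (Fin n) × StripData n)}
    (hD : IsDisperser G w ((1 : ℝ) / K) δ D) (hδ : δ ≤ 1) (hm : 0 < m)
    (hL : Real.log n ≤ L) (hK : K = 16 * m * (2 * L + 4 * m + 1))
    (hd : (2 * L + 4 * m + 1 : ℝ) ≤ δ * d) (hk : k = 8 * m * (d + 1))
    {J : Finset (Fin n)} (hJ : G.IsIndepSet (J : Set (Fin n))) :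
    (1 - 1 / (m : ℝ)) * weight w J ≤ weight w (solve w k (D.map fun m => m.2.pieces) (d + 1)
      (heavyVertices w (n * (4 * m)))) := by
  obtain ⟨O, hO, hmax⟩ := exists_max_weight_indepSet w G
  have hm1 : (1 : ℝ) ≤ m := by exact_mod_cast hm
  have hheavy := weight_inter_heavyVertices hmax (M := 4 * m) (by omega)
  set A := heavyVertices w (n * (4 * m)) with hA
  set I := O ∩ A with hI
  set R := solve w k (D.map fun m => m.2.pieces) (d + 1) A
  suffices H : (1 - 1 / (m : ℝ)) * weight w O ≤ weight w R by
    refine le_trans ?_ H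
    refine mul_le_mul_of_nonneg_left (Nat.cast_le.mpr (hmax J hJ)) ?_
    rw [sub_nonneg, div_le_one (by linarith)]
    exact hm1
  have hO0 : (0 : ℝ) ≤ weight w O := Nat.cast_nonneg _
  set ε : ℝ := 1 / ((4 * m : ℕ) : ℝ) with hε
  have hε0 : 0 ≤ ε := by positivity
  have hεm : 1 / (m : ℝ) = 4 * ε := by
    rw [hε]
    push_cast
    field_simp
  have hε1 : ε ≤ 1 / 4 := by
    have : 1 / (m : ℝ) ≤ 1 := by
      rw [div_le_one (by linarith)]
      exact hm1
    linarith
  rcases I.eq_empty_or_nonempty with hemp | hne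
  · rw [hemp] at hheavy
    have : (weight w (∅ : Finset (Fin n)) : ℝ) = 0 := by simp [weight]
    rw [this] at hheavy
    have h0 : (weight w O : ℝ) = 0 := by nlinarith
    rw [h0, mul_zero]
    exact Nat.cast_nonneg _
  obtain ⟨v, hv, hvmin⟩ := Finset.exists_min_image I w hne
  have hvA := (Finset.mem_filter.mp (Finset.mem_of_mem_inter_right hv)).2
  set θ : ℝ := ((w v : ℕ) : ℝ) with hθdef
  have hθ : 0 < θ := Nat.cast_pos.mpr hvA.1
  set W : ℝ := ((weight w I : ℕ) : ℝ) with hW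
  have hn : 0 < n := v.pos
  have hWθ : W ≤ n * (n * (4 * m)) * θ := by
    have : weight w I ≤ n * (n * (4 * m) * w v) := by
      calc weight w I ≤ I.card • (n * (4 * m) * w v) :=
            Finset.sum_le_card_nsmul _ _ _ fun u _ => hvA.2 u
        _ ≤ n * (n * (4 * m) * w v) := by
            rw [smul_eq_mul]
            gcongr
            exact (Finset.card_le_univ _).trans (by simp)
    rw [hW, hθdef]
    calc ((weight w I : ℕ) : ℝ) ≤ ((n * (n * (4 * m) * w v) : ℕ) : ℝ) := by exact_mod_cast this
      _ = _ := by push_cast; ring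
  have hθW : θ ≤ W := Nat.cast_le.mpr (weight_le_of_mem hv)
  have hW0 : 0 < W := hθ.trans_le hθW
  have hn' : (0 : ℝ) < n := by exact_mod_cast hn
  set Λ : ℝ := 2 * L + 4 * m with hΛ
  -- Heavy vertices differ by a factor of at most `4 m n`, so `W / θ ≤ 4 m n ^ 2`; and `log (4 m) ≤
  -- 4 m`.
  have hratio : Real.log (W / θ) ≤ Λ := by
    have h1 : W / θ ≤ n * (n * (4 * m)) := by
      rw [div_le_iff₀ hθ]
      exact hWθ
    have h2 := Real.log_le_log (by positivity) h1
    rw [Real.log_mul hn'.ne' (by positivity), Real.log_mul hn'.ne' (by positivity)] at h2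
    have h3 := Real.log_le_sub_one_of_pos (x := 4 * (m : ℝ)) (by positivity)
    linarith
  have hΛ0 : 0 ≤ Λ := by positivity
  -- Since `δ d ≥ Λ + 1`, the factor is at most `exp (-Λ - 1)`, while `W / θ ≤ exp Λ`. The extra `1`
  -- makes the inequality strict.
  have hdrop : W * (1 - δ) ^ d < θ := by
    have h1 : (1 - δ) ^ d ≤ Real.exp (-(Λ + 1)) := by
      calc (1 - δ) ^ d ≤ Real.exp (-δ) ^ d := by
            refine pow_le_pow_left₀ (by linarith) ?_ d
            have := Real.add_one_le_exp (-δ)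
            linarith
        _ = Real.exp (-(δ * d)) := by rw [← Real.exp_nat_mul]; ring_nf
        _ ≤ _ := Real.exp_le_exp.mpr (by linarith)
    have h2 : W ≤ θ * Real.exp Λ := by
      have := Real.exp_le_exp.mpr hratio
      rw [Real.exp_log (by positivity), div_le_iff₀ hθ] at this
      linarith
    calc W * (1 - δ) ^ d ≤ (θ * Real.exp Λ) * Real.exp (-(Λ + 1)) := by gcongr
      _ = θ * Real.exp (-1) := by rw [mul_assoc, ← Real.exp_add]; ring_nf
      _ < θ * 1 := by
          gcongr
          rw [Real.exp_lt_one_iff]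
          norm_num
      _ = θ := mul_one θ
  have hKpos : (0 : ℝ) < K := by
    rw [hK]
    push_cast
    positivity
  have hk2 : 2 ≤ k := by
    rw [hk]
    nlinarith
  have hsolve := solve_ge hD (by positivity) hδ hk2 hθ d
    (Finset.inter_subset_right : I ⊆ A) (hO.mono (by simp))
    (fun u hu => Nat.cast_le.mpr (hvmin u hu)) hdrop
  have hloss : loss ((1 : ℝ) / K) θ W ≤ ε * W := by
    have hK' : (K : ℝ) = 16 * m * (Λ + 1) := by
      rw [hK, hΛ]
      push_cast
      ring
    calc loss ((1 : ℝ) / K) θ W ≤ 4 * (1 / K) * (W * (Λ + 1)) := by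
          unfold loss
          gcongr
      _ = ε * W := by
          rw [hK', hε]
          push_cast
          field_simp
          norm_num
  -- By Bernoulli's inequality the loss is at most `2 d / k`, which is less than `1 / (4 m)` for `k
  -- = 8 m (d + 1)`.
  have hρ : 1 - ε ≤ (1 - 2 / (k : ℝ)) ^ d := by
    have hkpos : (2 : ℝ) ≤ k := by exact_mod_cast hk2
    have h1 : 2 / (k : ℝ) ≤ 1 := by
      rw [div_le_one (by linarith)]
      exact hkpos
    have h2 := one_add_mul_le_pow (a := -(2 / (k : ℝ))) (by linarith) d
    refine le_trans ?_ (h2.trans_eq (by ring))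
    have h3 : (d : ℝ) * (2 / k) ≤ ε := by
      have h4 : (d : ℝ) * (2 / k) = (d / (d + 1)) * ε := by
        rw [hε, hk]
        push_cast
        field_simp
        ring
      rw [h4]
      refine mul_le_of_le_one_left hε0 ?_
      rw [div_le_one (by positivity)]
      linarith
    linarith
  have h1 : (1 - ε) * ((1 - ε) * W) ≤ weight w R := by
    refine le_trans ?_ hsolve
    have h5 : 0 ≤ (1 - ε) * W := mul_nonneg (by linarith) hW0.le
    calc (1 - ε) * ((1 - ε) * W) ≤ (1 - 2 / (k : ℝ)) ^ d * ((1 - ε) * W) := by gcongr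
      _ ≤ _ := mul_le_mul_of_nonneg_left (by linarith) (by linarith)
  rw [hεm]
  have h2 : (1 - ε) * ((1 - ε) * ((1 - ε) * weight w O)) ≤ weight w R := by
    refine le_trans ?_ h1
    have : 0 ≤ 1 - ε := by linarith
    gcongr
  refine le_trans ?_ h2
  have h6 : 1 - 4 * ε ≤ (1 - ε) * ((1 - ε) * (1 - ε)) := by
    have e : (1 - ε) * ((1 - ε) * (1 - ε)) = 1 - 3 * ε + ε ^ 2 * (3 - ε) := by ring
    have h7 : 0 ≤ ε ^ 2 * (3 - ε) := mul_nonneg (sq_nonneg ε) (by linarith)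
    linarith
  calc (1 - 4 * ε) * weight w O ≤ ((1 - ε) * ((1 - ε) * (1 - ε))) * weight w O := by gcongr
    _ = _ := by ring

end scheme

namespace Computes

open Val

variable {ι κ : Type*} {s : ι → ℕ} {env out : ι → Val}

/-! ### Unary numbers -/

/-- A number as a list of that length. -/
def unary (k : ℕ) : Val := ofList (List.replicate k (Val.num 0))

/-- `σ i k` is the value after `k` of `N i` rounds. -/
theorem iterate {N : ι → ℕ} {σ : ι → ℕ → Val} (hN : Computes s env fun i => unary (N i))
    (hb : QuasiPoly s N) (h0 : Computes s env fun i => σ i 0)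
    (hstep : Computes (fun j : (i : ι) × Fin (N i) => s j.1)
      (fun j => .pair (env j.1) (σ j.1 j.2)) fun j => σ j.1 (j.2 + 1)) :
    Computes s env fun i => σ i (N i) :=
  (fold (acc := σ) hN (by simpa using hb) h0 (((fst id).pair (fst (snd id))).comp
    (hstep.reindex fun j : (i : ι) × Fin (List.replicate (N i) (Val.num 0)).length =>
      ⟨j.1, j.2.cast (by simp)⟩))).congr fun i => by simp

theorem unary_length {X : ι → Type*} {e : ∀ i, X i → Val} {l : ∀ i, List (X i)}
    (hl : Computes s env fun i => ofList ((l i).map (e i)))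
    (hlen : QuasiPoly s fun i => (l i).length) :
    Computes s env fun i => unary (l i).length :=
  (map (f := fun _ _ => Val.num 0) hl hlen (num 0)).congr fun i => by simp [unary]

theorem unary_const (k : ℕ) : Computes s env fun _ => unary k := by
  induction k with
  | zero => exact nil
  | succ k ih => exact cons (num 0) ih

theorem unary_add {a b : ι → ℕ} (ha : Computes s env fun i => unary (a i)) (hb : QuasiPoly s a)
    (h : Computes s env fun i => unary (b i)) : Computes s env fun i => unary (a i + b i) :=
  (append ha (by simpa using hb) h).congr fun i => by simp [unary]

theorem unary_mul {a b : ι → ℕ} (ha : Computes s env fun i => unary (a i)) (hb : QuasiPoly s a)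
    (h : Computes s env fun i => unary (b i)) (hb' : QuasiPoly s b) :
    Computes s env fun i => unary (a i * b i) := by
  have ha' : Computes s env fun i => ofList ((List.replicate (a i) ()).map fun _ => Val.num 0) :=
    ha.congr fun i => by simp [unary]
  refine (flatMap (f := fun i _ => List.replicate (b i) (Val.num 0)) ha' (by simpa using hb)
    (by simpa using hb'.comp _) (h.weaken _ _)).congr fun i => ?_
  unfold unary
  congr 1
  generalize a i = k
  induction k with
  | zero => simp
  | succ k ih => rw [List.replicate_succ, List.flatMap_cons, ih, List.replicate_append_replicate,
      Nat.succ_mul, add_comm]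

theorem unary_pow {a : ι → ℕ} (ha : Computes s env fun i => unary (a i)) (hb : PolyBdd s a)
    (k : ℕ) : Computes s env fun i => unary (a i ^ k) := by
  induction k with
  | zero => exact (unary_const 1).congr fun i => by simp
  | succ k ih =>
    exact (unary_mul ih (.of_polyBdd (hb.pow k)) ha (.of_polyBdd hb)).congr fun i => by
      rw [pow_succ]

theorem num_of_unary {a : ι → ℕ} (ha : Computes s env fun i => unary (a i)) (hb : QuasiPoly s a) :
    Computes s env fun i => .num (a i) := by
  have ha' : Computes s env fun i => ofList ((List.replicate (a i) ()).map fun _ => Val.num 0) :=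
    ha.congr fun i => by simp [unary]
  exact (length ha' (by simpa using hb)).congr fun i => by simp

theorem unary_of_num {a : ι → ℕ} (ha : Computes s env fun i => .num (a i)) (hb : QuasiPoly s a) :
    Computes s env fun i => unary (a i) :=
  (unary_length (range ha hb) (by simpa using hb)).congr fun i => by simp

/-- The product of a number with a unary number. -/
theorem mul_unary {a b : ι → ℕ} (ha : Computes s env fun i => unary (a i)) (hb : QuasiPoly s a)
    (h : Computes s env fun i => .num (b i)) : Computes s env fun i => .num (a i * b i) := by
  have ha' : Computes s env fun i => ofList ((List.replicate (a i) ()).map fun _ => Val.num 0) :=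
    ha.congr fun i => by simp [unary]
  exact (sum (f := fun i _ => b i) ha' (by simpa using hb) (h.weaken _ _)).congr fun i => by
    simp

/-- The logarithm to base two, rounded up. -/
theorem unary_clog {a : ι → ℕ} (ha : Computes s env fun i => .num (a i))
    (hb : QuasiPoly s fun i => Nat.clog 2 (a i)) :
    Computes s env fun i => unary (Nat.clog 2 (a i)) := by
  -- The state holds `a`, the power `2 ^ k` and `k` in unary; the power is doubled until it reaches
  -- `a`.
  have key := loop (env := env)
    (σ := fun i k => .pair (.num (a i)) (.pair (.num (2 ^ k)) (unary k))) hb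
    (ha.pair ((num 1).pair (unary_const 0))) ?_ ?_
  · exact key.snd.snd
  · exact (lt (fst (snd id)) (fst id)).congr fun j => by
      rw [Nat.lt_clog_iff_pow_lt (by norm_num)]
  · refine ((fst id).pair ((add (fst (snd id)) (fst (snd id))).pair
      (cons (num 0) (snd (snd id))))).congr fun j => ?_
    rw [pow_succ, mul_two]
    rfl

/-- The quotient `b / a`, rounded up. -/
theorem unary_ceilDiv {a b : ι → ℕ} (ha : Computes s env fun i => .num (a i))
    (h : Computes s env fun i => .num (b i)) (hpos : ∀ i, 0 < a i)
    (hb : QuasiPoly s fun i => (b i + a i - 1) / a i) :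
    Computes s env fun i => unary ((b i + a i - 1) / a i) := by
  -- Division by repeated truncated subtraction; the number of rounds is the quotient rounded up.
  have key := loop (env := env)
    (σ := fun i k => .pair (.num (a i)) (.pair (.num (b i - k * a i)) (unary k))) hb
    (ha.pair ((h.congr fun i => by simp).pair (unary_const 0))) ?_ ?_
  · exact key.snd.snd
  · refine (lt (num 0) (fst (snd id))).congr fun j => ?_
    congr 1
    have := hpos j.1
    rw [Nat.lt_div_iff_mul_lt this]
    refine propext ⟨fun h => ?_, fun h => ?_⟩ <;>
    · rw [mul_comm] at *
      omega
  · refine ((fst id).pair ((sub (fst (snd id)) (fst id)).pair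
      (cons (num 0) (snd (snd id))))).congr fun j => ?_
    rw [add_mul, one_mul, Nat.sub_add_eq]
    rfl

/-! ### Local search -/

theorem bestOf {A : ι → Type*} {e : ∀ i, A i → Val} {l : ∀ i, List (A i)} {a : ∀ i, A i}
    {f : ∀ i, A i → ℕ} (ha : Computes s env fun i => e i (a i))
    (hl : Computes s env fun i => ofList ((l i).map (e i)))
    (hlen : QuasiPoly s fun i => (l i).length)
    (hf : Computes (fun j : (i : ι) × {x // x ∈ a i :: l i} => s j.1)
      (fun j => .pair (env j.1) (e j.1 j.2)) fun j => .num (f j.1 j.2)) :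
    Computes s env fun i => e i (bestOf (f i) (a i) (l i)) := by
  refine foldl_of_invariant (eA := e) (P := fun i x => x ∈ a i :: l i) hl hlen ha
    (fun i => List.mem_cons_self) (fun i x hx y hy => ?_) ?_
  · split_ifs
    · exact List.mem_cons_of_mem _ hy
    · exact hx
  · have h1 := ((fst id).pair (fst (snd id))).comp (hf.reindex fun j : (i : ι) ×
      {x // x ∈ a i :: l i} × {x // x ∈ l i} => ⟨j.1, j.2.1⟩)
      (s := fun j : (i : ι) × {x // x ∈ a i :: l i} × {x // x ∈ l i} => s j.1)
      (env := fun j => .pair (env j.1) (.pair (e j.1 j.2.1) (e j.1 j.2.2)))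
    have h2 := ((fst id).pair (snd (snd id))).comp (hf.reindex fun j : (i : ι) ×
      {x // x ∈ a i :: l i} × {x // x ∈ l i} => ⟨j.1, j.2.2, List.mem_cons_of_mem _ j.2.2.2⟩)
      (s := fun j : (i : ι) × {x // x ∈ a i :: l i} × {x // x ∈ l i} => s j.1)
      (env := fun j => .pair (env j.1) (.pair (e j.1 j.2.1) (e j.1 j.2.2)))
    exact of_flag (snd (snd id)) (fst (snd id)) (h1.lt h2) (fun j h => congrArg _ (if_pos h))
      fun j h => congrArg _ (if_neg h)

end Computes

/-! ### The algorithm as a program -/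

def encodeLabel (l : ℕ × ℕ) : Val := .pair (.num l.1) (.num l.2)

noncomputable def encodePiece {n : ℕ} (p : Piece n) : Val :=
  .pair (.flag (p.item = true))
    (.pair (.pair (encodeLabel p.lab.1) (encodeLabel p.lab.2)) (encodeSet p.set))

noncomputable def encodeSolved {n : ℕ} (q : Piece n × Finset (Fin n)) : Val :=
  .pair (encodePiece q.1) (encodeSet q.2)

noncomputable abbrev encodeSolvedList {n : ℕ} (l : List (Piece n × Finset (Fin n))) : Val :=
  .ofList (l.map encodeSolved)

namespace Computes

open Val

variable {ι κ : Type*} {s : ι → ℕ} {env out : ι → Val}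

section

variable {n : ι → ℕ} {p q : ∀ i, Piece (n i) × Finset (Fin (n i))}
  {E M : ∀ i, List (Piece (n i) × Finset (Fin (n i)))}

theorem label_eq {a b : ι → ℕ × ℕ} (ha : Computes s env fun i => encodeLabel (a i))
    (hb : Computes s env fun i => encodeLabel (b i)) :
    Computes s env fun i => flag (a i = b i) :=
  ((ha.fst.eq hb.fst).and (ha.snd.eq hb.snd)).congr fun i => by rw [Prod.ext_iff]

theorem clash (hp : Computes s env fun i => encodeSolved (p i))
    (hq : Computes s env fun i => encodeSolved (q i)) :
    Computes s env fun i => flag (Clash (fun q => q.1.lab) (p i) (q i)) := by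
  have hp1 := hp.fst.snd.fst.fst
  have hp2 := hp.fst.snd.fst.snd
  have hq1 := hq.fst.snd.fst.fst
  have hq2 := hq.fst.snd.fst.snd
  exact ((label_eq hp1 hq1).or (label_eq hp1 hq2)).or ((label_eq hp2 hq1).or (label_eq hp2 hq2))

theorem insertEvict (hq : Computes s env fun i => encodeSolved (q i))
    (hM : Computes s env fun i => encodeSolvedList (M i))
    (hlen : QuasiPoly s fun i => (M i).length) :
    Computes s env fun i => encodeSolvedList (insertEvict (fun q => q.1.lab) (q i) (M i)) :=
  (cons hq (filter (p := fun i r => ¬ Clash (fun q => q.1.lab) (q i) r) hM hlen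
    (clash (hq.weaken _ _) top).not)).congr fun i => by
      rw [encodeSolvedList, _root_.insertEvict, List.map_cons]
      congr!

/-- There are `(|E| + 1) ^ k` outcomes, quasi-polynomially many as `k` is polynomially bounded. Each
is a packing and hence no longer than `E`, which is why the invariant `hpack` is carried along. -/
theorem exchanges {k : ι → ℕ} (hE : Computes s env fun i => encodeSolvedList (E i))
    (hElen : QuasiPoly s fun i => (E i).length)
    (hM : Computes s env fun i => encodeSolvedList (M i))
    (hpack : ∀ i, IsPacking (fun q => q.1.lab) (E i) (M i))
    (hk : Computes s env fun i => unary (k i)) (hkb : PolyBdd s k) :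
    Computes s env fun i =>
      ofList ((exchanges (fun q => q.1.lab) (E i) (M i) (k i)).map encodeSolvedList) := by
  refine iterate (σ := fun i j =>
    ofList ((_root_.exchanges (fun q => q.1.lab) (E i) (M i) j).map encodeSolvedList)) hk
    (.of_polyBdd hkb) (cons hM nil) ?_
  have hE1 : QuasiPoly s fun i => (E i).length + 1 := hElen.add (.const 1)
  refine (flatMap (f := fun (j : (i : ι) × Fin (k i)) c => (c :: (E j.1).map fun q =>
    _root_.insertEvict (fun q => q.1.lab) q c).map encodeSolvedList)
    (e := fun _ => encodeSolvedList)
    (l := fun j => _root_.exchanges (fun q => q.1.lab) (E j.1) (M j.1) j.2) top ?_ ?_ ?_).congr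
    fun j => ?_
  · refine ((hE1.pow hkb).comp Sigma.fst).mono fun j => ?_
    rw [length_exchanges]
    exact Nat.pow_le_pow_right (by omega) j.2.2.le
  · refine ((hE1.comp Sigma.fst).comp Sigma.fst).mono fun j => ?_
    simp
  · refine cons top ?_
    refine (map (f := fun j q => encodeSolvedList (_root_.insertEvict (fun q => q.1.lab) q j.2.1))
      (e := fun _ => encodeSolved) (l := fun j => E j.1.1) (hE.weaken₂ _ _)
      ((hElen.comp Sigma.fst).comp Sigma.fst) ?_).congr fun j => by simp [Function.comp_def]
    refine insertEvict top (fst id).snd ?_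
    refine (((hElen.comp Sigma.fst).comp Sigma.fst).comp Sigma.fst).mono fun j => ?_
    exact ((hpack _).exchanges j.1.2.2).length_le
  · rw [_root_.exchanges, List.map_flatMap]

theorem improve {k : ι → ℕ} {g : ∀ i, Piece (n i) × Finset (Fin (n i)) → ℕ}
    (hE : Computes s env fun i => encodeSolvedList (E i))
    (hElen : QuasiPoly s fun i => (E i).length)
    (hg : Computes (fun j : (i : ι) × {q // q ∈ E i} => s j.1)
      (fun j => .pair (env j.1) (encodeSolved j.2.1)) fun j => .num (g j.1 j.2))
    (hM : Computes s env fun i => encodeSolvedList (M i))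
    (hpack : ∀ i, IsPacking (fun q => q.1.lab) (E i) (M i))
    (hk : Computes s env fun i => unary (k i)) (hkb : PolyBdd s k) :
    Computes s env fun i =>
      encodeSolvedList (improve (fun q => q.1.lab) (g i) (E i) (k i) (M i)) := by
  have hpack' : ∀ j : (i : ι) ×
      {x // x ∈ M i :: _root_.exchanges (fun q => q.1.lab) (E i) (M i) (k i)},
      IsPacking (fun q => q.1.lab) (E j.1) j.2.1 := fun j => by
    rcases List.mem_cons.mp j.2.2 with h | h
    · rw [h]; exact hpack _
    · exact (hpack _).exchanges h
  refine bestOf (e := fun _ => encodeSolvedList) hM (hE.exchanges hElen hM hpack hk hkb) ?_ ?_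
  · refine ((hElen.add (.const 1)).pow hkb).mono fun i => ?_
    rw [length_exchanges]
  · refine sum (e := fun _ => encodeSolved) top
      ((hElen.comp Sigma.fst).mono fun j => (hpack' j).length_le) ?_
    exact ((fst (fst id)).pair (snd id)).comp (hg.reindex fun j :
      (j : (i : ι) × {x // x ∈ M i :: _root_.exchanges (fun q => q.1.lab) (E i) (M i) (k i)}) ×
        {q // q ∈ j.2.1} => ⟨j.1.1, j.2.1, (hpack' j.1).1 _ j.2.2⟩)

theorem localSearch {k t : ι → ℕ} {g : ∀ i, Piece (n i) × Finset (Fin (n i)) → ℕ}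
    (hE : Computes s env fun i => encodeSolvedList (E i))
    (hElen : QuasiPoly s fun i => (E i).length)
    (hg : Computes (fun j : (i : ι) × {q // q ∈ E i} => s j.1)
      (fun j => .pair (env j.1) (encodeSolved j.2.1)) fun j => .num (g j.1 j.2))
    (hk : Computes s env fun i => unary (k i)) (hkb : PolyBdd s k)
    (ht : Computes s env fun i => unary (t i)) (htb : QuasiPoly s t) :
    Computes s env fun i =>
      encodeSolvedList (localSearch (fun q => q.1.lab) (g i) (E i) (k i) (t i)) := by
  refine iterate (σ := fun i j =>
    encodeSolvedList ((_root_.improve (fun q => q.1.lab) (g i) (E i) (k i))^[j] [])) ht htb nil ?_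
  refine (improve (hE.weaken Sigma.fst _) (hElen.comp Sigma.fst) (g := fun j => g j.1) ?_ top
    (fun j => isPacking_iterate _ _ _ _) (hk.weaken _ _) (hkb.comp _)).congr fun j => by
      rw [Function.iterate_succ_apply']
  exact ((fst (fst id)).pair (snd id)).comp (hg.reindex fun j :
    (j : (i : ι) × Fin (t i)) × {q // q ∈ E j.1} => ⟨j.1.1, j.2⟩)

end

/-! ### Programs for merging solutions and for one step of the recursion -/

section

variable {n : ι → ℕ} {w : ∀ i, Fin (n i) → ℕ}
  {ps : ∀ i, List (Piece (n i) × Finset (Fin (n i)))}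

theorem baseUnion (hn : Computes s env fun i => .num (n i)) (hb : QuasiPoly s n)
    (hps : Computes s env fun i => encodeSolvedList (ps i))
    (hlen : QuasiPoly s fun i => (ps i).length) :
    Computes s env fun i => encodeSet (baseUnion (ps i)) := by
  refine foldl (eA := fun _ => encodeSet) (e := fun _ => encodeSolved) hps hlen (empty hn hb) ?_
  refine (ite' (p := fun j : (i : ι) × Finset (Fin (n i)) × {x // x ∈ ps i} =>
      j.2.2.1.1.item = true)
    (fst (fst (snd (snd id)))) (fst (snd id)) (union (hn.weaken _ _) (hb.comp _)
      (fst (snd id)) (snd (snd (snd id))))).congr fun j => ?_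
  split_ifs <;> rfl

theorem gain {Z : ∀ i, Finset (Fin (n i))} {q : ∀ i, Piece (n i) × Finset (Fin (n i))}
    (hn : Computes s env fun i => .num (n i)) (hb : QuasiPoly s n)
    (hw : Computes s env fun i => Val.table fun v => .num (w i v))
    (hZ : Computes s env fun i => encodeSet (Z i))
    (hq : Computes s env fun i => encodeSolved (q i)) :
    Computes s env fun i => .num (gain (w i) (Z i) (q i)) :=
  sub (weight hn hb hw hq.snd) (weight hn hb hw (inter hn hb hZ hq.fst.snd.snd))

theorem gainItems (hn : Computes s env fun i => .num (n i)) (hb : QuasiPoly s n)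
    (hw : Computes s env fun i => Val.table fun v => .num (w i v))
    (hps : Computes s env fun i => encodeSolvedList (ps i))
    (hlen : QuasiPoly s fun i => (ps i).length) :
    Computes s env fun i => encodeSolvedList (gainItems (w i) (ps i)) :=
  (filter (e := fun _ => encodeSolved) (p := fun i q => q.1.item = true ∧
    0 < _root_.gain (w i) (_root_.baseUnion (ps i)) q) hps hlen
    (and (fst (fst (snd id))) (lt (num 0) (gain (hn.weaken _ _) (hb.comp _) (hw.weaken _ _)
      ((baseUnion hn hb hps hlen).weaken _ _) top)))).congr fun i => by
      rw [encodeSolvedList, _root_.gainItems]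
      congr!

theorem combine {k : ι → ℕ} (hn : Computes s env fun i => .num (n i)) (hb : QuasiPoly s n)
    (hw : Computes s env fun i => Val.table fun v => .num (w i v))
    (hk : Computes s env fun i => unary (k i)) (hkb : PolyBdd s k)
    (hps : Computes s env fun i => encodeSolvedList (ps i))
    (hlen : QuasiPoly s fun i => (ps i).length) :
    Computes s env fun i => encodeSet (combine (w i) (k i) (ps i)) := by
  have hE := gainItems hn hb hw hps hlen
  have hElen : QuasiPoly s fun i => (_root_.gainItems (w i) (ps i)).length :=
    hlen.mono fun i => List.length_filter_le _ _
  have hkq := QuasiPoly.of_polyBdd hkb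
  have hZ := baseUnion hn hb hps hlen
  refine foldl (eA := fun _ => encodeSet) (e := fun _ => encodeSolved)
    (localSearch hE hElen (gain (hn.weaken _ _) (hb.comp _) (hw.weaken _ _)
      (hZ.weaken _ _) top) (unary_mul (unary_const 2) (.const 2) hk hkq)
      ((PolyBdd.const 2).mul hkb) (unary_mul (unary_length hE hElen) hElen hk hkq)
      (hElen.mul hkq)) ?_ hZ ?_
  · exact hElen.mono fun i => (isPacking_localSearch _ _ _ _).length_le
  · exact union (hn.weaken _ _) (hb.comp _) (sdiff (hn.weaken _ _) (hb.comp _) (fst (snd id))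
      (fst (snd (snd id))).snd.snd) (snd (snd (snd id)))

theorem leafSolution {A : ∀ i, Finset (Fin (n i))}
    (hn : Computes s env fun i => .num (n i)) (hb : QuasiPoly s n)
    (hA : Computes s env fun i => encodeSet (A i)) :
    Computes s env fun i => encodeSet (leafSolution (A i)) :=
  of_flag hA (empty hn hb) (le (card hn hb hA) (num 1))
    (fun i h => by simp [_root_.leafSolution, h]) fun i h => by simp [_root_.leafSolution, h]

theorem solveStep {k : ι → ℕ} {members : ∀ i, List (List (Piece (n i)))}
    {F : ∀ i, Finset (Fin (n i)) → Finset (Fin (n i))} {A : ∀ i, Finset (Fin (n i))}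
    (hn : Computes s env fun i => .num (n i)) (hb : QuasiPoly s n)
    (hw : Computes s env fun i => Val.table fun v => .num (w i v))
    (hk : Computes s env fun i => unary (k i)) (hkb : PolyBdd s k)
    (hm : Computes s env fun i =>
      ofList ((members i).map fun ps => ofList (ps.map encodePiece)))
    (hmlen : QuasiPoly s fun i => (members i).length)
    (hplen : QuasiPoly (fun j : (i : ι) × {ps // ps ∈ members i} => s j.1) fun j => j.2.1.length)
    (hF : Computes (fun j : (i : ι) × Finset (Fin (n i)) => s j.1)
      (fun j => .pair (env j.1) (encodeSet j.2)) fun j => encodeSet (F j.1 j.2))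
    (hA : Computes s env fun i => encodeSet (A i)) :
    Computes s env fun i => encodeSet (solveStep (w i) (k i) (members i) (F i) (A i)) := by
  refine bestOf (e := fun _ => encodeSet) (leafSolution hn hb hA) ?_ (by simpa using hmlen)
    (weight (hn.weaken _ _) (hb.comp _) (hw.weaken _ _) top)
  refine (map (f := fun i ps => encodeSet (_root_.combine (w i) (k i)
    (ps.map fun p => (p, F i (A i ∩ p.set))))) (e := fun _ ps => ofList (ps.map encodePiece))
    hm hmlen ?_).congr fun i => by rw [List.map_map]; rfl
  refine combine (hn.weaken _ _) (hb.comp _) (hw.weaken _ _) (hk.weaken _ _) (hkb.comp _) ?_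
    (by simpa using hplen)
  refine (map (f := fun (j : (i : ι) × {ps // ps ∈ members i}) p =>
    encodeSolved (p, F j.1 (A j.1 ∩ p.set))) (e := fun _ => encodePiece) (l := fun j => j.2.1)
    top hplen ?_).congr fun j => (congrArg ofList (by
      rw [List.map_map]; rfl) : _ =
        encodeSolvedList (j.2.1.map fun p => (p, F j.1 (A j.1 ∩ p.set))))
  refine pair top ((pair (fst (fst id)) ?_).comp (hF.reindex fun j :
    (j : (i : ι) × {ps // ps ∈ members i}) × {p // p ∈ j.2.1} =>
      ⟨j.1.1, A j.1.1 ∩ j.2.1.set⟩))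
  exact inter (hn.weaken₂ _ _) ((hb.comp Sigma.fst).comp Sigma.fst)
    (hA.weaken₂ _ _) (snd (snd top))

end

end Computes

/-! ### The recursion, level by level -/

section levels

variable {n : ℕ} (w : Fin n → ℕ) (k : ℕ) (members : List (List (Piece n)))

/-- Look up the value of a key in a list of pairs. -/
def assocLookup (res : List (Finset (Fin n) × Finset (Fin n))) (A : Finset (Fin n)) :
    Finset (Fin n) :=
  res.foldl (fun B x => if x.1 = A then x.2 else B) ∅

/-- The last match wins, and a key that occurs repeatedly always comes with the same value. -/
theorem assocLookup_map {As : List (Finset (Fin n))} {A : Finset (Fin n)} (hA : A ∈ As)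
    (f : Finset (Fin n) → Finset (Fin n)) : assocLookup (As.map fun A => (A, f A)) A = f A := by
  suffices H : ∀ (As : List (Finset (Fin n))) (B : Finset (Fin n)), A ∈ As ∨ B = f A →
      (As.map fun A => (A, f A)).foldl (fun B x => if x.1 = A then x.2 else B) B = f A from
    H As ∅ (.inl hA)
  intro As
  induction As with
  | nil => simp
  | cons A' As ih =>
    intro B h
    rw [List.map_cons, List.foldl_cons]
    apply ih
    by_cases hA' : A' = A
    · simp [hA']
    · simp only [if_neg hA']
      simpa [Ne.symm hA'] using h

/-- The instances to which the instances `As` are reduced. -/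
def subinstances (As : List (Finset (Fin n))) : List (Finset (Fin n)) :=
  As.flatMap fun A => members.flatMap fun ps => ps.map fun p => A ∩ p.set

/-- The instances at depth `i` of the recursion for `A`. -/
def level (A : Finset (Fin n)) (i : ℕ) : List (Finset (Fin n)) := (subinstances members)^[i] [A]

/-- The instances at depths below `i`, deepest first. -/
def levels (A : Finset (Fin n)) : ℕ → List (List (Finset (Fin n)))
  | 0 => []
  | i + 1 => level members A i :: levels A i

/-- Solve the instances `As`, given the solutions of the instances to which they are reduced. -/
noncomputable def solveAll (res : List (Finset (Fin n) × Finset (Fin n)))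
    (As : List (Finset (Fin n))) : List (Finset (Fin n) × Finset (Fin n)) :=
  As.map fun A => (A, solveStep w k members (assocLookup res) A)

theorem level_succ (A : Finset (Fin n)) (i : ℕ) :
    level members A (i + 1) = subinstances members (level members A i) :=
  Function.iterate_succ_apply' _ _ _

theorem inter_mem_level {A B : Finset (Fin n)} {i : ℕ} (hB : B ∈ level members A i)
    {ps : List (Piece n)} (hps : ps ∈ members) {p : Piece n} (hp : p ∈ ps) :
    B ∩ p.set ∈ level members A (i + 1) := by
  rw [level_succ]
  exact List.mem_flatMap.mpr ⟨B, hB, List.mem_flatMap.mpr ⟨ps, hps, List.mem_map.mpr ⟨p, hp, rfl⟩⟩⟩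

theorem solveStep_congr {F F' : Finset (Fin n) → Finset (Fin n)} {A : Finset (Fin n)}
    (h : ∀ ps ∈ members, ∀ p ∈ ps, F (A ∩ p.set) = F' (A ∩ p.set)) :
    solveStep w k members F A = solveStep w k members F' A := by
  unfold solveStep
  congr 1
  refine List.map_congr_left fun ps hps => congrArg _ (List.map_congr_left fun p hp => ?_)
  rw [h ps hps p hp]

/-- Programs have loops but no recursive calls. All instances are therefore listed from the top down
and solved from the deepest level up; only the table of the level below is needed, because every
instance reached from one level occurs in the next. -/
theorem assocLookup_foldl_levels (A : Finset (Fin n)) (i j : ℕ)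
    (res : List (Finset (Fin n) × Finset (Fin n)))
    (h : ∀ B ∈ level members A i, assocLookup res B = solve w k members j B) :
    assocLookup ((levels members A i).foldl (solveAll w k members) res) A =
      solve w k members (j + i) A := by
  induction i generalizing j res with
  | zero => exact h A (List.mem_singleton_self A)
  | succ i ih =>
    rw [levels, List.foldl_cons, ← Nat.succ_add_eq_add_succ]
    refine ih (j + 1) _ fun B hB => ?_
    rw [solveAll, assocLookup_map hB, solve]
    exact solveStep_congr w k members fun ps hps p hp => h _ (inter_mem_level members hB hps hp)

theorem solve_eq_assocLookup (A : Finset (Fin n)) (d : ℕ) : solve w k members d A =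
    assocLookup ((levels members A d).foldl (solveAll w k members) []) A := by
  -- The empty table yields the default value `∅`, which is the solution at recursion depth `0`.
  rw [assocLookup_foldl_levels w k members A d 0 [] fun B _ => rfl, zero_add]

theorem length_subinstances (As : List (Finset (Fin n))) : (subinstances members As).length =
    As.length * (members.flatMap fun ps => ps).length := by
  unfold subinstances
  induction As with
  | nil => simp
  | cons A As ih =>
    rw [List.flatMap_cons, List.length_append, ih, List.length_cons, Nat.succ_mul, add_comm]
    simp [List.length_flatMap]

theorem length_level (A : Finset (Fin n)) (i : ℕ) :
    (level members A i).length = (members.flatMap fun ps => ps).length ^ i := by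
  induction i with
  | zero => rfl
  | succ i ih => rw [level_succ, length_subinstances, ih, pow_succ]

theorem length_levels (A : Finset (Fin n)) (i : ℕ) : (levels members A i).length = i := by
  induction i with
  | zero => rfl
  | succ i ih => rw [levels, List.length_cons, ih]

theorem length_level_le (A : Finset (Fin n)) {i d : ℕ} (h : i ≤ d) :
    (level members A i).length ≤ ((members.flatMap fun ps => ps).length + 1) ^ d := by
  rw [length_level]
  exact (Nat.pow_le_pow_left (by omega) _).trans (Nat.pow_le_pow_right (by omega) h)

theorem length_le_of_mem_levels {A : Finset (Fin n)} {d : ℕ} {As : List (Finset (Fin n))}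
    (h : As ∈ levels members A d) :
    As.length ≤ ((members.flatMap fun ps => ps).length + 1) ^ d := by
  suffices H : ∀ i, As ∈ levels members A i → ∃ j < i, As = level members A j by
    obtain ⟨i, hi, rfl⟩ := H d h
    exact length_level_le members A hi.le
  intro i
  induction i with
  | zero => simp [levels]
  | succ i ih =>
    intro h
    rcases List.mem_cons.mp h with h | h
    · exact ⟨i, by omega, h⟩
    · obtain ⟨j, hj, h⟩ := ih h
      exact ⟨j, by omega, h⟩

theorem length_foldl_levels (A : Finset (Fin n)) (d : ℕ) :
    ((levels members A d).foldl (solveAll w k members) []).length ≤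
      ((members.flatMap fun ps => ps).length + 1) ^ d :=
  List.foldlRecOn (motive := fun res => res.length ≤ _) (levels members A d) (solveAll w k members)
    (Nat.zero_le _) fun _ _ As h => by
      rw [solveAll, List.length_map]
      exact length_le_of_mem_levels members h

end levels

theorem QuasiPoly.length_flatMap {ι : Type*} {X Y : ι → Type*} {s : ι → ℕ}
    {l : ∀ i, List (X i)} {f : ∀ i, X i → List (Y i)} (hlen : QuasiPoly s fun i => (l i).length)
    (hf : QuasiPoly (fun j : (i : ι) × {x // x ∈ l i} => s j.1) fun j => (f j.1 j.2).length) :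
    QuasiPoly s fun i => ((l i).flatMap (f i)).length := by
  obtain ⟨c, hc⟩ := hf
  refine (hlen.mul ⟨c, fun _ => le_rfl⟩).mono fun i => ?_
  rw [List.length_flatMap, ← smul_eq_mul, ← List.length_map (f := fun a => (f i a).length)]
  refine List.sum_le_card_nsmul _ _ fun x hx => ?_
  obtain ⟨a, ha, rfl⟩ := List.mem_map.mp hx
  exact hc ⟨i, a, ha⟩

namespace Computes

open Val

variable {ι κ : Type*} {s : ι → ℕ} {env out : ι → Val}
  {n : ι → ℕ} {w : ∀ i, Fin (n i) → ℕ} {k : ι → ℕ} {members : ∀ i, List (List (Piece (n i)))}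

theorem assocLookup {res : ∀ i, List (Finset (Fin (n i)) × Finset (Fin (n i)))}
    {A : ∀ i, Finset (Fin (n i))}
    (hn : Computes s env fun i => .num (n i)) (hb : QuasiPoly s n)
    (hres : Computes s env fun i =>
      ofList ((res i).map fun x => .pair (encodeSet x.1) (encodeSet x.2)))
    (hlen : QuasiPoly s fun i => (res i).length)
    (hA : Computes s env fun i => encodeSet (A i)) :
    Computes s env fun i => encodeSet (assocLookup (res i) (A i)) :=
  foldl (eA := fun _ => encodeSet) hres hlen (empty hn hb)
    (of_flag (snd (snd (snd id))) (fst (snd id))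
      (set_eq (hn.weaken _ _) (hb.comp _) (fst (snd (snd id))) (hA.weaken _ _))
      (fun j h => by rw [if_pos h]) fun j h => by rw [if_neg h])

theorem subinstances {As : ∀ i, List (Finset (Fin (n i)))}
    (hn : Computes s env fun i => .num (n i)) (hb : QuasiPoly s n)
    (hm : Computes s env fun i =>
      ofList ((members i).map fun ps => ofList (ps.map encodePiece)))
    (hmlen : QuasiPoly s fun i => (members i).length)
    (hplen : QuasiPoly (fun j : (i : ι) × {ps // ps ∈ members i} => s j.1) fun j => j.2.1.length)
    (hA : Computes s env fun i => ofList ((As i).map encodeSet))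
    (hAlen : QuasiPoly s fun i => (As i).length) :
    Computes s env fun i => ofList ((subinstances (members i) (As i)).map encodeSet) := by
  refine (flatMap (f := fun i A => ((members i).flatMap fun ps => ps.map fun p =>
    encodeSet (A ∩ p.set))) (e := fun _ => encodeSet) hA hAlen ?_ ?_).congr fun i => by
      simp [_root_.subinstances, List.map_flatMap, Function.comp_def]
  · exact QuasiPoly.length_flatMap (hmlen.comp Sigma.fst) (by
      simpa using hplen.comp fun j : (j : (i : ι) × {A // A ∈ As i}) × {ps // ps ∈ members j.1} =>
        ⟨j.1.1, j.2⟩)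
  · refine flatMap (f := fun (j : (i : ι) × {A // A ∈ As i}) ps => ps.map fun p =>
      encodeSet (j.2.1 ∩ p.set)) (l := fun j => members j.1)
      (e := fun _ ps => ofList (ps.map encodePiece)) (hm.weaken _ _) (hmlen.comp _) ?_ ?_
    · simpa using hplen.comp fun j : (j : (i : ι) × {A // A ∈ As i}) × {ps // ps ∈ members j.1} =>
        ⟨j.1.1, j.2⟩
    · refine map (f := fun (j : (j : (i : ι) × {A // A ∈ As i}) × {ps // ps ∈ members j.1}) p =>
        encodeSet (j.1.2.1 ∩ p.set)) (e := fun _ => encodePiece)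
        (l := fun j => j.2.1) top (hplen.comp fun j : (j : (i : ι) × {A // A ∈ As i}) ×
          {ps // ps ∈ members j.1} => ⟨j.1.1, j.2⟩) ?_
      exact inter (hn.weaken₃ _ _ _) (((hb.comp _).comp _).comp _)
        (fst (fst id)).snd top.snd.snd

theorem solveAll {res : ∀ i, List (Finset (Fin (n i)) × Finset (Fin (n i)))}
    {As : ∀ i, List (Finset (Fin (n i)))}
    (hn : Computes s env fun i => .num (n i)) (hb : QuasiPoly s n)
    (hw : Computes s env fun i => Val.table fun v => .num (w i v))
    (hk : Computes s env fun i => unary (k i)) (hkb : PolyBdd s k)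
    (hm : Computes s env fun i =>
      ofList ((members i).map fun ps => ofList (ps.map encodePiece)))
    (hmlen : QuasiPoly s fun i => (members i).length)
    (hplen : QuasiPoly (fun j : (i : ι) × {ps // ps ∈ members i} => s j.1) fun j => j.2.1.length)
    (hres : Computes s env fun i =>
      ofList ((res i).map fun x => .pair (encodeSet x.1) (encodeSet x.2)))
    (hlen : QuasiPoly s fun i => (res i).length)
    (hA : Computes s env fun i => ofList ((As i).map encodeSet))
    (hAlen : QuasiPoly s fun i => (As i).length) :
    Computes s env fun i => ofList ((solveAll (w i) (k i) (members i) (res i) (As i)).map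
      fun x => .pair (encodeSet x.1) (encodeSet x.2)) := by
  refine (map (f := fun i B => .pair (encodeSet B) (encodeSet (_root_.solveStep (w i) (k i)
    (members i) (_root_.assocLookup (res i)) B))) (e := fun _ => encodeSet) hA hAlen
    (pair top ?_)).congr fun i => by simp only [_root_.solveAll, List.map_map, Function.comp_def]
  refine solveStep (hn.weaken _ _) (hb.comp _) (hw.weaken _ _) (hk.weaken _ _)
    (hkb.comp _) (hm.weaken _ _) (hmlen.comp _) (hplen.comp fun j : (j : (i : ι) ×
      {A // A ∈ As i}) × {ps // ps ∈ members j.1} => ⟨j.1.1, j.2⟩) ?_ top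
  exact assocLookup (hn.weaken₂ _ _) ((hb.comp _).comp _) (hres.weaken₂ _ _)
    ((hlen.comp _).comp _) top

theorem solve {d : ι → ℕ} {A : ∀ i, Finset (Fin (n i))}
    (hn : Computes s env fun i => .num (n i)) (hb : QuasiPoly s n)
    (hw : Computes s env fun i => Val.table fun v => .num (w i v))
    (hk : Computes s env fun i => unary (k i)) (hkb : PolyBdd s k)
    (hm : Computes s env fun i =>
      ofList ((members i).map fun ps => ofList (ps.map encodePiece)))
    (hmlen : QuasiPoly s fun i => (members i).length)
    (hplen : QuasiPoly (fun j : (i : ι) × {ps // ps ∈ members i} => s j.1) fun j => j.2.1.length)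
    (hd : Computes s env fun i => unary (d i)) (hdb : PolyBdd s d)
    (hA : Computes s env fun i => encodeSet (A i)) :
    Computes s env fun i => encodeSet (solve (w i) (k i) (members i) (d i) (A i)) := by
  have hR : QuasiPoly s fun i => ((members i).flatMap fun ps => ps).length + 1 :=
    (QuasiPoly.length_flatMap (f := fun i ps => ps) hmlen hplen).add (.const 1)
  -- The number of instances on a level: the total number of pieces, raised to a polynomially
  -- bounded depth.
  have hB := hR.pow hdb
  have hL : Computes s env fun i => ofList ((levels (members i) (A i) (d i)).map
      fun As => ofList (As.map encodeSet)) := by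
    refine snd (iterate (σ := fun i j => .pair
      (ofList ((level (members i) (A i) j).map encodeSet))
      (ofList ((levels (members i) (A i) j).map fun As => ofList (As.map encodeSet)))) hd
      (.of_polyBdd hdb) (pair (cons hA nil) nil) ?_)
    refine pair ?_ (cons (fst top) (snd top))
    refine (subinstances (hn.weaken _ _) (hb.comp _) (hm.weaken _ _) (hmlen.comp _)
      (hplen.comp fun j : (j : (i : ι) × Fin (d i)) × {ps // ps ∈ members j.1} => ⟨j.1.1, j.2⟩)
      (As := fun j : (i : ι) × Fin (d i) => level (members j.1) (A j.1) j.2) (fst top)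
      ?_).congr fun j => by
        rw [level_succ]
    exact (hB.comp Sigma.fst).mono fun j => length_level_le _ _ j.2.2.le
  have hres : Computes s env fun i => ofList (((levels (members i) (A i) (d i)).foldl
      (_root_.solveAll (w i) (k i) (members i)) []).map
        fun x => .pair (encodeSet x.1) (encodeSet x.2)) := by
    refine foldl_of_invariant (A := fun i => List (Finset (Fin (n i)) × Finset (Fin (n i))))
      (eA := fun _ res => ofList (res.map fun x => .pair (encodeSet x.1) (encodeSet x.2)))
      (a₀ := fun _ => []) (f := fun i => _root_.solveAll (w i) (k i) (members i))
      (P := fun i res => res.length ≤ (((members i).flatMap fun ps => ps).length + 1) ^ d i)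
      hL ((QuasiPoly.of_polyBdd hdb).mono fun i => (length_levels _ _ _).le) nil
      (fun i => by simp) (fun i _ _ As h => ?_) ?_
    · rw [_root_.solveAll, List.length_map]
      exact length_le_of_mem_levels _ h
    · exact solveAll (hn.weaken _ _) (hb.comp _) (hw.weaken _ _) (hk.weaken _ _) (hkb.comp _)
        (hm.weaken _ _) (hmlen.comp _) (hplen.comp fun j : (j : (i : ι) ×
          {res : List (Finset (Fin (n i)) × Finset (Fin (n i))) //
            res.length ≤ (((members i).flatMap fun ps => ps).length + 1) ^ d i} ×
          {As // As ∈ levels (members i) (A i) (d i)}) × {ps // ps ∈ members j.1} => ⟨j.1.1, j.2⟩)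
        top.fst ((hB.comp Sigma.fst).mono fun j => j.2.1.2) top.snd
        ((hB.comp Sigma.fst).mono fun j => length_le_of_mem_levels _ j.2.2.2)
  refine (assocLookup hn hb hres ?_ hA).congr fun i => by rw [solve_eq_assocLookup]
  exact hB.mono fun i => length_foldl_levels _ _ _ _ _

end Computes

/-! ### Computing the pieces -/

theorem StripData.length_pieces_le {n : ℕ} (S : StripData n) :
    S.pieces.length ≤ S.m + (S.m * (S.m * 3) + S.m * (S.m * (S.m * 1))) := by
  have key : ∀ {α β : Type} (l : List α) (f : α → List β) (b : ℕ), (∀ x, (f x).length ≤ b) →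
      (l.flatMap f).length ≤ l.length * b := by
    intro α β l f b h
    induction l with
    | nil => simp
    | cons a l ih =>
      rw [List.flatMap_cons, List.length_append, List.length_cons, Nat.succ_mul]
      have := h a
      omega
  have hfin : (List.finRange S.m).length = S.m := List.length_finRange
  rw [pieces, List.length_append, List.length_append, List.length_map, hfin]
  refine Nat.add_le_add_left (Nat.add_le_add ?_ ?_) _
  · refine (key _ _ (S.m * 3) fun u => ?_).trans_eq (by rw [hfin])
    refine (key _ _ 3 fun v => ?_).trans_eq (by rw [hfin])
    unfold edgePieces
    split_ifs <;> simp
  · refine (key _ _ (S.m * (S.m * 1)) fun u => ?_).trans_eq (by rw [hfin])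
    refine (key _ _ (S.m * 1) fun v => ?_).trans_eq (by rw [hfin])
    refine (key _ _ 1 fun z => ?_).trans_eq (by rw [hfin])
    unfold trianglePieces
    split_ifs <;> simp

namespace Computes

open Val

variable {ι κ : Type*} {s : ι → ℕ} {env out : ι → Val}

theorem and_of {p q : ι → Prop} (hp : Computes s env fun i => flag (p i))
    (hq : Computes (fun i : {i // p i} => s i) (fun i => env i) fun i => flag (q i)) :
    Computes s env fun i => flag (p i ∧ q i) :=
  (ite hp (a := fun i => flag (q i)) (b := fun _ => .num 0) hq (num 0)).congr fun i => by
    by_cases h : p i <;> by_cases h' : q i <;> simp [flag, h, h']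

section

variable {n : ι → ℕ} {S : ∀ i, StripData (n i)} {u v z : ∀ i, Fin (S i).m}

theorem strip_m (hS : Computes s env fun i => encodeStrip (S i))
    (hm : QuasiPoly s fun i => (S i).m) : Computes s env fun i => .num (S i).m :=
  (length (l := fun i => List.finRange (S i).m) (hS.fst.congr fun i => table_eq _)
    (by simpa using hm)).congr fun i => by simp

theorem strip_vertex (hS : Computes s env fun i => encodeStrip (S i))
    (hm : QuasiPoly s fun i => (S i).m) (hu : Computes s env fun i => .num (u i)) :
    Computes s env fun i => encodeSet ((S i).η (.vertex (u i))) :=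
  lookup hS.fst hu hm

open Classical in
theorem strip_entry (hS : Computes s env fun i => encodeStrip (S i))
    (hm : QuasiPoly s fun i => (S i).m) (hu : Computes s env fun i => .num (u i))
    (hv : Computes s env fun i => .num (v i)) :
    Computes s env fun i => if (S i).H.Adj (u i) (v i) then
      Val.pair (encodeSet ((S i).η (.edge s(u i, v i)))) (encodeSet ((S i).ηEnd s(u i, v i) (u i)))
      else .num 0 :=
  lookup (lookup hS.snd.fst hu hm) hv hm

/-- The entry of the edge table is a pair for an edge of `H` and a number otherwise, so testing for
a pair decides adjacency. -/
theorem strip_adj (hS : Computes s env fun i => encodeStrip (S i))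
    (hm : QuasiPoly s fun i => (S i).m) (hu : Computes s env fun i => .num (u i))
    (hv : Computes s env fun i => .num (v i)) :
    Computes s env fun i => flag ((S i).H.Adj (u i) (v i)) :=
  (strip_entry hS hm hu hv).testPair.congr fun i => by
    by_cases h : (S i).H.Adj (u i) (v i) <;> simp [h, flag, Val.testPair]

theorem strip_edge (hS : Computes s env fun i => encodeStrip (S i))
    (hm : QuasiPoly s fun i => (S i).m) (hu : Computes s env fun i => .num (u i))
    (hv : Computes s env fun i => .num (v i)) (h : ∀ i, (S i).H.Adj (u i) (v i)) :
    Computes s env fun i => encodeSet ((S i).η (.edge s(u i, v i))) :=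
  (strip_entry hS hm hu hv).first.congr fun i => by rw [if_pos (h i)]; rfl

theorem strip_end (hS : Computes s env fun i => encodeStrip (S i))
    (hm : QuasiPoly s fun i => (S i).m) (hu : Computes s env fun i => .num (u i))
    (hv : Computes s env fun i => .num (v i)) (h : ∀ i, (S i).H.Adj (u i) (v i)) :
    Computes s env fun i => encodeSet ((S i).ηEnd s(u i, v i) (u i)) :=
  (strip_entry hS hm hu hv).second.congr fun i => by rw [if_pos (h i)]; rfl

/-- The end set at `v` is stored in the entry for the reversed pair. -/
theorem strip_end' (hS : Computes s env fun i => encodeStrip (S i))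
    (hm : QuasiPoly s fun i => (S i).m) (hu : Computes s env fun i => .num (u i))
    (hv : Computes s env fun i => .num (v i)) (h : ∀ i, (S i).H.Adj (u i) (v i)) :
    Computes s env fun i => encodeSet ((S i).ηEnd s(u i, v i) (v i)) :=
  (strip_end hS hm hv hu fun i => (h i).symm).congr fun i => by rw [Sym2.eq_swap]

open Classical in
theorem strip_triangle (hS : Computes s env fun i => encodeStrip (S i))
    (hm : QuasiPoly s fun i => (S i).m) (hu : Computes s env fun i => .num (u i))
    (hv : Computes s env fun i => .num (v i)) (hz : Computes s env fun i => .num (z i))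
    (h : ∀ i, (S i).H.Adj (u i) (v i) ∧ (S i).H.Adj (v i) (z i) ∧ (S i).H.Adj (u i) (z i)) :
    Computes s env fun i => encodeSet ((S i).η (.triangle {u i, v i, z i})) := by
  have h1 := lookup (lookup (lookup hS.snd.snd hu hm) hv hm) hz hm
  exact h1.congr fun i => by rw [if_pos (h i)]

theorem strip_trianglesAt (hn : Computes s env fun i => .num (n i)) (hb : QuasiPoly s n)
    (hS : Computes s env fun i => encodeStrip (S i))
    (hm : QuasiPoly s fun i => (S i).m) (hu : Computes s env fun i => .num (u i))
    (hv : Computes s env fun i => .num (v i)) (h : ∀ i, (S i).H.Adj (u i) (v i)) :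
    Computes s env fun i => encodeSet ((S i).trianglesAt (u i) (v i)) := by
  refine set hn hb ((exists_fin (n := fun j => (S j.1).m)
    (p := fun (j : (i : ι) × Fin (n i)) (z : Fin (S j.1).m) =>
      ((S j.1).H.Adj (v j.1) z ∧ (S j.1).H.Adj (u j.1) z) ∧
        j.2 ∈ (S j.1).η (.triangle {u j.1, v j.1, z}))
    ((strip_m hS hm).weaken Sigma.fst _) (hm.comp Sigma.fst) ?_).congr fun j => ?_)
  · have hm2 := (hm.comp (Sigma.fst (β := fun i => Fin (n i)))).comp
      (Sigma.fst (β := fun j => Fin (S j.1).m))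
    refine and_of ((strip_adj (hS.weaken₂ _ _) hm2 (hv.weaken₂ _ _) top).and
      (strip_adj (hS.weaken₂ _ _) hm2 (hu.weaken₂ _ _) top)) ?_
    let π : {j : (j : (i : ι) × Fin (n i)) × Fin (S j.1).m //
      (S j.1.1).H.Adj (v j.1.1) j.2 ∧ (S j.1.1).H.Adj (u j.1.1) j.2} → ι := fun j => j.1.1.1
    have hπ : ∀ {o : ι → Val}, Computes s env o → Computes (fun j => s (π j))
        (fun j => .pair (.pair (env (π j)) (.num j.1.1.2)) (.num j.1.2)) fun j => o (π j) :=
      fun ho => (fst (fst id)).comp (ho.reindex π)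
    exact mem (strip_triangle (hπ hS) (hm.comp π) (hπ hu) (hπ hv) top
      fun j => ⟨h (π j), j.2.1, j.2.2⟩) (hb.comp π) (fst id).snd
  · congr 1
    rw [StripData.mem_trianglesAt]
    refine propext ⟨fun ⟨z, ⟨h1, h2⟩, h3⟩ => ⟨_, SimpleGraph.is3Clique_iff.mpr
      ⟨_, _, z, h j.1, h2, h1, rfl⟩, by simp, by simp, h3⟩, fun ⟨T, hT, hu, hv, hx⟩ => ?_⟩
    -- A triangle through `u` and `v` is determined by its third vertex, so a search over single
    -- vertices suffices.
    obtain ⟨z, hz⟩ : ∃ z, T = {u j.1, v j.1, z} := by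
      have hc : (T \ {u j.1, v j.1}).card = 1 := by
        rw [Finset.card_sdiff_of_subset (by simp [Finset.insert_subset_iff, hu, hv]), hT.card_eq,
          Finset.card_pair (h j.1).ne]
      obtain ⟨z, hz⟩ := Finset.card_eq_one.mp hc
      refine ⟨z, Finset.ext fun y => ?_⟩
      have := Finset.ext_iff.mp hz y
      simp only [Finset.mem_sdiff, Finset.mem_insert, Finset.mem_singleton, not_or] at this ⊢
      by_cases h1 : y = u j.1
      · simp [h1, hu]
      · by_cases h2 : y = v j.1
        · simp [h2, hv]
        · simpa [h1, h2] using this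
    subst hz
    have := SimpleGraph.is3Clique_triple_iff.mp hT
    exact ⟨z, ⟨this.2.2, this.2.1⟩, hx⟩

theorem piece {p : ∀ i, Piece (n i)} (hitem : Computes s env fun i => flag ((p i).item = true))
    (h1 : Computes s env fun i => .num (p i).lab.1.1)
    (h2 : Computes s env fun i => .num (p i).lab.1.2)
    (h3 : Computes s env fun i => .num (p i).lab.2.1)
    (h4 : Computes s env fun i => .num (p i).lab.2.2)
    (hset : Computes s env fun i => encodeSet (p i).set) :
    Computes s env fun i => encodePiece (p i) :=
  hitem.pair (((h1.pair h2).pair (h3.pair h4)).pair hset)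

theorem flag_item_true : Computes s env fun _ => flag (true = true) :=
  (num 1).congr fun i => by simp [flag]

theorem flag_item_false : Computes s env fun _ => flag (false = true) :=
  (num 0).congr fun i => by simp [flag]

theorem edgePieces (hn : Computes s env fun i => .num (n i)) (hb : QuasiPoly s n)
    (hS : Computes s env fun i => encodeStrip (S i))
    (hm : QuasiPoly s fun i => (S i).m) (hu : Computes s env fun i => .num (u i))
    (hv : Computes s env fun i => .num (v i)) :
    Computes s env fun i => ofList (((S i).edgePieces (u i) (v i)).map encodePiece) := by
  refine (ite (strip_adj hS hm hu hv) (a := fun i => ofList ([(S i).botPiece (u i) (v i),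
    (S i).onePiece (u i) (v i), (S i).fullPiece (u i) (v i)].map encodePiece))
    (b := fun _ => ofList []) ?_ nil).congr fun i => ?_
  · replace hn := hn.reindex fun i : {i // (S i).H.Adj (u i) (v i)} => i.1
    replace hb := hb.comp fun i : {i // (S i).H.Adj (u i) (v i)} => i.1
    replace hS := hS.reindex fun i : {i // (S i).H.Adj (u i) (v i)} => i.1
    replace hm := hm.comp fun i : {i // (S i).H.Adj (u i) (v i)} => i.1
    replace hu := hu.reindex fun i : {i // (S i).H.Adj (u i) (v i)} => i.1
    replace hv := hv.reindex fun i : {i // (S i).H.Adj (u i) (v i)} => i.1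
    have h := fun i : {i // (S i).H.Adj (u i) (v i)} => i.2
    have hE := strip_edge hS hm hu hv h
    have hEu := strip_end hS hm hu hv h
    have hEv := strip_end' hS hm hu hv h
    have hU := strip_vertex hS hm hu
    have hV := strip_vertex hS hm hv
    refine cons (piece flag_item_false (num 0) (num 0) (num 0) (num 0) ?_)
      (cons (piece flag_item_true hu hu ?_ ?_ ?_) (cons (piece flag_item_true hu hu hv hv ?_) nil))
    · exact sdiff hn hb hE (union hn hb hEu hEv)
    · exact of_flag hu hv (le hu hv) (fun i h => by simpa [StripData.onePiece] using h)
        fun i h => by simpa [StripData.onePiece] using (not_le.mp h).le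
    · exact of_flag hv hu (le hu hv) (fun i h => by simpa [StripData.onePiece] using h)
        fun i h => by simpa [StripData.onePiece] using (not_le.mp h).le
    · exact union hn hb hU (sdiff hn hb hE hEv)
    · exact union hn hb (union hn hb (union hn hb hU hV) hE)
        (strip_trianglesAt hn hb hS hm hu hv h)
  · unfold StripData.edgePieces
    split_ifs <;> rfl

theorem trianglePieces (hS : Computes s env fun i => encodeStrip (S i))
    (hm : QuasiPoly s fun i => (S i).m) (hu : Computes s env fun i => .num (u i))
    (hv : Computes s env fun i => .num (v i)) (hz : Computes s env fun i => .num (z i)) :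
    Computes s env fun i =>
      ofList (((S i).trianglePieces (u i) (v i) (z i)).map encodePiece) := by
  refine (ite ((strip_adj hS hm hu hv).and ((strip_adj hS hm hv hz).and (strip_adj hS hm hu hz)))
    (a := fun i => ofList ([(S i).trianglePiece {u i, v i, z i}].map encodePiece))
    (b := fun _ => ofList []) ?_ nil).congr fun i => ?_
  · exact cons (piece flag_item_false (num 0) (num 0) (num 0) (num 0)
      (strip_triangle (hS.reindex _) (hm.comp _) (hu.reindex _) (hv.reindex _) (hz.reindex _)
        fun i => i.2)) nil
  · unfold StripData.trianglePieces
    split_ifs <;> rfl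

theorem flatMap_fin {Y : ι → Type*} {eY : ∀ i, Y i → Val} {m : ι → ℕ}
    {f : ∀ i, Fin (m i) → List (Y i)}
    (hn : Computes s env fun i => .num (m i)) (hb : QuasiPoly s m)
    (hflen : QuasiPoly (fun j : (i : ι) × Fin (m i) => s j.1) fun j => (f j.1 j.2).length)
    (hf : Computes (fun j : (i : ι) × Fin (m i) => s j.1)
      (fun j => .pair (env j.1) (.num j.2)) fun j => ofList ((f j.1 j.2).map (eY j.1))) :
    Computes s env fun i => ofList (((List.finRange (m i)).flatMap (f i)).map (eY i)) := by
  refine (flatMap (f := fun i v => (f i v).map (eY i)) (range hn hb) (by simpa using hb) ?_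
    (hf.reindex fun j : (i : ι) × {x // x ∈ List.finRange (m i)} => ⟨j.1, j.2.1⟩)).congr
    fun i => by rw [List.map_flatMap]
  simpa using hflen.comp fun j : (i : ι) × {x // x ∈ List.finRange (m i)} => ⟨j.1, j.2.1⟩

theorem length_flatMap_fin {Y : ι → Type*} {m : ι → ℕ}
    {f : ∀ i, Fin (m i) → List (Y i)} (hb : QuasiPoly s m)
    (hflen : QuasiPoly (fun j : (i : ι) × Fin (m i) => s j.1) fun j => (f j.1 j.2).length) :
    QuasiPoly s fun i => ((List.finRange (m i)).flatMap (f i)).length :=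
  QuasiPoly.length_flatMap (by simpa using hb)
    (hflen.comp fun j : (i : ι) × {x // x ∈ List.finRange (m i)} => ⟨j.1, j.2.1⟩)

theorem pieces (hn : Computes s env fun i => .num (n i)) (hb : QuasiPoly s n)
    (hS : Computes s env fun i => encodeStrip (S i))
    (hm : QuasiPoly s fun i => (S i).m) :
    Computes s env fun i => ofList ((S i).pieces.map encodePiece) := by
  have hmn := strip_m hS hm
  have hE : QuasiPoly (fun j : (j : (i : ι) × Fin (S i).m) × Fin (S j.1).m => s j.1.1)
      fun j => ((S j.1.1).edgePieces j.1.2 j.2).length :=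
    (QuasiPoly.const 3).mono fun j => by unfold StripData.edgePieces; split_ifs <;> simp
  have hT : QuasiPoly (fun j : (k : (j : (i : ι) × Fin (S i).m) × Fin (S j.1).m) ×
      Fin (S k.1.1).m => s j.1.1.1)
      fun j => ((S j.1.1.1).trianglePieces j.1.1.2 j.1.2 j.2).length :=
    (QuasiPoly.const 1).mono fun j => by unfold StripData.trianglePieces; split_ifs <;> simp
  have hm1 : QuasiPoly (fun j : (i : ι) × Fin (S i).m => s j.1) fun j => (S j.1).m := hm.comp _
  have hm2 : QuasiPoly (fun j : (j : (i : ι) × Fin (S i).m) × Fin (S j.1).m => s j.1.1)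
    fun j => (S j.1.1).m := hm1.comp _
  have h1 : Computes s env fun i =>
      ofList (((List.finRange (S i).m).map (S i).vertexPiece).map encodePiece) := by
    refine (map (f := fun i u => encodePiece ((S i).vertexPiece u)) (range hmn hm)
      (by simpa using hm) ?_).congr fun i => by rw [List.map_map]; rfl
    exact piece flag_item_false (num 0) (num 0) (num 0) (num 0)
      (strip_vertex (hS.weaken _ _) (hm.comp _) top)
  have h2 : Computes s env fun i => ofList (((List.finRange (S i).m).flatMap fun u =>
      (List.finRange (S i).m).flatMap fun v => (S i).edgePieces u v).map encodePiece) :=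
    flatMap_fin hmn hm (length_flatMap_fin hm1 hE)
      (flatMap_fin (hmn.weaken _ _) hm1 hE
        (edgePieces (hn.weaken₂ _ _) ((hb.comp _).comp _) (hS.weaken₂ _ _) hm2
          (snd (fst id)) top))
  have h3 : Computes s env fun i => ofList (((List.finRange (S i).m).flatMap fun u =>
      (List.finRange (S i).m).flatMap fun v => (List.finRange (S i).m).flatMap fun z =>
        (S i).trianglePieces u v z).map encodePiece) :=
    flatMap_fin hmn hm (length_flatMap_fin hm1 (length_flatMap_fin hm2 hT))
      (flatMap_fin (hmn.weaken _ _) hm1 (length_flatMap_fin hm2 hT)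
        (flatMap_fin (hmn.weaken₂ _ _) hm2 hT (trianglePieces (hS.weaken₃ _ _ _) (hm2.comp _)
          (snd (fst (fst id))) (snd (fst id)) top)))
  refine (append h1 (by simpa using hm) (append h2 ?_ h3)).congr fun i => by
    simp only [StripData.pieces, List.map_append]
  simpa only [List.length_map] using length_flatMap_fin hm (length_flatMap_fin hm1 hE)

end

end Computes

/-! ### The size of values -/

/-- The depth of a value as a tree. -/
def Val.depth : Val → ℕ
  | num _ => 0
  | pair a b => max a.depth b.depth + 1

/-- Pairing a value with itself doubles the number of nodes but adds only one to the depth. So it is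
the depth that grows at most linearly with time, and it still bounds the lengths of lists. -/
theorem Runs.depth_le {p : Code} {x y : Val} {t : ℕ} (h : Runs p x y t) :
    y.depth ≤ x.depth + t := by
  induction h with
  | lit => simp [Val.depth]
  | first x => cases x <;> simp only [Val.first, Val.depth] <;> omega
  | second x => cases x <;> simp only [Val.second, Val.depth] <;> omega
  | testPair x => cases x <;> simp [Val.testPair, Val.depth]
  | plus x =>
    unfold Val.plus
    split <;> simp [Val.depth]
  | minus x =>
    unfold Val.minus
    split <;> simp [Val.depth]
  | pair _ _ h1 h2 => simp only [Val.depth]; omega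
  | _ => omega

namespace Val

theorem length_le_depth (l : List Val) : l.length ≤ (ofList l).depth := by
  induction l with
  | nil => simp
  | cons a l ih => simp only [ofList, depth, List.length_cons]; omega

theorem depth_le_depth_of_mem {l : List Val} {a : Val} (h : a ∈ l) :
    a.depth ≤ (ofList l).depth := by
  induction l with
  | nil => simp at h
  | cons b l ih =>
    simp only [ofList, depth]
    rcases List.mem_cons.mp h with rfl | h
    · omega
    · have := ih h
      omega

theorem depth_table_le {n : ℕ} (f : Fin n → Val) {e : ℕ} (h : ∀ i, (f i).depth ≤ e) :
    (table f).depth ≤ n + e := by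
  have key : ∀ l : List Val, (∀ a ∈ l, a.depth ≤ e) → (ofList l).depth ≤ l.length + e := by
    intro l hl
    induction l with
    | nil => simp [ofList, depth]
    | cons a l ih =>
      have h1 := hl a List.mem_cons_self
      have h2 := ih fun b hb => hl b (List.mem_cons_of_mem _ hb)
      simp only [ofList, depth, List.length_cons]
      omega
  refine (key _ fun a ha => ?_).trans_eq (by rw [List.length_ofFn])
  obtain ⟨i, rfl⟩ := List.mem_ofFn.mp ha
  exact h i

theorem le_depth_table {n : ℕ} (f : Fin n → Val) : n ≤ (table f).depth :=
  (List.length_ofFn (f := f)).symm.le.trans (length_le_depth (List.ofFn f))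

end Val

theorem depth_encodeInput_le {n : ℕ} (q : ℚ) (G : SimpleGraph (Fin n)) (w : Fin n → ℕ) :
    (encodeInput q G w).depth ≤ 2 * n + 3 := by
  classical
  have h1 := Val.depth_table_le (fun u : Fin n => Val.table fun v : Fin n =>
    .num (if G.Adj u v then 1 else 0)) (e := n) fun u =>
      Val.depth_table_le _ (e := 0) fun _ => le_rfl
  have h2 := Val.depth_table_le (fun v => .num (w v)) (e := 0) fun _ => le_rfl
  simp only [encodeInput, Val.depth]
  convert_to max _ (max _ (max (Val.depth (Val.table fun u : Fin n => Val.table fun v : Fin n =>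
    .num (if G.Adj u v then 1 else 0))) _ + 1) + 1) + 1 ≤ _
  omega

section disperser

variable {n : ℕ} {D : List (Finset (Fin n) × StripData n)}

theorem length_le_depth_encodeDisperser : D.length ≤ (encodeDisperser D).depth :=
  List.length_map (fun d : Finset (Fin n) × StripData n =>
    Val.pair (encodeSet d.1) (encodeStrip d.2)) |>.symm.le.trans (Val.length_le_depth _)

/-- The definition of a disperser does not limit the order of `H`; the limit comes from the time
spent on writing its tables. -/
theorem m_le_depth_encodeDisperser {d : Finset (Fin n) × StripData n} (hd : d ∈ D) :
    d.2.m ≤ (encodeDisperser D).depth := by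
  refine le_trans ?_ (Val.depth_le_depth_of_mem (List.mem_map.mpr ⟨d, hd, rfl⟩))
  have := Val.le_depth_table fun u => encodeSet (d.2.η (.vertex u))
  simp only [encodeStrip, Val.depth]
  omega

end disperser

/-! ### The approximation scheme -/

/-- An input of the approximation scheme. -/
structure MWISInput (C : GraphClass) where
  ε : ℚ
  ε_pos : 0 < ε
  n : ℕ
  G : SimpleGraph (Fin n)
  mem : G ∈ C n
  w : Fin n → ℕ

namespace MWISInput

variable {C : GraphClass} (i : MWISInput C)

noncomputable def encode : Val := encodeInput i.ε i.G i.w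

/-- The inverse of the error, rounded up. -/
def m : ℕ := (i.ε.den + i.ε.num.toNat - 1) / i.ε.num.toNat

/-- The logarithm of the number of vertices. -/
def L : ℕ := Nat.clog 2 i.n

/-- The parameter of the running times. -/
def size : ℕ := i.L + i.m

/-- The inverse of the parameter `γ` of the disperser. -/
def K : ℕ := 16 * i.m * (2 * i.L + 4 * i.m + 1)

/-- A bound for the inverse of the parameter `δ` of the disperser. -/
def Δ (c : ℕ) : ℕ := c * (1 + i.L + i.K) ^ c

/-- The depth of the recursion. -/
def d (c : ℕ) : ℕ := i.Δ c * (2 * i.L + 4 * i.m + 1)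

/-- The inverse of the error of the local search. -/
def k (c : ℕ) : ℕ := 8 * i.m * (i.d c + 1)

theorem num_pos : 0 < i.ε.num.toNat := by
  have := Rat.num_pos.mpr i.ε_pos
  omega

theorem inv_ε : (i.ε : ℝ)⁻¹ = i.ε.den / i.ε.num.toNat := by
  have h : ((i.ε.num.toNat : ℤ) : ℝ) = (i.ε.num : ℝ) := by
    exact_mod_cast Int.toNat_of_nonneg (Rat.num_pos.mpr i.ε_pos).le
  conv_lhs => rw [Rat.cast_def, inv_div]
  rw [← h, Int.cast_natCast]

theorem inv_ε_le_m : (i.ε : ℝ)⁻¹ ≤ i.m := by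
  have h := i.num_pos
  rw [inv_ε, div_le_iff₀ (by exact_mod_cast h)]
  have : i.ε.den ≤ i.m * i.ε.num.toNat := by
    unfold m
    have := Nat.lt_div_mul_add h (a := i.ε.den + i.ε.num.toNat - 1)
    omega
  exact_mod_cast this

theorem m_le : (i.m : ℝ) ≤ (i.ε : ℝ)⁻¹ + 1 := by
  have h := i.num_pos
  have h' : (0 : ℝ) < i.ε.num.toNat := by exact_mod_cast h
  rw [inv_ε, div_add_one h'.ne', le_div_iff₀ h']
  have := Nat.div_mul_le_self (i.ε.den + i.ε.num.toNat - 1) i.ε.num.toNat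
  have : i.m * i.ε.num.toNat ≤ i.ε.den + i.ε.num.toNat := by unfold m; omega
  exact_mod_cast this

theorem m_pos : 0 < i.m := by
  have h : (0 : ℝ) < (i.ε : ℝ)⁻¹ := by have := i.ε_pos; positivity
  exact_mod_cast h.trans_le i.inv_ε_le_m

theorem n_le : i.n ≤ 2 ^ i.L := Nat.le_pow_clog (by norm_num) _

theorem log_le_L : Real.log i.n ≤ i.L := by
  rcases Nat.eq_zero_or_pos i.n with h | h
  · simp [h]
  · calc Real.log i.n ≤ Real.log ((2 : ℝ) ^ i.L) :=
          Real.log_le_log (by exact_mod_cast h) (by exact_mod_cast i.n_le)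
      _ = i.L * Real.log 2 := Real.log_pow _ _
      _ ≤ i.L * 1 := by
          gcongr
          linarith [Real.log_two_lt_d9]
      _ = i.L := mul_one _

/-- The factor absorbs `1 / log 2 < 2`, and rounding up costs at most one. -/
theorem L_le : (i.L : ℝ) ≤ 2 * Real.log i.n + 1 := by
  rcases Nat.eq_zero_or_pos i.n with h | h
  · simp [L, h]
  · have hlog : 0 ≤ Real.log i.n := Real.log_natCast_nonneg _
    have h2 : (0 : ℝ) < Real.log 2 := Real.log_pos (by norm_num)
    have h1 : Real.logb 2 i.n ≤ 2 * Real.log i.n := by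
      rw [Real.logb, div_le_iff₀ h2]
      nlinarith [Real.log_two_gt_d9]
    have h0 : 0 ≤ Real.logb 2 i.n := div_nonneg hlog h2.le
    have h3 := Nat.ceil_lt_add_one h0
    have h4 : ⌈Real.logb 2 i.n⌉₊ = i.L := by
      have := Real.natCeil_logb_natCast 2 i.n
      push_cast at this
      exact this
    rw [h4] at h3
    linarith

theorem polyLog_le_Δ (c : ℕ) : polyLog c i.n i.K ≤ i.Δ c := by
  have h := i.log_le_L
  have h' : 0 ≤ Real.log i.n := Real.log_natCast_nonneg _
  unfold polyLog Δ
  push_cast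
  gcongr

/-- The internal size parameter plus two is at most `4 (1 + log n + ε⁻¹)`, and the factor `4 ^ c` is
moved into the constant. -/
theorem two_pow_le (c : ℕ) : ((2 ^ (c * (i.size + 2) ^ c) : ℕ) : ℝ) ≤
    2 ^ polyLog (c * 4 ^ c) i.n (i.ε : ℝ)⁻¹ := by
  have h' : 0 ≤ Real.log i.n := Real.log_natCast_nonneg _
  have hε : (0 : ℝ) ≤ (i.ε : ℝ)⁻¹ := by have := i.ε_pos; positivity
  set x : ℝ := 1 + Real.log i.n + (i.ε : ℝ)⁻¹ with hx
  have h1 : ((i.size + 2 : ℕ) : ℝ) ≤ 4 * x := by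
    have := i.L_le
    have := i.m_le
    unfold size
    push_cast
    linarith
  have hc : c ≤ c * 4 ^ c := Nat.le_mul_of_pos_right _ (by positivity)
  push_cast
  rw [← Real.rpow_natCast]
  refine Real.rpow_le_rpow_of_exponent_le (by norm_num) ?_
  unfold polyLog
  push_cast at h1 ⊢
  rw [← hx]
  calc (c : ℝ) * (i.size + 2) ^ c ≤ c * (4 * x) ^ c := by gcongr
    _ = c * 4 ^ c * x ^ c := by rw [mul_pow, mul_assoc]
    _ ≤ c * 4 ^ c * x ^ (c * 4 ^ c) := by
        gcongr
        linarith

/-! ### Polynomial bounds for the parameters -/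

section bounds

theorem polyBdd_L : PolyBdd (size (C := C)) L := PolyBdd.self.mono fun _ => Nat.le_add_right _ _

theorem polyBdd_m : PolyBdd (size (C := C)) m := PolyBdd.self.mono fun _ => Nat.le_add_left _ _

theorem quasiPoly_n : QuasiPoly (size (C := C)) n := polyBdd_L.quasiPoly_two_pow.mono n_le

theorem polyBdd_aux : PolyBdd (size (C := C)) fun i => 2 * i.L + 4 * i.m + 1 :=
  (((PolyBdd.const 2).mul polyBdd_L).add ((PolyBdd.const 4).mul polyBdd_m)).add (.const 1)

theorem polyBdd_K : PolyBdd (size (C := C)) K := ((PolyBdd.const 16).mul polyBdd_m).mul polyBdd_aux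

theorem polyBdd_Δ (c : ℕ) : PolyBdd (size (C := C)) fun i => i.Δ c :=
  (PolyBdd.const c).mul ((((PolyBdd.const 1).add polyBdd_L).add polyBdd_K).pow c)

theorem polyBdd_d (c : ℕ) : PolyBdd (size (C := C)) fun i => i.d c :=
  (polyBdd_Δ c).mul polyBdd_aux

theorem polyBdd_k (c : ℕ) : PolyBdd (size (C := C)) fun i => i.k c :=
  ((PolyBdd.const 8).mul polyBdd_m).mul ((polyBdd_d c).add (.const 1))

end bounds

/-! ### Programs for the parameters and for the heavy vertices -/

section programs

open Computes

theorem computes_n : Computes (size (C := C)) encode fun i => .num i.n := id.second.first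

theorem computes_w : Computes (size (C := C)) encode fun i => Val.table fun v => .num (i.w v) :=
  id.second.second.second

theorem unary_m : Computes (size (C := C)) encode fun i => unary i.m :=
  unary_ceilDiv (s := size (C := C)) (env := encode) (a := fun i => i.ε.num.toNat)
    (b := fun i => i.ε.den) id.first.first id.first.second num_pos (.of_polyBdd polyBdd_m)

theorem unary_L : Computes (size (C := C)) encode fun i => unary i.L :=
  unary_clog computes_n (.of_polyBdd polyBdd_L)

theorem unary_aux : Computes (size (C := C)) encode fun i => unary (2 * i.L + 4 * i.m + 1) :=
  unary_add (unary_add (unary_mul (unary_const 2) (.const 2) unary_L (.of_polyBdd polyBdd_L))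
    (.of_polyBdd ((PolyBdd.const 2).mul polyBdd_L))
    (unary_mul (unary_const 4) (.const 4) unary_m (.of_polyBdd polyBdd_m)))
    (.of_polyBdd (((PolyBdd.const 2).mul polyBdd_L).add ((PolyBdd.const 4).mul polyBdd_m)))
    (unary_const 1)

theorem unary_K : Computes (size (C := C)) encode fun i => unary i.K :=
  unary_mul (unary_mul (unary_const 16) (.const 16) unary_m (.of_polyBdd polyBdd_m))
    (.of_polyBdd ((PolyBdd.const 16).mul polyBdd_m)) unary_aux (.of_polyBdd polyBdd_aux)

theorem unary_Δ (c : ℕ) : Computes (size (C := C)) encode fun i => unary (i.Δ c) :=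
  have h : PolyBdd (size (C := C)) fun i => 1 + i.L + i.K :=
    ((PolyBdd.const 1).add polyBdd_L).add polyBdd_K
  unary_mul (unary_const c) (.const c) (unary_pow (unary_add (unary_add (unary_const 1) (.const 1)
    unary_L) (.of_polyBdd ((PolyBdd.const 1).add polyBdd_L)) unary_K) h c) (.of_polyBdd (h.pow c))

theorem unary_d (c : ℕ) : Computes (size (C := C)) encode fun i => unary (i.d c) :=
  unary_mul (unary_Δ c) (.of_polyBdd (polyBdd_Δ c)) unary_aux (.of_polyBdd polyBdd_aux)

theorem unary_k (c : ℕ) : Computes (size (C := C)) encode fun i => unary (i.k c) :=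
  unary_mul (unary_mul (unary_const 8) (.const 8) unary_m (.of_polyBdd polyBdd_m))
    (.of_polyBdd ((PolyBdd.const 8).mul polyBdd_m))
    (unary_add (unary_d c) (.of_polyBdd (polyBdd_d c)) (unary_const 1))
    (.of_polyBdd ((polyBdd_d c).add (.const 1)))

theorem computes_heavyVertices : Computes (size (C := C)) encode fun i =>
    encodeSet (heavyVertices i.w (i.n * (4 * i.m))) := by
  have hw : ∀ {κ : Type} {π : κ → MWISInput C} {env : κ → Val} {u : ∀ j, Fin (π j).n},
      Computes (fun j => (π j).size) env (fun j => Val.table fun v => .num ((π j).w v)) →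
      Computes (fun j => (π j).size) env (fun j => .num (u j)) →
      Computes (fun j => (π j).size) env fun j => .num ((π j).w (u j)) := fun hw hu =>
    lookup (f := fun j v => .num (w _ v)) hw hu (quasiPoly_n.comp _)
  have h4 : Computes (size (C := C)) encode fun i => unary (4 * i.m) :=
    unary_mul (unary_const 4) (.const 4) unary_m (.of_polyBdd polyBdd_m)
  have h4b : QuasiPoly (size (C := C)) fun i => 4 * i.m :=
    .of_polyBdd ((PolyBdd.const 4).mul polyBdd_m)
  have hN : Computes (size (C := C)) encode fun i => unary (i.n * (4 * i.m)) :=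
    unary_mul (unary_of_num computes_n quasiPoly_n) quasiPoly_n h4 h4b
  have hNb := quasiPoly_n.mul h4b
  refine set computes_n quasiPoly_n ((((num 0).lt (hw (computes_w.weaken _ _) top)).and
    (forall_fin (p := fun j u => j.1.w u ≤ j.1.n * (4 * j.1.m) * j.1.w j.2)
      (computes_n.weaken _ _) (quasiPoly_n.comp _)
      (le (hw (computes_w.weaken₂ _ _) top) (mul_unary (hN.weaken₂ _ _) ((hNb.comp _).comp _)
        (hw (computes_w.weaken₂ _ _) (snd (fst id))))))).congr fun j => ?_)
  simp [heavyVertices]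

end programs

open Computes in
theorem admitsQPTAS (hdisp : QPDispersible C) : AdmitsQPTAS C := by
  obtain ⟨P, c, hP⟩ := hdisp
  -- This makes `γ = 1 / K` admissible, that is, less than `1 / 2`.
  have hK : ∀ i : MWISInput C, 2 < i.K := fun i => by
    have := i.m_pos
    unfold K
    nlinarith
  -- The parameter `γ` varies with the input, while `P` and `c` do not. Since `γ⁻¹ = K`, both `δ⁻¹`
  -- and the exponent of the running time are at most `Δ`.
  have key : ∀ i : MWISInput C, ∃ (D : List (Finset (Fin i.n) × StripData i.n)) (δ : ℝ) (t : ℕ),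
      Runs P (encodeInput (1 / (i.K : ℚ)) i.G i.w) (encodeDisperser D) t ∧ t ≤ 2 ^ i.Δ c ∧
      IsDisperser i.G i.w ((1 : ℝ) / i.K) δ D ∧ δ ≤ 1 ∧ 1 ≤ δ * i.Δ c := by
    intro i
    have hK0 : (2 : ℚ) < i.K := by exact_mod_cast hK i
    obtain ⟨δ, S, T, -, hδ, -, -, hδ', -, hT, hdis⟩ := hP (1 / (i.K : ℚ)) (by positivity) (by
      rw [div_lt_div_iff₀] <;> linarith)
    obtain ⟨D, t, hrun, ht, hD, -⟩ := hdis i.n i.G i.w i.mem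
    have hcast : ((1 / (i.K : ℚ) : ℚ) : ℝ) = 1 / i.K := by push_cast; rfl
    rw [hcast, one_div, inv_inv] at hδ' hT
    have hΔ := i.polyLog_le_Δ c
    refine ⟨D, δ i.n, t, hrun, ht.trans ?_, hcast ▸ hD, by linarith [(hδ i.n).2], ?_⟩
    · have := (hT i.n).trans (Real.rpow_le_rpow_of_exponent_le (by norm_num) hΔ)
      rw [Real.rpow_natCast] at this
      exact_mod_cast this
    · have h0 := (hδ i.n).1
      calc (1 : ℝ) = δ i.n * (δ i.n)⁻¹ := (mul_inv_cancel₀ h0.ne').symm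
        _ ≤ _ := by gcongr; exact (hδ' i.n).trans hΔ
  choose D δ t hrun ht hD hδ hδΔ using key
  have ht' : QuasiPoly (size (C := C)) t := (polyBdd_Δ c).quasiPoly_two_pow.mono ht
  have hDc : Computes (size (C := C)) encode fun i => encodeDisperser (D i) := by
    -- The input for `P` is the given one with `ε` replaced by `1 / K`, whose numerator and
    -- denominator are `1` and `K`.
    refine Computes.comp (mid := fun i => encodeInput (1 / (i.K : ℚ)) i.G i.w) ?_
      ⟨P, t, ht', fun i => ⟨t i, hrun i, le_rfl⟩⟩
    refine (pair (pair (num 1) (num_of_unary unary_K (.of_polyBdd polyBdd_K))) id.second).congr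
      fun i => ?_
    have h0 : i.K ≠ 0 := by have := hK i; omega
    have h1 : (1 / (i.K : ℚ)).num = 1 ∧ (1 / (i.K : ℚ)).den = i.K := by
      have h : 0 < i.K := Nat.pos_of_ne_zero h0
      rw [one_div]
      exact ⟨Rat.inv_natCast_num_of_pos h, Rat.inv_natCast_den_of_pos h⟩
    simp only [encode, encodeInput, Val.second, h1.1, h1.2, Int.toNat_one]
  -- The depth of the disperser is at most that of the input plus the running time of `P`. This
  -- bounds the number of members and the orders of the graphs `H`.
  have hdepth : QuasiPoly (size (C := C)) fun i => (encodeDisperser (D i)).depth :=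
    ((((QuasiPoly.const 2).mul quasiPoly_n).add (.const 3)).add ht').mono fun i =>
      (hrun i).depth_le.trans (Nat.add_le_add_right (depth_encodeInput_le _ _ _) _)
  have hDlen : QuasiPoly (size (C := C)) fun i => (D i).length :=
    hdepth.mono fun i => length_le_depth_encodeDisperser
  have hDm : QuasiPoly (fun j : (i : MWISInput C) × {x // x ∈ D i} => j.1.size)
      fun j => j.2.1.2.m :=
    (hdepth.comp Sigma.fst).mono fun j => m_le_depth_encodeDisperser j.2.2
  have hpieces : QuasiPoly (fun j : (i : MWISInput C) × {x // x ∈ D i} => j.1.size)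
      fun j => j.2.1.2.pieces.length :=
    (hDm.add ((hDm.mul (hDm.mul (.const 3))).add (hDm.mul (hDm.mul (hDm.mul (.const 1)))))).mono
      fun j => j.2.1.2.length_pieces_le
  have hmem : Computes (size (C := C)) encode fun i => Val.ofList
      (((D i).map fun d => d.2.pieces).map fun ps => Val.ofList (ps.map encodePiece)) := by
    refine (Computes.map (f := fun i d => Val.ofList (d.2.pieces.map encodePiece)) hDc hDlen
      (Computes.pieces (computes_n.weaken _ _) (quasiPoly_n.comp _) top.second hDm)).congr
        fun i => by
        rw [List.map_map]; rfl
  obtain ⟨Q, T, ⟨c', hT⟩, hQ⟩ := Computes.solve (d := fun i : MWISInput C => i.d c + 1) computes_n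
    quasiPoly_n computes_w (unary_k c) (polyBdd_k c) hmem (by simpa using hDlen)
    (by
      obtain ⟨e, he⟩ := hpieces
      refine ⟨e, fun j => ?_⟩
      obtain ⟨x, hx, h⟩ := List.mem_map.mp j.2.2
      exact (congrArg List.length h).symm.le.trans (he ⟨j.1, x, hx⟩))
    (unary_add (a := fun i : MWISInput C => i.d c) (unary_d c) (.of_polyBdd (polyBdd_d c))
      (unary_const 1)) ((polyBdd_d c).add (.const 1)) computes_heavyVertices
  refine ⟨Q, c' * 4 ^ c', fun ε hε n G w hG => ?_⟩
  set i : MWISInput C := ⟨ε, hε, n, G, hG, w⟩ with hi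
  obtain ⟨t', hrun', ht''⟩ := hQ i
  refine ⟨_, t', hrun', ?_, ?_, fun J hJ => ?_⟩
  · refine le_trans ?_ (i.two_pow_le c')
    exact_mod_cast ht''.trans (hT i)
  · refine (solve_spec (by have := i.m_pos; unfold k; positivity) (fun ps hps => ?_) _ _).2
    obtain ⟨x, hx, rfl⟩ := List.mem_map.mp hps
    exact ⟨x.2, x.1ᶜ, (hD i).1 x hx, rfl⟩
  · have hm := i.m_pos
    -- The guarantee is `1 - 1 / m`, and `1 / m ≤ ε` because `m` is `ε⁻¹` rounded up.
    have h1 := solve_heavyVertices (hD i) (hδ i) hm i.log_le_L rfl (d := i.d c) ?_ rfl hJ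
    · refine le_trans ?_ h1
      gcongr
      have := i.inv_ε_le_m
      rw [one_div]
      exact inv_le_of_inv_le₀ (by exact_mod_cast hε) this
    · have h2 := mul_le_mul_of_nonneg_right (hδΔ i)
        (by positivity : (0 : ℝ) ≤ 2 * i.L + 4 * i.m + 1)
      unfold d
      push_cast
      linarith

end MWISInput

theorem theorem5 (C : GraphClass) (hC : C.Hereditary) (hdisp : QPDispersible C) :
    AdmitsQPTAS C :=
  MWISInput.admitsQPTAS hdisp
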